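/- **Theorem (Uniqueness).** Let $\Omega\subset\mathbb{R}^N$ be a bounded domain (a non-empty, open, connected, bounded set), let $T>0$, let $p\in(1,\infty]$ and let $q\in[1,\infty)$ be its conjugate exponent, $\frac1p+\frac1q=1$. Let $$u\in L^1(0,T;W_0^{1,q}(\Omega;\mathbb{R}^N))\cap L^1(0,T;C(\overline\Omega;\mathbb{R}^N))$$ be divergence-free in the weak sense: for almost every $t\in(0,T)$, $\int_\Omega u(t)\cdot\nabla\varphi\,dx=0$ for every $\varphi\in C_c^\infty(\Omega)$. Here $W_0^{1,q}(\Omega)$ is the closure of the test functions $C_c^\infty(\Omega)$ in the norm of $W^{1,q}(\Omega)$. Let $\rho\in L^\infty(0,T;L^p(\Omega))$, that is, $\rho$ is measurable on $(0,T)\times\Omega$ and $\operatorname{ess\,sup}_{t\in(0,T)}\|\rho(t)\|_{L^p(\Omega)}<\infty$. Assume that $\rho$ is a weak solution of $$\rho_t-u\cdot\nabla\rho=0\ \text{ in }(0,T)\times\Omega,\qquad \rho(0)=\rho_0$$ with $\rho_0\equiv0$, where a weak solution with initial density $\rho_0\in L^p(\Omega)$ is one that satisfies $$-\int_0^T\!\int_\Omega\rho\,\phi_t\,dx\,dt-\int_\Omega\rho_0(x)\,\phi(0,x)\,dx+\int_0^T\!\int_\Omega\rho\,(u\cdot\nabla\phi)\,dx\,dt=0$$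 for every $\phi\in C_c^\infty([0,T)\times\Omega)$. Then $\rho\equiv0$: for almost every $t\in(0,T)$, $\rho(t,x)=0$ for almost every $x\in\Omega$. -/

import Mathlib

open MeasureTheory Filter Topology
open scoped ENNReal NNReal ContDiff BoundedContinuousFunction

namespace Transport

/-- The Euclidean space `ℝ^N`. -/
abbrev Space (N : ℕ) : Type := EuclideanSpace ℝ (Fin N)

/-- Bounded domains of `ℝ^N`: non-empty connected bounded open sets. -/
structure IsBoundedDomain {N : ℕ} (Ω : Set (Space N)) : Prop where
  isOpen : IsOpen Ω
  isConnected : IsConnected Ω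
  isBounded : Bornology.IsBounded Ω

/-- Lebesgue measure on the time interval `(0,T)`. -/
noncomputable abbrev timeMeasure (T : ℝ) : Measure ℝ := volume.restrict (Set.Ioo 0 T)

/-- Lebesgue measure on `Ω`. -/
noncomputable abbrev spaceMeasure {N : ℕ} (Ω : Set (Space N)) : Measure (Space N) :=
  volume.restrict Ω

/-- Test functions on `Ω` with values in `F`: the class `C_c^∞(Ω; F)`. -/
structure IsTestFunction {N : ℕ} {F : Type*} [NormedAddCommGroup F] [NormedSpace ℝ F]
    (Ω : Set (Space N)) (φ : Space N → F) : Prop where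
  contDiff : ContDiff ℝ ∞ φ
  hasCompactSupport : HasCompactSupport φ
  tsupport_subset : tsupport φ ⊆ Ω

/-- Test functions in `C_c^∞([0,T) × Ω)`. They are given through their smooth extensions to
negative times, so `φ` need not vanish at `t = 0`, but it vanishes for `t` near `T`. -/
structure IsSpaceTimeTestFunction {N : ℕ} (T : ℝ) (Ω : Set (Space N))
    (φ : ℝ × Space N → ℝ) : Prop where
  contDiff : ContDiff ℝ ∞ φ
  hasCompactSupport : HasCompactSupport φ
  tsupport_subset : tsupport φ ⊆ Set.Iio T ×ˢ Ω

/-- The classical partial derivative `∂φ/∂x_i` at `x`. -/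
noncomputable def partialDeriv {N : ℕ} {F : Type*} [NormedAddCommGroup F] [NormedSpace ℝ F]
    (i : Fin N) (φ : Space N → F) (x : Space N) : F :=
  fderiv ℝ φ x (EuclideanSpace.single i 1)

/-- `G i` is the weak partial derivative `∂v/∂x_i` of the vector field `v` on `Ω`, for every `i`:
`∫_Ω (∂φ/∂x_i) v = - ∫_Ω φ (G i)` for all `φ ∈ C_c^∞(Ω)`. -/
structure IsWeakGradient {N : ℕ} (Ω : Set (Space N)) (v : Space N → Space N)
    (G : Fin N → Space N → Space N) : Prop where
  locallyIntegrableOn : LocallyIntegrableOn v Ω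
  locallyIntegrableOn_deriv : ∀ i, LocallyIntegrableOn (G i) Ω
  integral_eq : ∀ i, ∀ φ : Space N → ℝ, IsTestFunction Ω φ →
    ∫ x in Ω, partialDeriv i φ x • v x = - ∫ x in Ω, φ x • G i x

/-- The norm of `W^{1,q}(Ω; ℝ^N)`, for a field `v` with weak partial derivatives `G i`. -/
noncomputable def sobolevNorm {N : ℕ} (Ω : Set (Space N)) (q : ℝ≥0∞) (v : Space N → Space N)
    (G : Fin N → Space N → Space N) : ℝ≥0∞ :=
  eLpNorm v q (spaceMeasure Ω) + ∑ i, eLpNorm (G i) q (spaceMeasure Ω)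

/-- `v ∈ W_0^{1,q}(Ω; ℝ^N)`, with weak partial derivatives `G i`: the field `v` belongs to
`W^{1,q}(Ω)` and is a limit of test functions in the norm of `W^{1,q}(Ω)`. -/
structure MemSobolevZero {N : ℕ} (Ω : Set (Space N)) (q : ℝ≥0∞) (v : Space N → Space N)
    (G : Fin N → Space N → Space N) : Prop where
  memLp : MemLp v q (spaceMeasure Ω)
  memLp_deriv : ∀ i, MemLp (G i) q (spaceMeasure Ω)
  isWeakGradient : IsWeakGradient Ω v G
  exists_approx : ∃ φ : ℕ → Space N → Space N, (∀ n, IsTestFunction Ω (φ n)) ∧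
    Tendsto (fun n => sobolevNorm Ω q (fun x => v x - φ n x)
      (fun i x => G i x - partialDeriv i (φ n) x)) atTop (𝓝 0)

/-- `u ∈ L^1(0,T; W_0^{1,q}(Ω))`: the field `u` and its weak spatial derivatives are measurable on
`(0,T) × Ω`, `u(t) ∈ W_0^{1,q}(Ω)` for a.e. `t`, and `∫_0^T ‖u(t)‖_{W^{1,q}} dt < ∞`. -/
def MemL1SobolevZero {N : ℕ} (T : ℝ) (Ω : Set (Space N)) (q : ℝ≥0∞)
    (u : ℝ → Space N → Space N) : Prop :=
  AEStronglyMeasurable (fun z : ℝ × Space N => u z.1 z.2)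
      ((timeMeasure T).prod (spaceMeasure Ω)) ∧
    ∃ G : ℝ → Fin N → Space N → Space N,
      (∀ i, AEStronglyMeasurable (fun z : ℝ × Space N => G z.1 i z.2)
        ((timeMeasure T).prod (spaceMeasure Ω))) ∧
      (∀ᵐ t ∂timeMeasure T, MemSobolevZero Ω q (u t) (G t)) ∧
      ∫⁻ t, sobolevNorm Ω q (u t) (G t) ∂timeMeasure T < ⊤

/-- `u ∈ L^1(0,T; C(Ω̄))`: up to null sets, `u` is a Bochner integrable map from `(0,T)` to the
space of continuous fields on `Ω̄` with the supremum norm. (For bounded `Ω` the closure is compact,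
so all continuous fields on it are bounded.) -/
def MemL1ContinuousClosure {N : ℕ} (T : ℝ) (Ω : Set (Space N))
    (u : ℝ → Space N → Space N) : Prop :=
  ∃ w : ℝ → (closure Ω →ᵇ Space N), Integrable w (timeMeasure T) ∧
    ∀ᵐ t ∂timeMeasure T, ∀ᵐ x ∂spaceMeasure Ω,
      ∀ hx : x ∈ Ω, u t x = w t ⟨x, subset_closure hx⟩

/-- `∇ · v = 0` on `Ω` in the weak sense; `fderiv ℝ φ x (v x)` is `v(x) · ∇φ(x)`. -/
def IsWeaklyDivFree {N : ℕ} (Ω : Set (Space N)) (v : Space N → Space N) : Prop :=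
  ∀ φ : Space N → ℝ, IsTestFunction Ω φ → ∫ x in Ω, fderiv ℝ φ x (v x) = 0

/-- `ρ ∈ L^∞(0,T; L^p(Ω))`: `ρ` is measurable on `(0,T) × Ω`, and `‖ρ(t)‖_p` is essentially
bounded in `t`. -/
def MemLinftyLp {N : ℕ} (T : ℝ) (Ω : Set (Space N)) (p : ℝ≥0∞)
    (ρ : ℝ → Space N → ℝ) : Prop :=
  AEStronglyMeasurable (fun z : ℝ × Space N => ρ z.1 z.2)
      ((timeMeasure T).prod (spaceMeasure Ω)) ∧
    ∃ C : ℝ≥0, ∀ᵐ t ∂timeMeasure T, eLpNorm (ρ t) p (spaceMeasure Ω) ≤ C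

/-- `ρ ∈ L^∞(0,T; L^p(Ω))` is a weak solution of `ρ_t - u · ∇ρ = 0` in `(0,T) × Ω`, `ρ(0) = ρ₀`. -/
structure IsWeakSolution {N : ℕ} (T : ℝ) (Ω : Set (Space N)) (p : ℝ≥0∞)
    (u : ℝ → Space N → Space N) (ρ₀ : Space N → ℝ) (ρ : ℝ → Space N → ℝ) : Prop where
  memLp_init : MemLp ρ₀ p (spaceMeasure Ω)
  memLinftyLp : MemLinftyLp T Ω p ρ
  weak_eq : ∀ φ : ℝ × Space N → ℝ, IsSpaceTimeTestFunction T Ω φ →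
    - (∫ t in Set.Ioo 0 T, ∫ x in Ω, ρ t x * deriv (fun s => φ (s, x)) t)
      - (∫ x in Ω, ρ₀ x * φ (0, x))
      + (∫ t in Set.Ioo 0 T, ∫ x in Ω, ρ t x * fderiv ℝ (fun y => φ (t, y)) x (u t x)) = 0

end Transport

set_option linter.unusedSectionVars false

/-! Put β(s) = s²/(1+s²), `saturation`, which is bounded by 1 and vanishes only at 0. Formally β(ρ)
solves the same equation, so div u = 0 and the zero initial value give, for a time-independent
cutoff 0 ≤ ψ ≤ 1 on Ω, ∫∫ ψ β(ρ) ≤ T ∫∫ |u| |∇ψ|. Hence ρ = 0 as soon as cutoffs of arbitrarily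
small flux ∫∫ |u| |∇ψ| dominate any given cutoff (`ae_eq_zero_of_cutoff`). Two things must be
proved: the inequality, and the existence of the cutoffs.

The inequality (`lintegral_saturation_le`) follows DiPerna and Lions. Mollify ρ in space at scale ε.
For fixed x the mollified density is a primitive in time of the mollified flux, so the chain rule is
one-dimensional. Replacing the flux by u·∇ρ_ε costs a commutator, which div u = 0 writes through
increments of both ρ and u; its L¹ norm is at most ∫ |∇m(h)| ∫ |ρ(x-h)-ρ(x)| |u(x-h)-u(x)| dx dh
(`incrementPairing`). The factor |h| supplied by the increment of u balances the size of ∇m, whence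
a bound by ‖ρ‖_p ‖∇u‖_q uniform in ε. For a Lipschitz field the pairing tends to 0 because
translations are continuous in L¹, which is available also for p = ∞ since Ω is bounded. Density of
test functions in W_0^{1,q} gives convergence for u(t) itself
(`MemSobolevZero.tendsto_incrementPairing`); membership in W_0^{1,q} also permits extension by zero.

For the cutoffs (`exists_cutoff`), no regularity of ∂Ω is available, so the role of the distance to
the boundary is played by the time-averaged speed U(x) = ∫ |u(t,x)| dt. The flux of ζ is ∫ U |∇ζ|.
For a smooth function ζ of U/ε that changes only where U is comparable to ε, it is of order ∫_{U ~
ε} |∇U|, and this tends to 0 with ε: ∇U is integrable, and each point leaves the sets {U ~ ε}. As U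
is not a test function, it is replaced by a test function V close to it with gradient controlled in
L¹ (`exists_testFunction_near_average`). A given ψ is then added where the truncation of V is below
1; there U is small, so ∇ψ costs little. -/

namespace Transport

/-! ### Translations in Lebesgue spaces -/

section Translation

variable {E F : Type*} [NormedAddCommGroup E] [NormedSpace ℝ E] [FiniteDimensional ℝ E]
  [MeasurableSpace E] [BorelSpace E] {μ : Measure E} [μ.IsAddHaarMeasure]
  [NormedAddCommGroup F]

lemma measurePreserving_sub_const (h : E) : MeasurePreserving (fun x : E => x - h) μ μ := by
  simpa [sub_eq_add_neg] using measurePreserving_add_right μ (-h)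

lemma eLpNorm_translate {a : E → F} (ha : AEStronglyMeasurable a μ) (p : ℝ≥0∞) (h : E) :
    eLpNorm (fun x => a (x - h)) p μ = eLpNorm a p μ :=
  eLpNorm_comp_measurePreserving (f := fun x : E => x - h) ha (measurePreserving_sub_const h)

/-- Translations act continuously on integrable functions. -/
lemma tendsto_lintegral_translate_sub {a : E → F} (ha : Integrable a μ) :
    Tendsto (fun h => ∫⁻ x, ‖a (x - h) - a x‖ₑ ∂μ) (𝓝 0) (𝓝 0) := by
  let f : Lp F 1 μ := ha.toL1 a
  let g : E → C(E, E) := fun h => ⟨fun x => x - h, by fun_prop⟩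
  have hg : Continuous g :=
    (ContinuousMap.curry ⟨fun z : E × E => z.2 - z.1, by fun_prop⟩).continuous
  have hmp : ∀ h, MeasurePreserving (g h) μ μ := fun h => measurePreserving_sub_const h
  have hc : Continuous fun h => Lp.compMeasurePreserving (g h) (hmp h) f :=
    Continuous.compMeasurePreservingLp continuous_const hg hmp (by simp)
  have h0 : Tendsto (fun h => edist (Lp.compMeasurePreserving (g h) (hmp h) f)
      (Lp.compMeasurePreserving (g 0) (hmp 0) f)) (𝓝 0) (𝓝 0) := by
    have := (hc.tendsto 0).edist (tendsto_const_nhds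
      (x := Lp.compMeasurePreserving (g 0) (hmp 0) f))
    simpa using this
  refine h0.congr fun h => ?_
  have key : ∀ h, (Lp.compMeasurePreserving (g h) (hmp h) f : E → F) =ᵐ[μ] fun x => a (x - h) :=
    fun h => (Lp.coeFn_compMeasurePreserving f (hmp h)).trans
      ((hmp h).quasiMeasurePreserving.ae_eq_comp ha.coeFn_toL1)
  rw [Lp.edist_def, eLpNorm_one_eq_lintegral_enorm]
  refine lintegral_congr_ae ?_
  filter_upwards [key h, key 0] with x h1 h2
  rw [Pi.sub_apply, h1, h2, sub_zero]

lemma lintegral_translate_sub_le {a : E → F} (ha : AEStronglyMeasurable a μ) (h : E) :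
    ∫⁻ x, ‖a (x - h) - a x‖ₑ ∂μ ≤ 2 * ∫⁻ x, ‖a x‖ₑ ∂μ := by
  have hm : AEStronglyMeasurable (fun x => a (x - h)) μ :=
    ha.comp_measurePreserving (measurePreserving_sub_const h)
  calc ∫⁻ x, ‖a (x - h) - a x‖ₑ ∂μ
      ≤ ∫⁻ x, ‖a (x - h)‖ₑ + ‖a x‖ₑ ∂μ := lintegral_mono fun x => enorm_sub_le
    _ = 2 * ∫⁻ x, ‖a x‖ₑ ∂μ := by
      rw [lintegral_add_left' hm.enorm, lintegral_sub_right_eq_self (fun x => ‖a x‖ₑ) h, two_mul]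

end Translation

/-! ### Mollifiers with scale-invariant gradient bounds -/

/-- A smooth mollifier at scale `ε`, with a scale invariant bound on its derivative. -/
structure IsMollifier {N : ℕ} (m : Space N → ℝ) (ε : ℝ) (C : ℝ) : Prop where
  contDiff : ContDiff ℝ ∞ m
  nonneg : ∀ h, 0 ≤ m h
  tsupport_subset : tsupport m ⊆ Metric.closedBall 0 ε
  integral_eq_one : ∫ h, m h = 1
  integral_norm_mul_fderiv_le : ∫ h, ‖h‖ * ‖fderiv ℝ m h‖ ≤ C

/-- Rescaling a fixed bump to ε^{-d} m₀(h/ε) multiplies the gradient by 1/ε, and the weight ‖h‖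
contributes ε. The weighted integral is therefore the same at every scale, and C is chosen before ε.
-/
lemma exists_isMollifier (N : ℕ) :
    ∃ C : ℝ, ∀ ε : ℝ, 0 < ε → ∃ m : Space N → ℝ, IsMollifier m ε C := by
  let b : ContDiffBump (0 : Space N) := ⟨1 / 2, 1, by norm_num, by norm_num⟩
  let m₀ : Space N → ℝ := b.normed volume
  have hm₀ : ContDiff ℝ ∞ m₀ := b.contDiff_normed
  refine ⟨∫ h, ‖h‖ * ‖fderiv ℝ m₀ h‖, fun ε hε => ?_⟩
  set l : ℝ := ε⁻¹ with hl
  have hl0 : 0 < l := inv_pos.2 hε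
  set d := Module.finrank ℝ (Space N)
  have hd : ∀ h, HasFDerivAt (fun h => l ^ d * m₀ (l • h))
      (l ^ d • (l • fderiv ℝ m₀ (l • h))) h := by
    intro h
    have h1 : HasFDerivAt m₀ (fderiv ℝ m₀ (l • h)) (l • h) :=
      (hm₀.differentiable (by simp) _).hasFDerivAt
    have h2 : HasFDerivAt (fun h : Space N => l • h) (l • ContinuousLinearMap.id ℝ (Space N)) h :=
      (hasFDerivAt_id h).const_smul l
    have h3 := (h1.comp h h2).const_mul (l ^ d)
    convert! h3 using 1
    ext v
    simp
  refine ⟨fun h => l ^ d * m₀ (l • h), ?_, ?_, ?_, ?_, ?_⟩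
  · exact contDiff_const.mul (hm₀.comp (contDiff_const_smul l))
  · intro h
    have := b.nonneg_normed (μ := volume) (l • h)
    positivity
  · refine closure_minimal ?_ Metric.isClosed_closedBall
    intro h hh
    have h1 : m₀ (l • h) ≠ 0 := fun h0 => hh (by simp [h0])
    have h2 : l • h ∈ Metric.ball (0 : Space N) 1 := by
      have : l • h ∈ Function.support (b.normed volume) := h1
      rwa [b.support_normed_eq] at this
    rw [mem_ball_zero_iff, norm_smul, Real.norm_of_nonneg hl0.le] at h2
    rw [mem_closedBall_zero_iff]
    have : ε * (l * ‖h‖) = ‖h‖ := by rw [hl]; field_simp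
    nlinarith
  · rw [integral_const_mul, Measure.integral_comp_smul, b.integral_normed]
    rw [abs_of_pos (by positivity)]
    simp only [smul_eq_mul, mul_one]
    exact mul_inv_cancel₀ (by positivity)
  · have : ∀ h, ‖h‖ * ‖fderiv ℝ (fun h => l ^ d * m₀ (l • h)) h‖
        = l ^ d * (‖l • h‖ * ‖fderiv ℝ m₀ (l • h)‖) := by
      intro h
      rw [(hd h).fderiv, norm_smul, norm_smul, norm_smul, Real.norm_of_nonneg hl0.le,
        Real.norm_of_nonneg (by positivity)]
      ring
    simp_rw [this]
    rw [integral_const_mul, Measure.integral_comp_smul volume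
      (fun z => ‖z‖ * ‖fderiv ℝ m₀ z‖) l, abs_of_pos (by positivity), smul_eq_mul,
      mul_inv_cancel_left₀ (by positivity)]

namespace IsMollifier

variable {N : ℕ} {m : Space N → ℝ} {ε C : ℝ}

lemma hasCompactSupport (hm : IsMollifier m ε C) : HasCompactSupport m :=
  (isCompact_closedBall 0 ε).of_isClosed_subset (isClosed_tsupport m) hm.tsupport_subset

lemma continuous_fderiv (hm : IsMollifier m ε C) : Continuous (fderiv ℝ m) :=
  hm.contDiff.continuous_fderiv (by simp)

lemma fderiv_eq_zero (hm : IsMollifier m ε C) {h : Space N} (hh : ε < ‖h‖) :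
    fderiv ℝ m h = 0 := by
  refine image_eq_zero_of_notMem_tsupport fun h' => ?_
  have := hm.tsupport_subset (tsupport_fderiv_subset ℝ h')
  rw [mem_closedBall_zero_iff] at this
  linarith

lemma lintegral_enorm_mul_fderiv_le (hm : IsMollifier m ε C) :
    ∫⁻ h, ‖h‖ₑ * ‖fderiv ℝ m h‖ₑ ≤ ENNReal.ofReal C := by
  have hc : Continuous fun h : Space N => ‖h‖ * ‖fderiv ℝ m h‖ :=
    continuous_norm.mul hm.continuous_fderiv.norm
  have hs : HasCompactSupport fun h : Space N => ‖h‖ * ‖fderiv ℝ m h‖ :=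
    (hm.hasCompactSupport.fderiv ℝ).norm.mul_left
  have hi := hc.integrable_of_hasCompactSupport hs (μ := volume)
  refine le_trans (le_of_eq ?_) (ENNReal.ofReal_le_ofReal hm.integral_norm_mul_fderiv_le)
  rw [ofReal_integral_eq_lintegral_ofReal hi (ae_of_all _ fun h => by positivity)]
  refine lintegral_congr fun h => ?_
  rw [ENNReal.ofReal_mul (norm_nonneg _), ofReal_norm, ofReal_norm]

lemma lintegral_enorm_fderiv_lt_top (hm : IsMollifier m ε C) :
    ∫⁻ h, ‖fderiv ℝ m h‖ₑ < ⊤ :=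
  (hm.continuous_fderiv.integrable_of_hasCompactSupport
    (hm.hasCompactSupport.fderiv ℝ) (μ := volume)).2

end IsMollifier

/-! ### Increment pairings and their bounds -/

section IncrementPairing

variable {E F : Type*} [NormedAddCommGroup E] [NormedSpace ℝ E] [FiniteDimensional ℝ E]
  [MeasureSpace E] [BorelSpace E] [(volume : Measure E).IsAddHaarMeasure]
  [NormedAddCommGroup F] [NormedSpace ℝ F] [MeasurableSpace F] [BorelSpace F]
  [SecondCountableTopology F]

lemma lintegral_enorm_mul_enorm_le {α : Type*} [MeasurableSpace α] {μ : Measure α} {p q : ℝ≥0∞}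
    [p.HolderConjugate q] {a : α → ℝ} {v : α → F} (ha : AEStronglyMeasurable a μ)
    (hv : AEStronglyMeasurable v μ) :
    ∫⁻ x, ‖a x‖ₑ * ‖v x‖ₑ ∂μ ≤ eLpNorm a p μ * eLpNorm v q μ := by
  have := eLpNorm_smul_le_mul_eLpNorm (p := p) (q := q) (r := 1) hv ha
  rw [eLpNorm_one_eq_lintegral_enorm] at this
  simpa [enorm_smul] using this

lemma enorm_sub_le_lintegral_fderiv {φ : E → F} (hφ : ContDiff ℝ 1 φ) (x h : E) :
    ‖φ (x - h) - φ x‖ₑ ≤ ∫⁻ s in Set.Icc (0 : ℝ) 1, ‖fderiv ℝ φ (x - s • h)‖ₑ * ‖h‖ₑ := by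
  have hd : ∀ s : ℝ, HasDerivAt (fun s : ℝ => φ (x - s • h)) (fderiv ℝ φ (x - s • h) (-h)) s := by
    intro s
    have h1 : HasFDerivAt φ (fderiv ℝ φ (x - s • h)) (x - s • h) :=
      (hφ.differentiable (by simp) _).hasFDerivAt
    have h2 : HasDerivAt (fun s : ℝ => x - s • h) (-h) s := by
      simpa using ((hasDerivAt_id s).smul_const h).const_sub x
    exact h1.comp_hasDerivAt s h2
  have hc : ContDiff ℝ 1 (fun s : ℝ => φ (x - s • h)) :=
    hφ.comp (contDiff_const.sub (contDiff_id.smul contDiff_const))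
  have := enorm_sub_le_lintegral_deriv_of_contDiffOn_Icc (a := 0) (b := 1)
    (f := fun s : ℝ => φ (x - s • h)) hc.contDiffOn zero_le_one
  simp only [one_smul, zero_smul, sub_zero] at this
  refine this.trans (lintegral_mono fun s => ?_)
  rw [(hd s).deriv]
  simpa using (fderiv ℝ φ (x - s • h)).le_opENorm (-h)

/-- The increment of φ is an integral of its derivative along the segment from x to x - h. After
Tonelli, Hölder applies for each s, and translation invariance of the L^q norm removes s. -/
lemma lintegral_mul_translate_sub_le {p q : ℝ≥0∞} [p.HolderConjugate q] {a : E → ℝ}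
    (ha : Measurable a) {φ : E → F} (hφ : ContDiff ℝ 1 φ) (h : E) :
    ∫⁻ x, ‖a x‖ₑ * ‖φ (x - h) - φ x‖ₑ
      ≤ ‖h‖ₑ * (eLpNorm a p volume * eLpNorm (fderiv ℝ φ) q volume) := by
  have hc : Continuous (fderiv ℝ φ) := hφ.continuous_fderiv (by simp)
  calc ∫⁻ x, ‖a x‖ₑ * ‖φ (x - h) - φ x‖ₑ
      ≤ ∫⁻ x, ∫⁻ s in Set.Icc (0 : ℝ) 1,
          ‖a x‖ₑ * (‖fderiv ℝ φ (x - s • h)‖ₑ * ‖h‖ₑ) := by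
        refine lintegral_mono fun x => ?_
        rw [lintegral_const_mul]
        · gcongr
          exact enorm_sub_le_lintegral_fderiv hφ x h
        · exact ((hc.comp (by fun_prop : Continuous fun s : ℝ => x - s • h)).enorm.measurable).mul_const _
    _ = ∫⁻ s in Set.Icc (0 : ℝ) 1, ∫⁻ x,
          ‖a x‖ₑ * (‖fderiv ℝ φ (x - s • h)‖ₑ * ‖h‖ₑ) := by
        refine lintegral_lintegral_swap (Measurable.aemeasurable ?_)
        refine (ha.comp measurable_fst).enorm.mul (Measurable.mul_const ?_ _)
        exact (hc.comp (by fun_prop : Continuous fun z : E × ℝ => z.1 - z.2 • h)).enorm.measurable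
    _ ≤ ∫⁻ s in Set.Icc (0 : ℝ) 1,
          ‖h‖ₑ * (eLpNorm a p volume * eLpNorm (fderiv ℝ φ) q volume) := by
        refine lintegral_mono fun s => ?_
        have hm : AEStronglyMeasurable (fun x => fderiv ℝ φ (x - s • h)) volume :=
          (hc.comp (by fun_prop : Continuous fun x : E => x - s • h)).aestronglyMeasurable
        simp_rw [← mul_assoc]
        rw [lintegral_mul_const' _ _ enorm_ne_top, mul_comm]
        rw [mul_assoc]
        refine mul_le_mul_right (α := ℝ≥0∞) ?_ _
        rw [← eLpNorm_translate hc.aestronglyMeasurable q (s • h)]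
        exact lintegral_enorm_mul_enorm_le ha.aestronglyMeasurable hm
    _ = _ := by simp

/-- The pairing of the increments of `a` and of `v`, averaged against a kernel `k`. It controls the
commutator of a mollification with the transport by `v`. -/
noncomputable def incrementPairing (k : E → ℝ≥0∞) (a : E → ℝ) (v : E → F) : ℝ≥0∞ :=
  ∫⁻ h, k h * ∫⁻ x, ‖a (x - h) - a x‖ₑ * ‖v (x - h) - v x‖ₑ

lemma measurable_lintegral_increments {a : E → ℝ} (ha : Measurable a) {v : E → F}
    (hv : Measurable v) :
    Measurable fun h => ∫⁻ x, ‖a (x - h) - a x‖ₑ * ‖v (x - h) - v x‖ₑ := by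
  refine Measurable.lintegral_prod_right' (f := fun z : E × E =>
    ‖a (z.2 - z.1) - a z.2‖ₑ * ‖v (z.2 - z.1) - v z.2‖ₑ) ?_
  fun_prop

lemma incrementPairing_add_le {k : E → ℝ≥0∞} (hk : Measurable k) {a : E → ℝ} (ha : Measurable a)
    {v w : E → F} (hv : Measurable v) :
    incrementPairing k a (fun x => v x + w x)
      ≤ incrementPairing k a v + incrementPairing k a w := by
  unfold incrementPairing
  have hm : Measurable fun h => k h * ∫⁻ x, ‖a (x - h) - a x‖ₑ * ‖v (x - h) - v x‖ₑ :=
    hk.mul (measurable_lintegral_increments ha hv)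
  rw [← lintegral_add_left hm]
  refine lintegral_mono fun h => ?_
  rw [← mul_add, ← lintegral_add_left (by fun_prop)]
  gcongr with x
  rw [← mul_add]
  gcongr
  rw [add_sub_add_comm]
  exact enorm_add_le _ _

lemma eLpNorm_increment_le {p : ℝ≥0∞} (hp : 1 ≤ p) {a : E → F} (ha : Measurable a) (h : E) :
    eLpNorm (fun x => a (x - h) - a x) p volume ≤ 2 * eLpNorm a p volume := by
  have := eLpNorm_sub_le (f := fun x => a (x - h)) (g := a) (μ := (volume : Measure E))
    (p := p)
    (ha.comp (measurable_sub_const h)).aestronglyMeasurable ha.aestronglyMeasurable hp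
  rwa [eLpNorm_translate ha.aestronglyMeasurable, ← two_mul] at this

/-- This crude bound involves the total mass of k, which is not controlled uniformly in the
mollification scale. It serves for remainders that tend to zero while the kernel is held fixed. -/
lemma incrementPairing_le {p q : ℝ≥0∞} [p.HolderConjugate q] {k : E → ℝ≥0∞}
    (hk : Measurable k) {a : E → ℝ} (ha : Measurable a) {v : E → F} (hv : Measurable v) :
    incrementPairing k a v
      ≤ (∫⁻ h, k h) * (2 * eLpNorm a p volume * (2 * eLpNorm v q volume)) := by
  have hp : 1 ≤ p := ENNReal.HolderConjugate.one_le p q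
  have hq : 1 ≤ q := ENNReal.HolderConjugate.one_le q p
  rw [← lintegral_mul_const _ hk]
  refine lintegral_mono fun h => mul_le_mul_right ?_ _
  refine (lintegral_enorm_mul_enorm_le (p := p) (q := q) (a := fun x => a (x - h) - a x)
    (v := fun x => v (x - h) - v x)
    ((ha.comp (measurable_sub_const h)).sub ha).aestronglyMeasurable
    ((hv.comp (measurable_sub_const h)).sub hv).aestronglyMeasurable).trans ?_
  gcongr
  · exact eLpNorm_increment_le hp ha h
  · exact eLpNorm_increment_le hq hv h

/-- The increment of φ yields a factor ‖h‖, so only the first moment of k enters. For k = ‖∇m‖ this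
moment is bounded independently of the scale. -/
lemma incrementPairing_le_of_contDiff {p q : ℝ≥0∞} [p.HolderConjugate q] {k : E → ℝ≥0∞}
    (hk : Measurable k) {C : ℝ≥0∞} (hC : ∫⁻ h, ‖h‖ₑ * k h ≤ C) {a : E → ℝ} (ha : Measurable a)
    {φ : E → F} (hφ : ContDiff ℝ 1 φ) :
    incrementPairing k a φ
      ≤ C * (2 * eLpNorm a p volume * eLpNorm (fderiv ℝ φ) q volume) := by
  have hp : 1 ≤ p := ENNReal.HolderConjugate.one_le p q
  calc incrementPairing k a φ
      ≤ ∫⁻ h, (‖h‖ₑ * k h) * (2 * eLpNorm a p volume * eLpNorm (fderiv ℝ φ) q volume) := by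
        refine lintegral_mono fun h => ?_
        rw [mul_comm ‖h‖ₑ, mul_assoc]
        gcongr
        refine (lintegral_mul_translate_sub_le (p := p) (q := q) (a := fun x => a (x - h) - a x)
          (by fun_prop) hφ h).trans ?_
        gcongr
        exact eLpNorm_increment_le hp ha h
    _ ≤ _ := by
        rw [lintegral_mul_const _ (by fun_prop)]
        gcongr

/-- Here the smallness comes from a: the Lipschitz bound supplies the factor ‖h‖ and leaves the L¹
modulus of continuity of a, over shifts within the support of k. -/
lemma incrementPairing_le_of_lipschitz {k : E → ℝ≥0∞}
    (hk : Measurable k) {C : ℝ≥0∞} (hC : ∫⁻ h, ‖h‖ₑ * k h ≤ C) {a : E → ℝ}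
    {L : ℝ≥0} {φ : E → F} (hφ : LipschitzWith L φ) {ε : ℝ} (hkε : ∀ h, ε < ‖h‖ → k h = 0)
    {δ : ℝ≥0∞} (hδ : ∀ h : E, ‖h‖ ≤ ε → ∫⁻ x, ‖a (x - h) - a x‖ₑ ≤ δ) :
    incrementPairing k a φ ≤ C * (L * δ) := by
  calc incrementPairing k a φ
      ≤ ∫⁻ h, (‖h‖ₑ * k h) * (L * δ) := by
        refine lintegral_mono fun h => ?_
        by_cases hh : ε < ‖h‖
        · simp [hkε h hh]
        have : ∀ x, ‖φ (x - h) - φ x‖ₑ ≤ L * ‖h‖ₑ := by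
          intro x
          have := hφ (x - h) x
          rw [edist_eq_enorm_sub, edist_eq_enorm_sub] at this
          simpa using this
        calc k h * ∫⁻ x, ‖a (x - h) - a x‖ₑ * ‖φ (x - h) - φ x‖ₑ
            ≤ k h * ∫⁻ x, ‖a (x - h) - a x‖ₑ * (L * ‖h‖ₑ) := by
              gcongr with x
              exact this x
          _ = k h * ((∫⁻ x, ‖a (x - h) - a x‖ₑ) * (L * ‖h‖ₑ)) := by
              rw [lintegral_mul_const' _ _ (ENNReal.mul_ne_top (by simp) (by simp))]
          _ ≤ k h * (δ * (L * ‖h‖ₑ)) := by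
              gcongr
              exact hδ h (not_lt.1 hh)
          _ = _ := by ring
    _ ≤ _ := by
        rw [lintegral_mul_const _ (by fun_prop)]
        gcongr

end IncrementPairing

/-! ### The commutator estimate for fields in W_0^{1,q} -/

section Sobolev

variable {N : ℕ} {Ω : Set (Space N)} {p q : ℝ≥0∞}

lemma norm_fderiv_le_sum_partialDeriv {F : Type*} [NormedAddCommGroup F] [NormedSpace ℝ F]
    (φ : Space N → F) (x : Space N) : ‖fderiv ℝ φ x‖ ≤ ∑ i, ‖partialDeriv i φ x‖ := by
  refine ContinuousLinearMap.opNorm_le_bound _ (by positivity) fun v => ?_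
  have hv : v = ∑ i, v i • EuclideanSpace.single i (1 : ℝ) := by
    ext j
    simp [Finset.sum_apply, Pi.single_apply]
  conv_lhs => rw [hv]
  rw [map_sum, Finset.sum_mul]
  refine (norm_sum_le _ _).trans (Finset.sum_le_sum fun i _ => ?_)
  rw [map_smul, norm_smul, mul_comm]
  exact mul_le_mul_of_nonneg_left (PiLp.norm_apply_le v i) (norm_nonneg _)

lemma IsTestFunction.sub {F : Type*} [NormedAddCommGroup F] [NormedSpace ℝ F]
    {φ ψ : Space N → F} (hφ : IsTestFunction Ω φ) (hψ : IsTestFunction Ω ψ) :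
    IsTestFunction Ω (fun x => φ x - ψ x) where
  contDiff := hφ.contDiff.sub hψ.contDiff
  hasCompactSupport := hφ.hasCompactSupport.sub hψ.hasCompactSupport
  tsupport_subset := (tsupport_sub φ ψ).trans (Set.union_subset hφ.tsupport_subset
    hψ.tsupport_subset)

lemma IsTestFunction.eq_zero {F : Type*} [NormedAddCommGroup F] [NormedSpace ℝ F]
    {φ : Space N → F} (hφ : IsTestFunction Ω φ) {x : Space N} (hx : x ∉ Ω) : φ x = 0 :=
  image_eq_zero_of_notMem_tsupport fun h => hx (hφ.tsupport_subset h)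

lemma IsTestFunction.fderiv_eq_zero {F : Type*} [NormedAddCommGroup F] [NormedSpace ℝ F]
    {φ : Space N → F} (hφ : IsTestFunction Ω φ) {x : Space N} (hx : x ∉ Ω) : fderiv ℝ φ x = 0 :=
  image_eq_zero_of_notMem_tsupport fun h =>
    hx (hφ.tsupport_subset (tsupport_fderiv_subset ℝ h))

lemma IsTestFunction.contDiff_one {F : Type*} [NormedAddCommGroup F] [NormedSpace ℝ F]
    {φ : Space N → F} (hφ : IsTestFunction Ω φ) : ContDiff ℝ 1 φ :=
  hφ.contDiff.of_le (by simp)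

lemma IsTestFunction.continuous_partialDeriv {F : Type*} [NormedAddCommGroup F]
    [NormedSpace ℝ F] {φ : Space N → F} (hφ : IsTestFunction Ω φ) (i : Fin N) :
    Continuous (partialDeriv i φ) :=
  (hφ.contDiff.continuous_fderiv (by simp)).clm_apply continuous_const

lemma partialDeriv_sub {F : Type*} [NormedAddCommGroup F] [NormedSpace ℝ F]
    {φ ψ : Space N → F} (hφ : IsTestFunction Ω φ) (hψ : IsTestFunction Ω ψ) (i : Fin N)
    (x : Space N) :
    partialDeriv i (fun x => φ x - ψ x) x = partialDeriv i φ x - partialDeriv i ψ x := by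
  unfold partialDeriv
  rw [fderiv_fun_sub (hφ.contDiff.differentiable (by simp) x)
    (hψ.contDiff.differentiable (by simp) x)]
  rfl

lemma IsTestFunction.eLpNorm_fderiv_le {F : Type*} [NormedAddCommGroup F] [NormedSpace ℝ F]
    {φ : Space N → F} (hφ : IsTestFunction Ω φ) (hq : 1 ≤ q) :
    eLpNorm (fderiv ℝ φ) q volume ≤ ∑ i, eLpNorm (partialDeriv i φ) q (spaceMeasure Ω) := by
  have hs : Function.support (fun x => ‖fderiv ℝ φ x‖) ⊆ Ω :=
    fun x hx => by_contra fun h => hx (by simp [hφ.fderiv_eq_zero h])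
  calc eLpNorm (fderiv ℝ φ) q volume
      = eLpNorm (fun x => ‖fderiv ℝ φ x‖) q (spaceMeasure Ω) := by
        rw [eLpNorm_restrict_eq_of_support_subset hs, eLpNorm_norm]
    _ ≤ eLpNorm (∑ i, fun x => ‖partialDeriv i φ x‖) q (spaceMeasure Ω) := by
        refine eLpNorm_mono_real fun x => ?_
        simpa using norm_fderiv_le_sum_partialDeriv φ x
    _ ≤ ∑ i, eLpNorm (fun x => ‖partialDeriv i φ x‖) q (spaceMeasure Ω) :=
        eLpNorm_sum_le (fun i _ => (hφ.continuous_partialDeriv i).norm.aestronglyMeasurable) hq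
    _ = _ := by simp_rw [eLpNorm_norm]

/-- The increment pairing of `a` with a Sobolev field is controlled by the derivatives. -/
lemma MemSobolevZero.incrementPairing_sub_le [p.HolderConjugate q] {v : Space N → Space N}
    {G : Fin N → Space N → Space N} (hv : MemSobolevZero Ω q v G) (hvm : Measurable v)
    (hv0 : ∀ x ∉ Ω, v x = 0) {ψ : Space N → Space N} (hψ : IsTestFunction Ω ψ)
    {k : Space N → ℝ≥0∞} (hk : Measurable k) (hk' : ∫⁻ h, k h ≠ ⊤) {C : ℝ≥0∞} (hC' : C ≠ ⊤)
    (hC : ∫⁻ h, ‖h‖ₑ * k h ≤ C) {a : Space N → ℝ} (ha : Measurable a)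
    (hap : eLpNorm a p volume ≠ ⊤) :
    incrementPairing k a (fun x => v x - ψ x) ≤ C * (2 * eLpNorm a p volume *
      ∑ i, eLpNorm (fun x => G i x - partialDeriv i ψ x) q (spaceMeasure Ω)) := by
  have hq : 1 ≤ q := ENNReal.HolderConjugate.one_le q p
  obtain ⟨φ, hφ, hlim⟩ := hv.exists_approx
  set D := ∑ i, eLpNorm (fun x => G i x - partialDeriv i ψ x) q (spaceMeasure Ω)
  set s : ℕ → ℝ≥0∞ := fun n => sobolevNorm Ω q (fun x => v x - φ n x)
      (fun i x => G i x - partialDeriv i (φ n) x) with hs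
  have h1 : ∀ n, eLpNorm (fun x => v x - φ n x) q volume ≤ s n := by
    intro n
    have hsupp : Function.support (fun x => v x - φ n x) ⊆ Ω := fun x hx =>
      by_contra fun h => hx (by simp [hv0 x h, (hφ n).eq_zero h])
    rw [← eLpNorm_restrict_eq_of_support_subset hsupp]
    exact le_self_add
  have h2 : ∀ n, eLpNorm (fderiv ℝ (fun x => φ n x - ψ x)) q volume ≤ s n + D := by
    intro n
    refine (((hφ n).sub hψ).eLpNorm_fderiv_le hq).trans ?_
    calc ∑ i, eLpNorm (partialDeriv i fun x => φ n x - ψ x) q (spaceMeasure Ω)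
        ≤ ∑ i, (eLpNorm (fun x => G i x - partialDeriv i (φ n) x) q (spaceMeasure Ω)
          + eLpNorm (fun x => G i x - partialDeriv i ψ x) q (spaceMeasure Ω)) := by
          refine Finset.sum_le_sum fun i _ => ?_
          have hG := (hv.memLp_deriv i).aestronglyMeasurable
          have e : (partialDeriv i fun x => φ n x - ψ x) = (fun x => G i x - partialDeriv i ψ x)
              - (fun x => G i x - partialDeriv i (φ n) x) := by
            ext1 x
            rw [partialDeriv_sub (hφ n) hψ]
            simp
          rw [e, add_comm]
          exact eLpNorm_sub_le (hG.sub (hψ.continuous_partialDeriv i).aestronglyMeasurable)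
            (hG.sub ((hφ n).continuous_partialDeriv i).aestronglyMeasurable) hq
      _ ≤ s n + D := by
          rw [Finset.sum_add_distrib]
          gcongr
          exact le_add_self
  -- Split v - ψ as (v - φ n) + (φ n - ψ). The first piece takes the crude bound, whose constant
  -- depends on k but multiplies the vanishing s n; the second is smooth and takes the
  -- scale-invariant bound.
  have h3 : ∀ n, incrementPairing k a (fun x => v x - ψ x)
      ≤ (∫⁻ h, k h) * (2 * eLpNorm a p volume * (2 * s n))
        + C * (2 * eLpNorm a p volume * (s n + D)) := by
    intro n
    have hφm : Measurable (φ n) := (hφ n).contDiff.continuous.measurable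
    have hψm : Measurable ψ := hψ.contDiff.continuous.measurable
    calc incrementPairing k a (fun x => v x - ψ x)
        = incrementPairing k a (fun x => (v x - φ n x) + (φ n x - ψ x)) := by simp
      _ ≤ _ := incrementPairing_add_le hk ha (hvm.sub hφm)
      _ ≤ _ := by
        gcongr
        · refine (incrementPairing_le (p := p) (q := q) hk ha (hvm.sub hφm)).trans ?_
          gcongr
          exact h1 n
        · refine (incrementPairing_le_of_contDiff (p := p) (q := q) hk hC ha
            ((hφ n).sub hψ).contDiff_one).trans ?_
          gcongr
          exact h2 n
  have h4 : Tendsto (fun n => (∫⁻ h, k h) * (2 * eLpNorm a p volume * (2 * s n))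
        + C * (2 * eLpNorm a p volume * (s n + D))) atTop
      (𝓝 ((∫⁻ h, k h) * (2 * eLpNorm a p volume * (2 * 0))
        + C * (2 * eLpNorm a p volume * (0 + D)))) := by
    have ha2 : 2 * eLpNorm a p volume ≠ ⊤ := ENNReal.mul_ne_top (by simp) hap
    refine Tendsto.add ?_ ?_
    · exact ENNReal.Tendsto.const_mul (ENNReal.Tendsto.const_mul
        (ENNReal.Tendsto.const_mul hlim (Or.inr (by simp))) (Or.inr ha2)) (Or.inr hk')
    · exact ENNReal.Tendsto.const_mul (ENNReal.Tendsto.const_mul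
        (hlim.add tendsto_const_nhds) (Or.inr ha2)) (Or.inr hC')
  simpa using ge_of_tendsto' h4 h3

lemma isTestFunction_zero {F : Type*} [NormedAddCommGroup F] [NormedSpace ℝ F] :
    IsTestFunction Ω (fun _ => (0 : F)) where
  contDiff := contDiff_const
  hasCompactSupport := HasCompactSupport.zero
  tsupport_subset := by simp [tsupport]

/-- The comparison field ψ = 0 gives a bound that does not see the scale of k; it becomes the
majorant for dominated convergence in time. -/
lemma MemSobolevZero.incrementPairing_le [p.HolderConjugate q] {v : Space N → Space N}
    {G : Fin N → Space N → Space N} (hv : MemSobolevZero Ω q v G) (hvm : Measurable v)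
    (hv0 : ∀ x ∉ Ω, v x = 0)
    {k : Space N → ℝ≥0∞} (hk : Measurable k) (hk' : ∫⁻ h, k h ≠ ⊤) {C : ℝ≥0∞} (hC' : C ≠ ⊤)
    (hC : ∫⁻ h, ‖h‖ₑ * k h ≤ C) {a : Space N → ℝ} (ha : Measurable a)
    (hap : eLpNorm a p volume ≠ ⊤) :
    incrementPairing k a v ≤ C * (2 * eLpNorm a p volume * sobolevNorm Ω q v G) := by
  have := hv.incrementPairing_sub_le hvm hv0 isTestFunction_zero hk hk' hC' hC ha hap
  have h0 : ∀ i, partialDeriv i (fun _ : Space N => (0 : Space N)) = 0 := by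
    intro i
    ext1 x
    simp [partialDeriv]
  simp only [h0, sub_zero, Pi.zero_apply] at this
  refine this.trans ?_
  gcongr
  exact le_add_self

/-- The increment pairing of an integrable function with a Sobolev field vanishes along
mollifier kernels. -/
lemma MemSobolevZero.tendsto_incrementPairing [p.HolderConjugate q] {v : Space N → Space N}
    {G : Fin N → Space N → Space N} (hv : MemSobolevZero Ω q v G) (hvm : Measurable v)
    (hv0 : ∀ x ∉ Ω, v x = 0) {C : ℝ} {ε : ℕ → ℝ} (hε : Tendsto ε atTop (𝓝 0))
    {m : ℕ → Space N → ℝ} (hm : ∀ n, IsMollifier (m n) (ε n) C)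
    {a : Space N → ℝ} (ha : Measurable a) (hap : eLpNorm a p volume ≠ ⊤) (hai : Integrable a) :
    Tendsto (fun n => incrementPairing (fun h => ‖fderiv ℝ (m n) h‖ₑ) a v) atTop (𝓝 0) := by
  rw [ENNReal.tendsto_nhds_zero]
  intro δ hδ
  have hkm : ∀ n, Measurable fun h => ‖fderiv ℝ (m n) h‖ₑ :=
    fun n => (hm n).continuous_fderiv.enorm.measurable
  have hC' : ENNReal.ofReal C ≠ ⊤ := ENNReal.ofReal_ne_top
  obtain ⟨φ, hφ, hlim⟩ := hv.exists_approx
  have hlim2 : Tendsto (fun j => ENNReal.ofReal C * (2 * eLpNorm a p volume *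
      sobolevNorm Ω q (fun x => v x - φ j x) (fun i x => G i x - partialDeriv i (φ j) x)))
      atTop (𝓝 0) := by
    have := ENNReal.Tendsto.const_mul (ENNReal.Tendsto.const_mul hlim (a := 2 * eLpNorm a p volume)
      (Or.inr (ENNReal.mul_ne_top (by simp) hap))) (a := ENNReal.ofReal C) (Or.inr hC')
    simpa using this
  have hδ2 : 0 < δ / 2 := ENNReal.half_pos hδ.ne'
  -- The approximating field φ j is fixed before the scale: the remainder v - φ j is small uniformly
  -- in n. The Lipschitz constant of φ j may be large, but it meets an L¹ modulus that tends to
  -- zero.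
  obtain ⟨j, hj⟩ := ((ENNReal.tendsto_nhds_zero.1 hlim2) _ hδ2).exists
  obtain ⟨L, hL⟩ : ∃ L : ℝ≥0, LipschitzWith L (φ j) :=
    (hφ j).contDiff_one.lipschitzWith_of_hasCompactSupport (hφ j).hasCompactSupport (by simp)
  have hT : Tendsto (fun h => ENNReal.ofReal C * (L * ∫⁻ x, ‖a (x - h) - a x‖ₑ)) (𝓝 0) (𝓝 0) := by
    have := ENNReal.Tendsto.const_mul (ENNReal.Tendsto.const_mul
      (tendsto_lintegral_translate_sub hai) (a := (L : ℝ≥0∞)) (Or.inr (by simp)))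
      (a := ENNReal.ofReal C) (Or.inr hC')
    simpa using this
  obtain ⟨r, hr, hr'⟩ := Metric.eventually_nhds_iff.1 ((ENNReal.tendsto_nhds_zero.1 hT) _ hδ2)
  filter_upwards [hε.eventually (gt_mem_nhds hr)] with n hn
  calc incrementPairing (fun h => ‖fderiv ℝ (m n) h‖ₑ) a v
      = incrementPairing (fun h => ‖fderiv ℝ (m n) h‖ₑ) a (fun x => (v x - φ j x) + φ j x) := by
        simp
    _ ≤ incrementPairing (fun h => ‖fderiv ℝ (m n) h‖ₑ) a (fun x => v x - φ j x)
        + incrementPairing (fun h => ‖fderiv ℝ (m n) h‖ₑ) a (φ j) :=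
        incrementPairing_add_le (hkm n) ha (hvm.sub (hφ j).contDiff.continuous.measurable)
    _ ≤ δ / 2 + δ / 2 := by
        gcongr
        · refine le_trans (hv.incrementPairing_sub_le hvm hv0 (hφ j) (hkm n)
            (hm n).lintegral_enorm_fderiv_lt_top.ne hC' (hm n).lintegral_enorm_mul_fderiv_le
            ha hap) (le_trans ?_ hj)
          gcongr
          exact le_add_self
        · refine (incrementPairing_le_of_lipschitz (hkm n) (hm n).lintegral_enorm_mul_fderiv_le hL
            (ε := ε n) (fun h hh => by
              rw [(hm n).fderiv_eq_zero hh]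
              rw [← ofReal_norm]
              simp)
            (δ := ⨆ h ∈ Metric.closedBall (0 : Space N) (ε n), ∫⁻ x, ‖a (x - h) - a x‖ₑ)
            fun h hh => le_iSup₂_of_le h (by simpa using hh) le_rfl).trans ?_
          simp only [ENNReal.mul_iSup]
          refine iSup₂_le fun h hh => hr' ?_
          rw [Metric.mem_closedBall] at hh
          linarith
    _ = δ := ENNReal.add_halves δ

end Sobolev

/-! ### Weak time derivatives and the chain rule in one dimension -/

section Time

lemma absolutelyContinuousOnInterval_lipschitz_comp {β g : ℝ → ℝ} {K : ℝ≥0}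
    (hβ : LipschitzWith K β) {a b : ℝ} (hg : AbsolutelyContinuousOnInterval g a b) :
    AbsolutelyContinuousOnInterval (fun t => β (g t)) a b := by
  rw [absolutelyContinuousOnInterval_iff] at hg ⊢
  intro ε hε
  -- Dividing by K + 1 instead of K covers K = 0 and keeps the final inequality strict.
  obtain ⟨δ, hδ, h⟩ := hg (ε / (K + 1)) (by positivity)
  refine ⟨δ, hδ, fun E hE hlen => ?_⟩
  have h1 := h E hE hlen
  rw [lt_div_iff₀ (by positivity)] at h1
  refine lt_of_le_of_lt ?_ h1
  rw [Finset.sum_mul]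
  refine Finset.sum_le_sum fun i _ => (hβ.dist_le_mul _ _).trans ?_
  rw [mul_comm]
  gcongr
  simp

variable {T : ℝ} {r f : ℝ → ℝ}

/-- Integration by parts; the boundary terms vanish because the primitive is zero at 0 and g is zero
at T. -/
lemma integral_mul_eq_neg_integral_deriv_mul_primitive (hT : 0 ≤ T)
    (hf : IntegrableOn f (Set.Ioo 0 T)) {g : ℝ → ℝ} (hg : AbsolutelyContinuousOnInterval g 0 T)
    (hgT : g T = 0) :
    ∫ t in (0 : ℝ)..T, g t * f t
      = - ∫ t in (0 : ℝ)..T, deriv g t * ∫ s in (0 : ℝ)..t, f s := by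
  have hfi : IntervalIntegrable f volume 0 T := by
    rwa [intervalIntegrable_iff_integrableOn_Ioo_of_le hT]
  have hR : AbsolutelyContinuousOnInterval (fun t => ∫ s in (0 : ℝ)..t, f s) 0 T :=
    hfi.absolutelyContinuousOnInterval_intervalIntegral (by simp)
  have h := hg.integral_mul_deriv_eq_deriv_mul hR
  rw [hgT] at h
  simp only [zero_mul, intervalIntegral.integral_same, mul_zero, sub_zero, zero_sub] at h
  rw [← h]
  refine intervalIntegral.integral_congr_ae ?_
  filter_upwards [hfi.ae_hasDerivAt_integral] with t ht ht'
  rw [(ht (Set.uIoc_subset_uIcc ht') 0 (by simp)).deriv]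

/-- A smooth function compactly supported in `(0,T)` is, on `(0,T)`, the derivative of a smooth
compactly supported function vanishing near `T`. -/
lemma exists_primitive_compactSupport {η : ℝ → ℝ} (hT : 0 < T) (hη : ContDiff ℝ ∞ η)
    (hηc : HasCompactSupport η) (hηT : tsupport η ⊆ Set.Ioo 0 T) :
    ∃ θ : ℝ → ℝ, ContDiff ℝ ∞ θ ∧ HasCompactSupport θ ∧ tsupport θ ⊆ Set.Iio T ∧
      ∀ t ∈ Set.Ioo 0 T, deriv θ t = η t := by
  obtain ⟨b, hbT, hb⟩ : ∃ b < T, ∀ t, b ≤ t → η t = 0 := by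
    obtain ⟨b, hb1, hb2⟩ : ∃ b, b < T ∧ ∀ t ∈ tsupport η, t ≤ b := by
      rcases (tsupport η).eq_empty_or_nonempty with h0 | hne
      · exact ⟨0, hT, by simp [h0]⟩
      · obtain ⟨c, hc, hc'⟩ := hηc.isCompact.exists_isGreatest hne
        exact ⟨c, (hηT hc).2, hc'⟩
    -- The greatest point b of the support is excluded by moving to the midpoint with T, so that η
    -- vanishes from there on, endpoint included.
    refine ⟨(b + T) / 2, by linarith, fun t ht => image_eq_zero_of_notMem_tsupport fun h => ?_⟩
    linarith [hb2 t h]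
  -- Integrating from T makes the primitive vanish near T. It may be a nonzero constant for negative
  -- times; the factor `Real.smoothTransition (t + 1)` equals 1 for t ≥ 0 and 0 for t ≤ -1, which
  -- restores compact support without changing anything on (0,T).
  set H : ℝ → ℝ := fun t => ∫ s in T..t, η s with hH
  have hHd : ∀ t, HasDerivAt H (η t) t := fun t =>
    intervalIntegral.integral_hasDerivAt_right (hη.continuous.intervalIntegrable _ _)
      hη.continuous.stronglyMeasurable.stronglyMeasurableAtFilter hη.continuous.continuousAt
  have hHc : ContDiff ℝ ∞ H := by
    refine contDiff_infty_iff_deriv.2 ⟨fun t => (hHd t).differentiableAt, ?_⟩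
    have : deriv H = η := funext fun t => (hHd t).deriv
    rwa [this]
  have hHb : ∀ t, b ≤ t → H t = 0 := by
    intro t ht
    refine intervalIntegral.integral_zero_ae (ae_of_all _ fun s hs => hb s ?_)
    rw [Set.uIoc, Set.mem_Ioc] at hs
    exact (le_min hbT.le ht).trans hs.1.le
  have hsm : ContDiff ℝ ∞ fun t : ℝ => Real.smoothTransition (t + 1) :=
    Real.smoothTransition.contDiff.comp (contDiff_id.add contDiff_const)
  have hsupp : tsupport (fun t => Real.smoothTransition (t + 1) * H t) ⊆ Set.Icc (-1) b := by
    refine closure_minimal (fun t ht => ?_) isClosed_Icc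
    by_contra hcon
    refine ht ?_
    rw [Set.mem_Icc, not_and_or, not_le, not_le] at hcon
    rcases hcon with h | h
    · simp [Real.smoothTransition.zero_of_nonpos (by linarith : t + 1 ≤ 0)]
    · simp [hHb t h.le]
  refine ⟨fun t => Real.smoothTransition (t + 1) * H t, hsm.mul hHc,
    isCompact_Icc.of_isClosed_subset (isClosed_tsupport _) hsupp,
    hsupp.trans fun t ht => lt_of_le_of_lt ht.2 hbT, fun t ht => ?_⟩
  have : (fun t => Real.smoothTransition (t + 1) * H t) =ᶠ[𝓝 t] H := by
    filter_upwards [lt_mem_nhds ht.1] with s hs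
    rw [Real.smoothTransition.one_of_one_le (by linarith), one_mul]
  rw [this.deriv_eq, (hHd t).deriv]

/-- The test functions θ need not vanish at 0, so the hypothesis also encodes the initial value
zero; this is why the primitive starts at 0 without an additive constant. Every η in C_c^∞(0,T) is
the derivative on (0,T) of an admissible θ, and the fundamental lemma applies to the difference. -/
lemma ae_eq_primitive_of_weak_deriv (hT : 0 < T) (hr : IntegrableOn r (Set.Ioo 0 T))
    (hf : IntegrableOn f (Set.Ioo 0 T))
    (h : ∀ θ : ℝ → ℝ, ContDiff ℝ ∞ θ → HasCompactSupport θ → tsupport θ ⊆ Set.Iio T →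
      ∫ t in Set.Ioo 0 T, deriv θ t * r t = - ∫ t in Set.Ioo 0 T, θ t * f t) :
    ∀ᵐ t, t ∈ Set.Ioo 0 T → r t = ∫ s in (0 : ℝ)..t, f s := by
  have hfi : IntervalIntegrable f volume 0 T := by
    rwa [intervalIntegrable_iff_integrableOn_Ioo_of_le hT.le]
  have hRc : ContinuousOn (fun t => ∫ s in (0 : ℝ)..t, f s) (Set.uIcc 0 T) :=
    (hfi.absolutelyContinuousOnInterval_intervalIntegral (by simp)).continuousOn
  rw [Set.uIcc_of_le hT.le] at hRc
  have hRi : IntegrableOn (fun t => ∫ s in (0 : ℝ)..t, f s) (Set.Ioo 0 T) :=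
    (hRc.integrableOn_Icc).mono_set Set.Ioo_subset_Icc_self
  have key := isOpen_Ioo.ae_eq_zero_of_integral_contDiff_smul_eq_zero (U := Set.Ioo 0 T)
    (f := fun t => r t - ∫ s in (0 : ℝ)..t, f s) (μ := volume)
    (hr.sub hRi).locallyIntegrableOn ?_
  · filter_upwards [key] with t ht ht'
    exact sub_eq_zero.1 (ht ht')
  · intro η hη hηc hηT
    obtain ⟨θ, hθ, hθc, hθT, hθd⟩ := exists_primitive_compactSupport hT hη hηc hηT
    have h1 := h θ hθ hθc hθT
    have hθac : AbsolutelyContinuousOnInterval θ 0 T :=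
      (hθ.of_le (by simp) : ContDiff ℝ 1 θ).contDiffOn.absolutelyContinuousOnInterval
    have h2 := integral_mul_eq_neg_integral_deriv_mul_primitive hT.le hf hθac
      (image_eq_zero_of_notMem_tsupport fun h' => lt_irrefl T (hθT h'))
    rw [intervalIntegral.integral_of_le hT.le, intervalIntegral.integral_of_le hT.le,
      integral_Ioc_eq_integral_Ioo, integral_Ioc_eq_integral_Ioo] at h2
    rw [h2, neg_neg] at h1
    have hθ' : Continuous (deriv θ) := hθ.continuous_deriv (by simp)
    have hθs : HasCompactSupport (deriv θ) := hθc.deriv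
    obtain ⟨M, hM⟩ := hθs.exists_bound_of_continuous hθ'
    calc ∫ t, η t • (r t - ∫ s in (0 : ℝ)..t, f s)
        = ∫ t in Set.Ioo 0 T, η t • (r t - ∫ s in (0 : ℝ)..t, f s) := by
          refine (setIntegral_eq_integral_of_forall_compl_eq_zero fun t ht => ?_).symm
          rw [image_eq_zero_of_notMem_tsupport fun h' => ht (hηT h'), zero_smul]
      _ = ∫ t in Set.Ioo 0 T, (deriv θ t * r t - deriv θ t * ∫ s in (0 : ℝ)..t, f s) := by
          refine setIntegral_congr_fun measurableSet_Ioo fun t ht => ?_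
          simp only [hθd t ht, smul_eq_mul]
          ring
      _ = 0 := by
          rw [integral_sub, h1, sub_self]
          · exact hr.bdd_mul hθ'.aestronglyMeasurable (ae_of_all _ hM)
          · exact hRi.bdd_mul hθ'.aestronglyMeasurable (ae_of_all _ hM)

/-- The time-integrated chain rule for a Lipschitz function of a weakly differentiable function
with vanishing initial value. -/
lemma integral_comp_eq_of_weak_deriv (hT : 0 < T) (hr : IntegrableOn r (Set.Ioo 0 T))
    (hf : IntegrableOn f (Set.Ioo 0 T))
    (h : ∀ θ : ℝ → ℝ, ContDiff ℝ ∞ θ → HasCompactSupport θ → tsupport θ ⊆ Set.Iio T →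
      ∫ t in Set.Ioo 0 T, deriv θ t * r t = - ∫ t in Set.Ioo 0 T, θ t * f t)
    {β : ℝ → ℝ} {K : ℝ≥0} (hβ : LipschitzWith K β) (hβd : Differentiable ℝ β) (hβ0 : β 0 = 0) :
    ∫ t in Set.Ioo 0 T, β (r t) = ∫ t in Set.Ioo 0 T, (T - t) * (deriv β (r t) * f t) := by
  have hfi : IntervalIntegrable f volume 0 T := by
    rwa [intervalIntegrable_iff_integrableOn_Ioo_of_le hT.le]
  set R : ℝ → ℝ := fun t => ∫ s in (0 : ℝ)..t, f s with hR
  have hrR : ∀ᵐ t ∂volume.restrict (Set.Ioo 0 T), r t = R t :=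
    (ae_restrict_iff' measurableSet_Ioo).2 (ae_eq_primitive_of_weak_deriv hT hr hf h)
  have hac : AbsolutelyContinuousOnInterval R 0 T :=
    hfi.absolutelyContinuousOnInterval_intervalIntegral (by simp)
  have hβR := absolutelyContinuousOnInterval_lipschitz_comp hβ hac
  -- The weight T - t has derivative -1, which produces the plain integral of β, and it kills the
  -- boundary term at T; the one at 0 vanishes since β 0 = 0.
  have hlin : AbsolutelyContinuousOnInterval (fun t : ℝ => T - t) 0 T :=
    (contDiff_const.sub contDiff_id).contDiffOn.absolutelyContinuousOnInterval
  have h1 := hlin.integral_mul_deriv_eq_deriv_mul hβR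
  have h2 : deriv (fun t : ℝ => T - t) = fun _ => -1 := by
    ext t
    simp
  have hR0 : R 0 = 0 := by simp [hR]
  simp only [h2, sub_self, zero_mul, hR0, hβ0, mul_zero, neg_mul, one_mul,
    intervalIntegral.integral_neg, zero_sub, neg_neg] at h1
  rw [intervalIntegral.integral_of_le hT.le, intervalIntegral.integral_of_le hT.le,
      integral_Ioc_eq_integral_Ioo, integral_Ioc_eq_integral_Ioo] at h1
  have h3 : ∫ t in Set.Ioo 0 T, β (r t) = ∫ t in Set.Ioo 0 T, β (R t) := by
    refine integral_congr_ae ?_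
    filter_upwards [hrR] with t ht
    rw [ht]
  rw [h3, ← h1]
  refine integral_congr_ae ?_
  filter_upwards [hrR, ae_restrict_of_ae hfi.ae_hasDerivAt_integral,
    ae_restrict_mem measurableSet_Ioo] with t ht ht' htm
  have hd : HasDerivAt R (f t) t := ht' (by
    rw [Set.uIcc_of_le hT.le]
    exact Set.Ioo_subset_Icc_self htm) 0 (by simp)
  have := (hβd (R t)).hasDerivAt.comp t hd
  rw [ht]
  congr 1
  exact this.deriv

end Time

/-! ### The renormalizing function -/

section Saturation

/-- A bounded smooth renormalization vanishing only at the origin. -/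
noncomputable def saturation (s : ℝ) : ℝ := s ^ 2 / (1 + s ^ 2)

lemma saturation_zero : saturation 0 = 0 := by simp [saturation]

lemma saturation_nonneg (s : ℝ) : 0 ≤ saturation s := by unfold saturation; positivity

lemma saturation_le_one (s : ℝ) : saturation s ≤ 1 := by
  unfold saturation
  rw [div_le_one (by positivity)]
  linarith

lemma saturation_eq_zero_iff {s : ℝ} : saturation s = 0 ↔ s = 0 := by
  have : (1 + s ^ 2) ≠ 0 := by positivity
  simp [saturation, this]

lemma contDiff_saturation : ContDiff ℝ ∞ saturation :=
  (contDiff_id.pow 2).div (contDiff_const.add (contDiff_id.pow 2)) fun s => by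
    positivity

lemma differentiable_saturation : Differentiable ℝ saturation :=
  contDiff_saturation.differentiable (by simp)

lemma abs_deriv_saturation_le (s : ℝ) : |deriv saturation s| ≤ 1 := by
  have h : HasDerivAt saturation (2 * s / (1 + s ^ 2) ^ 2) s := by
    have h1 : HasDerivAt (fun s : ℝ => s ^ 2) (2 * s) s := by simpa using hasDerivAt_pow 2 s
    have h2 : HasDerivAt (fun s : ℝ => 1 + s ^ 2) (2 * s) s := h1.const_add 1
    have := h1.div h2 (by positivity)
    convert! this using 1
    ring
  rw [h.deriv, abs_div, abs_of_pos (by positivity : (0 : ℝ) < (1 + s ^ 2) ^ 2),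
    div_le_one (by positivity), abs_le]
  constructor <;> nlinarith [sq_nonneg (s - 1), sq_nonneg (s + 1), sq_nonneg (s ^ 2)]

lemma lipschitzWith_saturation : LipschitzWith 1 saturation :=
  lipschitzWith_of_nnnorm_deriv_le differentiable_saturation fun s => by
    rw [← NNReal.coe_le_coe]
    simpa using abs_deriv_saturation_le s

end Saturation

/-! ### Mollification of the equation and the commutator identity -/

section Mollify

variable {N : ℕ} {Ω : Set (Space N)} {m : Space N → ℝ} {ε C : ℝ}

/-- The mollification of `a` by the kernel `m`. -/
noncomputable def mollify (m a : Space N → ℝ) (x : Space N) : ℝ := ∫ y, a y * m (x - y)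

/-- The mollification of the divergence of `a v` by the kernel `m`. -/
noncomputable def mollifyFlux (m a : Space N → ℝ) (v : Space N → Space N) (x : Space N) : ℝ :=
  ∫ y, a y * fderiv ℝ m (x - y) (v y)

lemma mollify_eq_convolution (m a : Space N → ℝ) :
    mollify m a = convolution a m (ContinuousLinearMap.mul ℝ ℝ) volume := rfl

lemma IsMollifier.contDiff_mollify (hm : IsMollifier m ε C) {a : Space N → ℝ}
    (ha : Integrable a) : ContDiff ℝ ∞ (mollify m a) := by
  rw [mollify_eq_convolution]
  exact hm.hasCompactSupport.contDiff_convolution_right _ ha.locallyIntegrable hm.contDiff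

lemma IsMollifier.fderiv_mollify (hm : IsMollifier m ε C) {a : Space N → ℝ}
    (ha : Integrable a) (x w : Space N) :
    fderiv ℝ (mollify m a) x w = ∫ y, a y * fderiv ℝ m (x - y) w := by
  have h1 : ContDiff ℝ 1 m := hm.contDiff.of_le (by simp)
  have h := hm.hasCompactSupport.hasFDerivAt_convolution_right (ContinuousLinearMap.mul ℝ ℝ)
    ha.locallyIntegrable h1 x
  rw [mollify_eq_convolution, h.fderiv, convolution_precompR_apply]
  · rfl
  · exact ha.locallyIntegrable
  · exact hm.hasCompactSupport.fderiv ℝ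
  · exact hm.continuous_fderiv

lemma IsMollifier.exists_norm_fderiv_le (hm : IsMollifier m ε C) :
    ∃ M, 0 ≤ M ∧ ∀ h, ‖fderiv ℝ m h‖ ≤ M := by
  obtain ⟨M, hM⟩ := (hm.hasCompactSupport.fderiv ℝ).exists_bound_of_continuous
    hm.continuous_fderiv
  exact ⟨M, (norm_nonneg _).trans (hM 0), hM⟩

lemma IsMollifier.continuous_fderiv_apply (hm : IsMollifier m ε C) :
    Continuous fun z : Space N × Space N => fderiv ℝ m z.1 z.2 :=
  (hm.continuous_fderiv.comp continuous_fst).clm_apply continuous_snd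

lemma IsMollifier.integrable_mul_fderiv (hm : IsMollifier m ε C) {a : Space N → ℝ}
    (ha : Integrable a) {v : Space N → Space N} (hv : Measurable v) {B : ℝ}
    (hB : ∀ x, ‖v x‖ ≤ B) (x : Space N) :
    Integrable fun y => a y * fderiv ℝ m (x - y) (v y) := by
  obtain ⟨M, hM0, hM⟩ := hm.exists_norm_fderiv_le
  have hmeas : AEStronglyMeasurable (fun y => fderiv ℝ m (x - y) (v y)) volume := by
    exact (hm.continuous_fderiv_apply.measurable.comp
      ((measurable_const.sub measurable_id).prodMk hv)).aestronglyMeasurable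
  refine ha.mul_bdd hmeas (ae_of_all _ fun y => ?_) (c := M * B)
  exact (ContinuousLinearMap.le_opNorm _ _).trans
    (mul_le_mul (hM _) (hB _) (norm_nonneg _) hM0)

lemma IsMollifier.isTestFunction_translate (hm : IsMollifier m ε C) {x : Space N}
    (hx : Metric.closedBall x ε ⊆ Ω) : IsTestFunction Ω fun y => m (x - y) where
  contDiff := hm.contDiff.comp (contDiff_const.sub contDiff_id)
  hasCompactSupport := hm.hasCompactSupport.comp_homeomorph (Homeomorph.subLeft x)
  tsupport_subset := by
    refine (closure_minimal (fun y hy => ?_) Metric.isClosed_closedBall).trans hx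
    have := hm.tsupport_subset (subset_tsupport _ hy)
    rwa [mem_closedBall_zero_iff, ← dist_eq_norm, dist_comm] at this

lemma IsMollifier.hasFDerivAt_translate (hm : IsMollifier m ε C) (x y : Space N) :
    HasFDerivAt (fun y => m (x - y)) (-fderiv ℝ m (x - y)) y := by
  have h1 : HasFDerivAt m (fderiv ℝ m (x - y)) (x - y) :=
    (hm.contDiff.differentiable (by simp) _).hasFDerivAt
  have h2 : HasFDerivAt (fun y : Space N => x - y) (-ContinuousLinearMap.id ℝ (Space N)) y :=
    (hasFDerivAt_id y).const_sub x
  convert! h1.comp y h2 using 1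
  ext w
  simp

lemma IsMollifier.integral_fderiv_divFree (hm : IsMollifier m ε C) {x : Space N}
    (hx : Metric.closedBall x ε ⊆ Ω) {v : Space N → Space N} (hv0 : ∀ y ∉ Ω, v y = 0)
    (hdiv : IsWeaklyDivFree Ω v) : ∫ y, fderiv ℝ m (x - y) (v y) = 0 := by
  have h := hdiv _ (hm.isTestFunction_translate hx)
  simp_rw [(hm.hasFDerivAt_translate x _).fderiv] at h
  rw [setIntegral_eq_integral_of_forall_compl_eq_zero (fun y hy => by simp [hv0 y hy])] at h
  simpa [integral_neg] using h

lemma IsMollifier.integral_fderiv_const (hm : IsMollifier m ε C) (x w : Space N) :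
    ∫ y, fderiv ℝ m (x - y) w = 0 := by
  rw [integral_sub_left_eq_self (fun h => fderiv ℝ m h w) volume x]
  have hc : Continuous fun h => fderiv ℝ m h w := hm.continuous_fderiv.clm_apply continuous_const
  have hs : HasCompactSupport fun h => fderiv ℝ m h w := (hm.hasCompactSupport.fderiv_apply ℝ w)
  have := integral_mul_fderiv_eq_neg_fderiv_mul_of_integrable (μ := (volume : Measure (Space N)))
    (f := fun _ => (1 : ℝ)) (g := m) (v := w) (by simp)
    (by simpa using hc.integrable_of_hasCompactSupport hs)
    (by simpa using hm.contDiff.continuous.integrable_of_hasCompactSupport hm.hasCompactSupport)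
    (fun _ _ => by fun_prop) (fun _ _ => hm.contDiff.differentiable (by simp) _)
  simpa using this

/-- The commutator of mollification and transport by a divergence-free field, written through
increments. -/
lemma IsMollifier.flux_sub_fderiv_eq (hm : IsMollifier m ε C) {a : Space N → ℝ}
    (ha : Integrable a) {v : Space N → Space N} (hv : Measurable v) {B : ℝ}
    (hB : ∀ x, ‖v x‖ ≤ B) (hv0 : ∀ y ∉ Ω, v y = 0) (hvi : Integrable v)
    (hdiv : IsWeaklyDivFree Ω v) {x : Space N} (hx : Metric.closedBall x ε ⊆ Ω) :
    mollifyFlux m a v x - fderiv ℝ (mollify m a) x (v x)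
      = ∫ y, (a y - a x) * fderiv ℝ m (x - y) (v y - v x) := by
  obtain ⟨M, hM0, hM⟩ := hm.exists_norm_fderiv_le
  have i1 := hm.integrable_mul_fderiv ha hv hB x
  have i2 := hm.integrable_mul_fderiv ha (measurable_const (a := v x)) (fun _ => hB x) x
  have i3 : Integrable fun y => a x * fderiv ℝ m (x - y) (v y) := by
    refine Integrable.const_mul ?_ _
    refine Integrable.mono' (hvi.norm.const_mul M) ?_ (ae_of_all _ fun y => ?_)
    · exact (hm.continuous_fderiv_apply.measurable.comp
        ((measurable_const.sub measurable_id).prodMk hv)).aestronglyMeasurable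
    · exact (ContinuousLinearMap.le_opNorm _ _).trans
        (mul_le_mul_of_nonneg_right (hM _) (norm_nonneg _))
  have i4 : Integrable fun y => a x * fderiv ℝ m (x - y) (v x) := by
    have hc : Continuous fun h => fderiv ℝ m h (v x) :=
      hm.continuous_fderiv.clm_apply continuous_const
    have hs : HasCompactSupport fun h => fderiv ℝ m h (v x) :=
      (hm.hasCompactSupport.fderiv_apply ℝ (v x))
    exact ((hc.integrable_of_hasCompactSupport hs).comp_sub_left x).const_mul _
  -- The two terms carrying a x integrate to zero: one by weak incompressibility tested with y ↦ m
  -- (x - y), the other because ∇m has zero mean. They can thus be inserted freely, and this creates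
  -- increments of both a and v.
  have e : ∀ y, (a y - a x) * fderiv ℝ m (x - y) (v y - v x)
      = (a y * fderiv ℝ m (x - y) (v y) - a y * fderiv ℝ m (x - y) (v x))
        - (a x * fderiv ℝ m (x - y) (v y) - a x * fderiv ℝ m (x - y) (v x)) := by
    intro y
    rw [map_sub]
    ring
  simp_rw [e]
  have i5 : Integrable fun y => a y * fderiv ℝ m (x - y) (v y) - a y * fderiv ℝ m (x - y) (v x) :=
    i1.sub i2
  have i6 : Integrable fun y => a x * fderiv ℝ m (x - y) (v y) - a x * fderiv ℝ m (x - y) (v x) :=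
    i3.sub i4
  rw [integral_sub i5 i6, integral_sub i1 i2, integral_sub i3 i4,
    integral_const_mul, integral_const_mul, hm.integral_fderiv_divFree hx hv0 hdiv,
    hm.integral_fderiv_const, hm.fderiv_mollify ha]
  simp [mollifyFlux]

/-- With h = x - y as integration variable, the kernel no longer depends on x, and Tonelli puts the
integral over h outside. -/
lemma IsMollifier.lintegral_commutator_le (hm : IsMollifier m ε C) {a : Space N → ℝ}
    (ha : Measurable a) {v : Space N → Space N} (hv : Measurable v) :
    ∫⁻ x, ‖∫ y, (a y - a x) * fderiv ℝ m (x - y) (v y - v x)‖ₑ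
      ≤ incrementPairing (fun h => ‖fderiv ℝ m h‖ₑ) a v := by
  have hk : Measurable fun h => ‖fderiv ℝ m h‖ₑ := hm.continuous_fderiv.enorm.measurable
  calc ∫⁻ x, ‖∫ y, (a y - a x) * fderiv ℝ m (x - y) (v y - v x)‖ₑ
      ≤ ∫⁻ x, ∫⁻ h, ‖fderiv ℝ m h‖ₑ * (‖a (x - h) - a x‖ₑ * ‖v (x - h) - v x‖ₑ) := by
        refine lintegral_mono fun x => ?_
        rw [← integral_sub_left_eq_self (fun y => (a y - a x) * fderiv ℝ m (x - y) (v y - v x))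
          volume x]
        refine (enorm_integral_le_lintegral_enorm _).trans (lintegral_mono fun h => ?_)
        rw [sub_sub_cancel, enorm_mul, mul_left_comm]
        gcongr
        exact ContinuousLinearMap.le_opENorm _ _
    _ = ∫⁻ h, ∫⁻ x, ‖fderiv ℝ m h‖ₑ * (‖a (x - h) - a x‖ₑ * ‖v (x - h) - v x‖ₑ) := by
        refine lintegral_lintegral_swap (Measurable.aemeasurable ?_)
        refine (hk.comp measurable_snd).mul ?_
        fun_prop
    _ = _ := by
        refine lintegral_congr fun h => ?_
        rw [lintegral_const_mul _ (by fun_prop)]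

lemma IsMollifier.stronglyMeasurable_flux (hm : IsMollifier m ε C) {a : Space N → ℝ}
    (ha : Measurable a) {v : Space N → Space N} (hv : Measurable v) :
    StronglyMeasurable (mollifyFlux m a v) := by
  refine StronglyMeasurable.integral_prod_right (f := fun x y => a y * fderiv ℝ m (x - y) (v y)) ?_
  refine Measurable.stronglyMeasurable ((ha.comp measurable_snd).mul ?_)
  exact hm.continuous_fderiv_apply.measurable.comp
    ((measurable_fst.sub measurable_snd).prodMk (hv.comp measurable_snd))

lemma norm_mollifyFlux_le {a : Space N → ℝ} (ha : Integrable a) {v : Space N → Space N} {B : ℝ}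
    (hB : ∀ x, ‖v x‖ ≤ B) {M : ℝ} (hM : ∀ h, ‖fderiv ℝ m h‖ ≤ M) (x : Space N) :
    ‖mollifyFlux m a v x‖ ≤ M * B * ∫ y, ‖a y‖ := by
  rw [← integral_const_mul]
  refine norm_integral_le_of_norm_le (ha.norm.const_mul _) (ae_of_all _ fun y => ?_)
  rw [norm_mul, mul_comm]
  refine mul_le_mul_of_nonneg_right ?_ (norm_nonneg _)
  exact (ContinuousLinearMap.le_opNorm _ _).trans
    (mul_le_mul (hM _) (hB _) (norm_nonneg _) ((norm_nonneg _).trans (hM 0)))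

/-- The renormalized mollified flux, tested against `ψ`, is controlled by the increment pairing and
by the flux of `v` through the level sets of `ψ`. -/
lemma IsMollifier.enorm_integral_renormalized_flux_le (hm : IsMollifier m ε C) {a : Space N → ℝ}
    (ha : Integrable a) (ham : Measurable a) {v : Space N → Space N} (hv : Measurable v) {B : ℝ}
    (hB : ∀ x, ‖v x‖ ≤ B) (hv0 : ∀ y ∉ Ω, v y = 0) (hvi : Integrable v)
    (hdiv : IsWeaklyDivFree Ω v) {ψ : Space N → ℝ} (hψ : IsTestFunction Ω ψ)
    (hψ1 : ∀ x, |ψ x| ≤ 1) (hψε : ∀ x ∈ tsupport ψ, Metric.closedBall x ε ⊆ Ω) :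
    ‖∫ x, ψ x * (deriv saturation (mollify m a x) * mollifyFlux m a v x)‖ₑ
      ≤ incrementPairing (fun h => ‖fderiv ℝ m h‖ₑ) a v + ∫⁻ x, ‖v x‖ₑ * ‖fderiv ℝ ψ x‖ₑ := by
  set A := mollify m a with hA
  have hAc : ContDiff ℝ ∞ A := hm.contDiff_mollify ha
  have hAd : ∀ x, HasFDerivAt A (fderiv ℝ A x) x := fun x =>
    (hAc.differentiable (by simp) x).hasFDerivAt
  have hψd : ∀ x, HasFDerivAt ψ (fderiv ℝ ψ x) x := fun x =>
    (hψ.contDiff.differentiable (by simp) x).hasFDerivAt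
  have hB0 : 0 ≤ B := (norm_nonneg _).trans (hB 0)
  obtain ⟨M, hM0, hM⟩ := hm.exists_norm_fderiv_le
  have hψi : Integrable ψ :=
    hψ.contDiff.continuous.integrable_of_hasCompactSupport hψ.hasCompactSupport
  have hβA : Continuous fun x => deriv saturation (A x) :=
    (contDiff_saturation.continuous_deriv (by simp)).comp hAc.continuous
  have hψ'c : Continuous (fderiv ℝ ψ) := hψ.contDiff.continuous_fderiv (by simp)
  have hA'c : Continuous (fderiv ℝ A) := hAc.continuous_fderiv (by simp)
  have i1 : Integrable fun x => ψ x * (deriv saturation (A x) * mollifyFlux m a v x) := by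
    refine hψi.mul_bdd (c := 1 * (M * B * ∫ y, ‖a y‖))
      (hβA.aestronglyMeasurable.mul (hm.stronglyMeasurable_flux ham hv).aestronglyMeasurable)
      (ae_of_all _ fun x => ?_)
    rw [norm_mul]
    exact mul_le_mul (abs_deriv_saturation_le _) (norm_mollifyFlux_le ha hB hM x) (norm_nonneg _)
      zero_le_one
  have hcv : ∀ {L : Space N → Space N →L[ℝ] ℝ}, Continuous L → HasCompactSupport L →
      Integrable fun x => L x (v x) := by
    intro L hL hLs
    refine Integrable.mono' ((hL.integrable_of_hasCompactSupport hLs).norm.mul_const B) ?_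
      (ae_of_all _ fun x => ?_)
    · have : Continuous fun z : Space N × Space N => L z.1 z.2 :=
        (hL.comp continuous_fst).clm_apply continuous_snd
      exact (this.measurable.comp (measurable_id.prodMk hv)).aestronglyMeasurable
    · exact (ContinuousLinearMap.le_opNorm _ _).trans
        (mul_le_mul_of_nonneg_left (hB _) (norm_nonneg _))
  have i2 : Integrable fun x => ((ψ x * deriv saturation (A x)) • fderiv ℝ A x) (v x) := by
    refine hcv (L := fun x => (ψ x * deriv saturation (A x)) • fderiv ℝ A x) ?_ ?_
    · exact (hψ.contDiff.continuous.mul hβA).smul hA'c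
    · exact hψ.hasCompactSupport.mono' fun x hx => subset_tsupport _ fun h0 => hx (by simp [h0])
  have i3 : Integrable fun x => (saturation (A x) • fderiv ℝ ψ x) (v x) := by
    refine hcv (L := fun x => saturation (A x) • fderiv ℝ ψ x) ?_ ?_
    · exact (contDiff_saturation.continuous.comp hAc.continuous).smul hψ'c
    · exact (hψ.hasCompactSupport.fderiv ℝ).mono' fun x hx =>
        subset_tsupport _ fun h0 => hx (by simp [h0])
  have hprod : ∀ x, HasFDerivAt (fun x => ψ x * saturation (A x))
      ((ψ x * deriv saturation (A x)) • fderiv ℝ A x + saturation (A x) • fderiv ℝ ψ x) x := by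
    intro x
    have h1 : HasFDerivAt (fun x => saturation (A x))
        (deriv saturation (A x) • fderiv ℝ A x) x :=
      (differentiable_saturation (A x)).hasDerivAt.comp_hasFDerivAt x (hAd x)
    convert! (hψd x).mul h1 using 1
    rw [smul_smul]
  -- The function tested against div v = 0 contains the mollified density itself. It is smooth, and
  -- ψ confines its support to Ω. This integration by parts moves the gradient from the density to
  -- ψ.
  have htest : IsTestFunction Ω fun x => ψ x * saturation (A x) :=
    ⟨hψ.contDiff.mul (contDiff_saturation.comp hAc), hψ.hasCompactSupport.mul_right,
      (tsupport_mul_subset_left).trans hψ.tsupport_subset⟩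
  have hzero : ∫ x, ((ψ x * deriv saturation (A x)) • fderiv ℝ A x) (v x)
      = - ∫ x, (saturation (A x) • fderiv ℝ ψ x) (v x) := by
    have h := hdiv _ htest
    simp_rw [(hprod _).fderiv] at h
    rw [setIntegral_eq_integral_of_forall_compl_eq_zero (fun y hy => by simp [hv0 y hy])] at h
    simp_rw [add_apply] at h
    rw [integral_add i2 i3] at h
    linarith
  have hsplit : ∫ x, ψ x * (deriv saturation (A x) * mollifyFlux m a v x)
      = (∫ x, ψ x * deriv saturation (A x) * (mollifyFlux m a v x - fderiv ℝ A x (v x)))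
        - ∫ x, (saturation (A x) • fderiv ℝ ψ x) (v x) := by
    rw [sub_eq_add_neg, ← hzero, ← integral_add ?_ i2]
    · refine integral_congr_ae (ae_of_all _ fun x => ?_)
      simp only [smul_apply, smul_eq_mul]
      ring
    · refine (i1.sub i2).congr (ae_of_all _ fun x => ?_)
      simp only [smul_apply, smul_eq_mul, Pi.sub_apply]
      ring
  rw [hsplit]
  refine enorm_sub_le.trans (add_le_add ?_ ?_)
  · refine (enorm_integral_le_lintegral_enorm _).trans
      (le_trans (lintegral_mono fun x => ?_) (hm.lintegral_commutator_le ham hv))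
    -- The commutator identity needs the ε-ball around x to lie in Ω, which is known on the support
    -- of ψ; elsewhere the integrand is zero.
    by_cases hx : x ∈ tsupport ψ
    · rw [hm.flux_sub_fderiv_eq ha hv hB hv0 hvi hdiv (hψε x hx), enorm_mul]
      refine mul_le_of_le_one_left' ?_
      rw [← ofReal_norm, ENNReal.ofReal_le_one, norm_mul]
      exact mul_le_one₀ (hψ1 x) (norm_nonneg _) (abs_deriv_saturation_le _)
    · simp [image_eq_zero_of_notMem_tsupport hx]
  · refine (enorm_integral_le_lintegral_enorm _).trans (lintegral_mono fun x => ?_)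
    rw [smul_apply, smul_eq_mul, enorm_mul, mul_comm ‖v x‖ₑ]
    refine le_trans (mul_le_of_le_one_left' ?_) (ContinuousLinearMap.le_opENorm _ _)
    rw [← ofReal_norm, ENNReal.ofReal_le_one, Real.norm_of_nonneg (saturation_nonneg _)]
    exact saturation_le_one _

end Mollify

/-! ### Measurable choice of a near-optimal index -/

section Selection

/-- The running minimizer among the indices 0, …, M is measurable, its error decreases to zero
almost everywhere, and d 0 dominates. Stopping at a finite M keeps the index bounded, so that
averages over the chosen index are finite sums. -/
lemma exists_measurable_index_lintegral_le {α : Type*} [MeasurableSpace α] {μ : Measure α}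
    {d : ℕ → α → ℝ≥0∞} (hd : ∀ k, Measurable (d k)) (h0 : ∫⁻ t, d 0 t ∂μ ≠ ⊤)
    (hinf : ∀ᵐ t ∂μ, ∀ δ > 0, ∃ k, d k t < δ) {δ : ℝ≥0∞} (hδ : 0 < δ) :
    ∃ κ : α → ℕ, Measurable κ ∧ (∃ M, ∀ t, κ t ≤ M) ∧ ∫⁻ t, d (κ t) t ∂μ ≤ δ := by
  have hd' : Measurable fun z : ℕ × α => d z.1 z.2 := measurable_from_prod_countable_right hd
  let κ : ℕ → α → ℕ := fun M => Nat.rec (fun _ => 0)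
    (fun M κ t => if d (M + 1) t < d (κ t) t then M + 1 else κ t) M
  have hκs : ∀ M t, κ (M + 1) t = if d (M + 1) t < d (κ M t) t then M + 1 else κ M t :=
    fun _ _ => rfl
  have hκm : ∀ M, Measurable (κ M) := by
    intro M
    induction M with
    | zero => exact measurable_const
    | succ M ih =>
      exact Measurable.ite (measurableSet_lt (hd _) (hd'.comp (ih.prodMk measurable_id)))
        measurable_const ih
  have hκb : ∀ M t, κ M t ≤ M := by
    intro M t
    induction M with
    | zero => exact le_rfl
    | succ M ih =>
      rw [hκs]
      split_ifs
      · exact le_rfl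
      · omega
  have hκd : ∀ M t, ∀ k ≤ M, d (κ M t) t ≤ d k t := by
    intro M t
    induction M with
    | zero =>
      intro k hk
      rw [Nat.le_zero.1 hk]
      exact le_rfl
    | succ M ih =>
      intro k hk
      rw [hκs]
      rcases Nat.le_succ_iff.1 hk with hk | rfl
      · split_ifs with h
        · exact h.le.trans (ih k hk)
        · exact ih k hk
      · split_ifs with h
        · exact le_rfl
        · exact not_lt.1 h
  have hlim : Tendsto (fun M => ∫⁻ t, d (κ M t) t ∂μ) atTop (𝓝 (∫⁻ _, 0 ∂μ)) := by
    refine tendsto_lintegral_of_dominated_convergence (d 0)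
      (fun M => hd'.comp ((hκm M).prodMk measurable_id))
      (fun M => ae_of_all _ fun t => hκd M t 0 (Nat.zero_le _)) h0 ?_
    filter_upwards [hinf] with t ht
    rw [ENNReal.tendsto_nhds_zero]
    intro δ hδ
    obtain ⟨k, hk⟩ := ht δ hδ
    filter_upwards [eventually_ge_atTop k] with M hM
    exact (hκd M t k hM).trans hk.le
  rw [lintegral_zero] at hlim
  obtain ⟨M, hM⟩ := ((ENNReal.tendsto_nhds_zero.1 hlim) δ hδ).exists
  exact ⟨κ M, hκm M, ⟨M, hκb M⟩, hM⟩

end Selection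

/-! ### Smooth approximation of the norm -/

section SmoothNorm

variable {F : Type*} [NormedAddCommGroup F] [InnerProductSpace ℝ F]

/-- A smooth approximation of the norm which vanishes at the origin. -/
noncomputable def smoothNorm (s : ℝ) (z : F) : ℝ := √(‖z‖ ^ 2 + s ^ 2) - s

lemma contDiff_smoothNorm {s : ℝ} (hs : 0 < s) : ContDiff ℝ ∞ (smoothNorm s : F → ℝ) :=
  (((contDiff_norm_sq ℝ).add contDiff_const).sqrt fun z => by positivity).sub contDiff_const

lemma smoothNorm_zero {s : ℝ} (hs : 0 < s) : smoothNorm s (0 : F) = 0 := by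
  simp [smoothNorm, Real.sqrt_sq hs.le]

lemma abs_smoothNorm_sub_norm_le {s : ℝ} (hs : 0 < s) (z : F) : |smoothNorm s z - ‖z‖| ≤ s := by
  unfold smoothNorm
  have h1 : ‖z‖ ≤ √(‖z‖ ^ 2 + s ^ 2) := Real.le_sqrt_of_sq_le (by nlinarith)
  have h2 : √(‖z‖ ^ 2 + s ^ 2) ≤ ‖z‖ + s :=
    Real.sqrt_le_iff.2 ⟨by positivity, by nlinarith [norm_nonneg z]⟩
  rw [abs_le]
  constructor <;> linarith

lemma lipschitzWith_smoothNorm (s : ℝ) : LipschitzWith 1 (smoothNorm s : F → ℝ) := by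
  have key : ∀ a b : ℝ, 0 ≤ a → 0 ≤ b → √(a ^ 2 + s ^ 2) ≤ √(b ^ 2 + s ^ 2) + |a - b| := by
    intro a b ha hb
    refine Real.sqrt_le_iff.2 ⟨by positivity, ?_⟩
    have h1 : b ≤ √(b ^ 2 + s ^ 2) := Real.le_sqrt_of_sq_le (by nlinarith)
    have h2 : √(b ^ 2 + s ^ 2) ^ 2 = b ^ 2 + s ^ 2 := Real.sq_sqrt (by positivity)
    have h3 : a ≤ b + |a - b| := by linarith [le_abs_self (a - b)]
    nlinarith [abs_nonneg (a - b)]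
  refine LipschitzWith.of_dist_le_mul fun z w => ?_
  rw [NNReal.coe_one, one_mul, Real.dist_eq, dist_eq_norm]
  have h := abs_norm_sub_norm_le z w
  have h1 := key ‖z‖ ‖w‖ (norm_nonneg _) (norm_nonneg _)
  have h2 := key ‖w‖ ‖z‖ (norm_nonneg _) (norm_nonneg _)
  rw [abs_sub_comm] at h2
  unfold smoothNorm
  rw [abs_le]
  constructor <;> linarith

end SmoothNorm

/-! ### Separability of the space of jets -/

section Jet

variable {N : ℕ} {Ω : Set (Space N)}

/-- A field together with its partial derivatives. -/
noncomputable def jet (φ : Space N → Space N) (x : Space N) : Space N × (Fin N → Space N) :=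
  (φ x, fun i => partialDeriv i φ x)

lemma IsTestFunction.continuous_jet {φ : Space N → Space N} (hφ : IsTestFunction Ω φ) :
    Continuous (jet φ) :=
  hφ.contDiff.continuous.prodMk (continuous_pi fun i => hφ.continuous_partialDeriv i)

lemma IsTestFunction.hasCompactSupport_jet {φ : Space N → Space N} (hφ : IsTestFunction Ω φ) :
    HasCompactSupport (jet φ) := by
  refine hφ.hasCompactSupport.mono' fun x hx => ?_
  by_contra h
  refine hx ?_
  have h1 : φ x = 0 := image_eq_zero_of_notMem_tsupport h
  have h2 : fderiv ℝ φ x = 0 :=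
    image_eq_zero_of_notMem_tsupport fun h' => h (tsupport_fderiv_subset ℝ h')
  ext <;> simp [jet, partialDeriv, h1, h2]

lemma IsTestFunction.integrable_jet {φ : Space N → Space N} (hφ : IsTestFunction Ω φ) :
    Integrable (jet φ) (spaceMeasure Ω) :=
  hφ.continuous_jet.integrable_of_hasCompactSupport hφ.hasCompactSupport_jet

/-- L¹ is separable and subsets of separable metric spaces are separable, so a dense sequence can be
taken among the jets of test fields. The zero field is put in front as index 0, where its jet error
is the norm of the target: an integrable majorant for the later selection. -/
lemma exists_seq_dense_jet (Ω : Set (Space N)) :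
    ∃ φ : ℕ → Space N → Space N, φ 0 = 0 ∧ (∀ k, IsTestFunction Ω (φ k)) ∧
      ∀ ψ, IsTestFunction Ω ψ → ∀ δ > 0, ∃ k,
        ∫⁻ x, ‖jet ψ x - jet (φ k) x‖ₑ ∂spaceMeasure Ω < δ := by
  let F : {φ : Space N → Space N // IsTestFunction Ω φ} →
      Lp (Space N × (Fin N → Space N)) 1 (spaceMeasure Ω) :=
    fun φ => φ.2.integrable_jet.toL1 _
  have : Fact ((1 : ℝ≥0∞) ≠ ⊤) := ⟨by simp⟩
  have : Nonempty (Set.range F) := ⟨⟨_, ⟨⟨_, isTestFunction_zero⟩, rfl⟩⟩⟩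
  obtain ⟨s, hs⟩ := TopologicalSpace.exists_dense_seq (Set.range F)
  choose g hg using fun k => (s k).2
  refine ⟨fun k => Nat.casesOn k 0 fun k => (g k).1, rfl, ?_, ?_⟩
  · rintro (_ | k)
    · exact isTestFunction_zero
    · exact (g k).2
  · intro ψ hψ δ hδ
    obtain ⟨k, hk⟩ := hs.exists_mem_open (Metric.isOpen_eball (x := (⟨F ⟨ψ, hψ⟩, ⟨_, rfl⟩⟩ :
      Set.range F)) (ε := δ)) ⟨_, Metric.mem_eball_self hδ⟩
    -- The shift by one accounts for the zero field inserted at index 0.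
    refine ⟨k + 1, ?_⟩
    rw [Metric.mem_eball, Subtype.edist_eq, edist_comm, ← hg k] at hk
    refine lt_of_eq_of_lt ?_ hk
    rw [Lp.edist_def, eLpNorm_one_eq_lintegral_enorm]
    refine lintegral_congr_ae ?_
    filter_upwards [hψ.integrable_jet.coeFn_toL1, (g k).2.integrable_jet.coeFn_toL1] with x h1 h2
    rw [Pi.sub_apply, h1, h2]

end Jet

/-! ### Test functions close to the time-averaged speed -/

section TimeAverage

variable {N : ℕ} {Ω : Set (Space N)}

/-- A time average over a selected index is a linear combination of finitely many terms, weighted by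
the measures of the level sets of κ. Averages of test functions chosen in this way are again test
functions. -/
lemma integral_comp_index {α : Type*} [MeasurableSpace α] {ν : Measure α} [IsFiniteMeasure ν]
    {κ : α → ℕ} (hκ : Measurable κ) {M : ℕ} (hM : ∀ t, κ t ≤ M) (f : ℕ → ℝ) :
    ∫ t, f (κ t) ∂ν = ∑ k ∈ Finset.range (M + 1), ν.real (κ ⁻¹' {k}) * f k := by
  have h : ∀ t, f (κ t)
      = ∑ k ∈ Finset.range (M + 1), (κ ⁻¹' {k}).indicator (fun _ => f k) t := by
    intro t
    rw [Finset.sum_eq_single (κ t)]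
    · simp
    · intro k _ hk
      exact Set.indicator_of_notMem (fun h => hk h.symm) _
    · intro h
      exact absurd (Finset.mem_range.2 (Nat.lt_succ_of_le (hM t))) h
  simp_rw [h]
  rw [integral_finsetSum]
  · refine Finset.sum_congr rfl fun k _ => ?_
    rw [integral_indicator_const _ (hκ (measurableSet_singleton k)), smul_eq_mul]
  · intro k _
    exact (integrable_const (f k)).indicator (hκ (measurableSet_singleton k))

lemma integrable_comp_index {α : Type*} [MeasurableSpace α] {ν : Measure α} [IsFiniteMeasure ν]
    {κ : α → ℕ} (hκ : Measurable κ) {M : ℕ} (hM : ∀ t, κ t ≤ M) (f : ℕ → ℝ) :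
    Integrable (fun t => f (κ t)) ν := by
  refine Integrable.mono' (integrable_const (∑ k ∈ Finset.range (M + 1), ‖f k‖))
    ((measurable_of_countable f).comp hκ).aestronglyMeasurable (ae_of_all _ fun t => ?_)
  exact Finset.single_le_sum (f := fun k => ‖f k‖) (fun k _ => norm_nonneg _)
    (Finset.mem_range.2 (Nat.lt_succ_of_le (hM t)))

/-- Smooth compactly supported approximations of the time average of the speed, with derivatives
controlled by the time average of the jet. -/
lemma exists_testFunction_near_average {ν : Measure ℝ} [IsFiniteMeasure ν]
    {P : ℝ → Space N → Space N × (Fin N → Space N)} (hP : Measurable (Function.uncurry P))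
    (hPi : ∫⁻ t, ∫⁻ x, ‖P t x‖ₑ ∂spaceMeasure Ω ∂ν ≠ ⊤)
    (hPint : ∀ x, Integrable (fun t => (P t x).1) ν)
    (happ : ∀ᵐ t ∂ν, ∀ δ > 0, ∃ ψ, IsTestFunction Ω ψ ∧
      ∫⁻ x, ‖P t x - jet ψ x‖ₑ ∂spaceMeasure Ω < δ) {δ : ℝ≥0∞} (hδ : 0 < δ) :
    ∃ V : Space N → ℝ, IsTestFunction Ω V ∧ ∃ e : Space N → ℝ≥0∞, Measurable e ∧
      ∫⁻ x, e x ∂spaceMeasure Ω ≤ δ ∧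
      (∀ x, ‖V x - ∫ t, ‖(P t x).1‖ ∂ν‖ₑ ≤ e x + δ) ∧
      (∀ x, ‖fderiv ℝ V x‖ₑ ≤ N * (∫⁻ t, ‖P t x‖ₑ ∂ν + e x)) := by
  obtain ⟨φ, hφ0, hφ, hφd⟩ := exists_seq_dense_jet Ω
  have hj0 : jet (φ 0) = 0 := by
    ext1 x
    rw [hφ0]
    ext <;> simp [jet, partialDeriv]
  have hdm : ∀ k, Measurable fun t => ∫⁻ x, ‖P t x - jet (φ k) x‖ₑ ∂spaceMeasure Ω := by
    intro k
    refine Measurable.lintegral_prod_right' (f := fun z : ℝ × Space N =>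
      ‖P z.1 z.2 - jet (φ k) z.2‖ₑ) ?_
    exact (hP.sub ((hφ k).continuous_jet.measurable.comp measurable_snd)).enorm
  obtain ⟨κ, hκ, ⟨M, hM⟩, hκδ⟩ := exists_measurable_index_lintegral_le (μ := ν) (δ := δ) hdm
    (by simpa [hj0] using hPi) (by
      filter_upwards [happ] with t ht δ hδ
      obtain ⟨ψ, hψ, hψδ⟩ := ht (δ / 2) (ENNReal.half_pos hδ.ne')
      obtain ⟨k, hk⟩ := hφd ψ hψ (δ / 2) (ENNReal.half_pos hδ.ne')
      refine ⟨k, ?_⟩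
      calc ∫⁻ x, ‖P t x - jet (φ k) x‖ₑ ∂spaceMeasure Ω
          ≤ ∫⁻ x, (‖P t x - jet ψ x‖ₑ + ‖jet ψ x - jet (φ k) x‖ₑ) ∂spaceMeasure Ω := by
            refine lintegral_mono fun x => ?_
            rw [← sub_add_sub_cancel (P t x) (jet ψ x) (jet (φ k) x)]
            exact enorm_add_le _ _
        _ < δ / 2 + δ / 2 := by
            rw [lintegral_add_right _ (by
              exact (hψ.continuous_jet.sub (hφ k).continuous_jet).enorm.measurable)]
            exact ENNReal.add_lt_add hψδ hk
        _ = δ := ENNReal.add_halves δ) hδ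
  have hjm : Measurable fun z : ℝ × Space N => jet (φ (κ z.1)) z.2 := by
    have : Measurable fun z : ℕ × Space N => jet (φ z.1) z.2 :=
      measurable_from_prod_countable_right fun k => (hφ k).continuous_jet.measurable
    exact this.comp ((hκ.comp measurable_fst).prodMk measurable_snd)
  have hdiffm : Measurable fun z : ℝ × Space N => ‖P z.1 z.2 - jet (φ (κ z.1)) z.2‖ₑ :=
    (hP.sub hjm).enorm
  -- Smoothing the norm costs at most s at each time, hence ν(ℝ) s after averaging; s is chosen so
  -- that this is at most δ.
  obtain ⟨s, hs, hsδ⟩ : ∃ s : ℝ, 0 < s ∧ ENNReal.ofReal (ν.real Set.univ * s) ≤ δ := by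
    have ht : Tendsto (fun s : ℝ => ENNReal.ofReal (ν.real Set.univ * s)) (𝓝[>] 0) (𝓝 0) := by
      have : Continuous fun s : ℝ => ENNReal.ofReal (ν.real Set.univ * s) :=
        ENNReal.continuous_ofReal.comp (continuous_const.mul continuous_id)
      have := this.tendsto 0
      simp only [mul_zero, ENNReal.ofReal_zero] at this
      exact this.mono_left nhdsWithin_le_nhds
    obtain ⟨s, hs1, hs2⟩ := (((ENNReal.tendsto_nhds_zero.1 ht) δ hδ).and
      self_mem_nhdsWithin).exists
    exact ⟨s, hs2, hs1⟩
  set a : ℕ → ℝ := fun k => ν.real (κ ⁻¹' {k}) with ha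
  have hjc : ∀ k, IsTestFunction Ω fun x => smoothNorm s (φ k x) := by
    intro k
    have hsub : tsupport (fun x => smoothNorm s (φ k x)) ⊆ tsupport (φ k) :=
      closure_mono fun x hx h0 => hx (by simp only [h0, smoothNorm_zero hs])
    exact ⟨(contDiff_smoothNorm hs).comp (hφ k).contDiff,
      (hφ k).hasCompactSupport.of_isClosed_subset (isClosed_tsupport _) hsub,
      hsub.trans (hφ k).tsupport_subset⟩
  have hfd : ∀ k x, ‖fderiv ℝ (fun x => smoothNorm s (φ k x)) x‖ ≤ N * ‖jet (φ k) x‖ := by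
    intro k x
    have h1 : HasFDerivAt (smoothNorm s : Space N → ℝ) (fderiv ℝ (smoothNorm s) (φ k x)) (φ k x) :=
      ((contDiff_smoothNorm hs).differentiable (by simp) _).hasFDerivAt
    have h2 : HasFDerivAt (φ k) (fderiv ℝ (φ k) x) x :=
      ((hφ k).contDiff.differentiable (by simp) _).hasFDerivAt
    have h3 := (h1.comp x h2).fderiv
    have h4 : ‖fderiv ℝ (smoothNorm s : Space N → ℝ) (φ k x)‖ ≤ 1 := by
      simpa using norm_fderiv_le_of_lipschitz ℝ (lipschitzWith_smoothNorm (F := Space N) s)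
    calc ‖fderiv ℝ (fun x => smoothNorm s (φ k x)) x‖
        = ‖(fderiv ℝ (smoothNorm s : Space N → ℝ) (φ k x)).comp (fderiv ℝ (φ k) x)‖ := by
          rw [← h3]; rfl
      _ ≤ 1 * ∑ i, ‖partialDeriv i (φ k) x‖ :=
          (ContinuousLinearMap.opNorm_comp_le _ _).trans
            (mul_le_mul h4 (norm_fderiv_le_sum_partialDeriv _ _) (norm_nonneg _) zero_le_one)
      _ ≤ N * ‖jet (φ k) x‖ := by
          rw [one_mul]
          refine (Finset.sum_le_card_nsmul _ _ ‖jet (φ k) x‖ fun i _ => ?_).trans (by simp)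
          exact (norm_le_pi_norm (jet (φ k) x).2 i).trans (norm_snd_le _)
  have hVeq : ∀ x, ∑ k ∈ Finset.range (M + 1), a k * smoothNorm s (φ k x)
      = ∫ t, smoothNorm s (φ (κ t) x) ∂ν := fun x =>
    (integral_comp_index hκ hM fun k => smoothNorm s (φ k x)).symm
  -- V averages the smoothed speeds of the selected fields, and e is the time-averaged jet error.
  -- The selection and Tonelli bound ∫ e by δ; the further δ in the pointwise bound pays for the
  -- smoothing of the norm.
  refine ⟨fun x => ∑ k ∈ Finset.range (M + 1), a k * smoothNorm s (φ k x), ?_,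
    fun x => ∫⁻ t, ‖P t x - jet (φ (κ t)) x‖ₑ ∂ν, ?_, ?_, ?_, ?_⟩
  · have hcs : tsupport (fun x => ∑ k ∈ Finset.range (M + 1), a k * smoothNorm s (φ k x))
        ⊆ ⋃ k ∈ Finset.range (M + 1), tsupport fun x => smoothNorm s (φ k x) := by
      refine closure_minimal (fun x hx => ?_)
        (isClosed_biUnion_finset fun k _ => isClosed_tsupport _)
      by_contra h
      refine hx (Finset.sum_eq_zero fun k hk => ?_)
      have : smoothNorm s (φ k x) = 0 := by
        by_contra h0
        exact h (Set.mem_biUnion hk (subset_tsupport _ h0))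
      rw [this, mul_zero]
    refine ⟨ContDiff.sum fun k _ => contDiff_const.mul (hjc k).contDiff, ?_, ?_⟩
    · exact ((Finset.range (M + 1)).isCompact_biUnion fun k _ =>
        (hjc k).hasCompactSupport).of_isClosed_subset (isClosed_tsupport _) hcs
    · exact hcs.trans (Set.iUnion₂_subset fun k _ => (hjc k).tsupport_subset)
  · exact Measurable.lintegral_prod_left' hdiffm
  · rw [lintegral_lintegral_swap]
    · exact hκδ
    · exact (hdiffm.comp measurable_swap).aemeasurable
  · intro x
    have i1 := integrable_comp_index (ν := ν) hκ hM fun k => smoothNorm s (φ k x)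
    beta_reduce
    rw [hVeq, ← integral_sub i1 (hPint x).norm]
    calc ‖∫ t, (smoothNorm s (φ (κ t) x) - ‖(P t x).1‖) ∂ν‖ₑ
        ≤ ∫⁻ t, ‖smoothNorm s (φ (κ t) x) - ‖(P t x).1‖‖ₑ ∂ν :=
          enorm_integral_le_lintegral_enorm _
      _ ≤ ∫⁻ t, (‖P t x - jet (φ (κ t)) x‖ₑ + ENNReal.ofReal s) ∂ν := by
          refine lintegral_mono fun t => ?_
          rw [← ofReal_norm, ← ofReal_norm, ← ENNReal.ofReal_add (norm_nonneg _) hs.le]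
          refine ENNReal.ofReal_le_ofReal ?_
          have h1 := abs_smoothNorm_sub_norm_le hs (φ (κ t) x)
          have h2 := abs_norm_sub_norm_le (φ (κ t) x) (P t x).1
          have h3 : ‖φ (κ t) x - (P t x).1‖ ≤ ‖P t x - jet (φ (κ t)) x‖ := by
            rw [norm_sub_rev]
            exact norm_fst_le (P t x - jet (φ (κ t)) x)
          rw [Real.norm_eq_abs]
          rw [abs_le] at h1 h2 ⊢
          constructor <;> linarith
      _ ≤ _ := by
          rw [lintegral_add_right _ measurable_const, lintegral_const]
          gcongr
          refine le_trans (le_of_eq ?_) hsδ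
          rw [ENNReal.ofReal_mul measureReal_nonneg, mul_comm, measureReal_def,
            ENNReal.ofReal_toReal (measure_ne_top _ _)]
  · intro x
    have hd : HasFDerivAt (fun x => ∑ k ∈ Finset.range (M + 1), a k * smoothNorm s (φ k x))
        (∑ k ∈ Finset.range (M + 1), a k • fderiv ℝ (fun x => smoothNorm s (φ k x)) x) x :=
      HasFDerivAt.fun_sum fun k _ =>
        (((hjc k).contDiff.differentiable (by simp) x).hasFDerivAt).const_mul (a k)
    have hb : ‖∑ k ∈ Finset.range (M + 1), a k • fderiv ℝ (fun x => smoothNorm s (φ k x)) x‖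
        ≤ ∫ t, N * ‖jet (φ (κ t)) x‖ ∂ν := by
      rw [integral_comp_index hκ hM fun k => N * ‖jet (φ k) x‖]
      refine (norm_sum_le _ _).trans (Finset.sum_le_sum fun k _ => ?_)
      rw [norm_smul, Real.norm_of_nonneg measureReal_nonneg]
      exact mul_le_mul_of_nonneg_left (hfd k x) measureReal_nonneg
    rw [hd.fderiv, ← ofReal_norm]
    refine (ENNReal.ofReal_le_ofReal hb).trans ?_
    rw [ofReal_integral_eq_lintegral_ofReal
      (integrable_comp_index hκ hM fun k => N * ‖jet (φ k) x‖) (ae_of_all _ fun t => by positivity)]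
    have hPm : Measurable fun t => ‖P t x‖ₑ :=
      (hP.comp (measurable_id.prodMk measurable_const)).enorm
    rw [← lintegral_add_left hPm, ← lintegral_const_mul' _ _ (by simp)]
    refine lintegral_mono fun t => ?_
    rw [ENNReal.ofReal_mul (by positivity), ENNReal.ofReal_natCast, ofReal_norm]
    gcongr
    have : jet (φ (κ t)) x = P t x - (P t x - jet (φ (κ t)) x) := by abel
    nth_rewrite 1 [this]
    exact enorm_sub_le

end TimeAverage

/-! ### Cutoffs from level sets of the averaged speed -/

section Cutoff

lemma deriv_smoothTransition_eq_zero {s : ℝ} (hs : s < 0 ∨ 1 < s) :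
    deriv Real.smoothTransition s = 0 := by
  rcases hs with hs | hs
  · have : Real.smoothTransition =ᶠ[𝓝 s] fun _ => 0 := by
      filter_upwards [gt_mem_nhds hs] with r hr
      exact Real.smoothTransition.zero_of_nonpos hr.le
    rw [this.deriv_eq, deriv_const]
  · have : Real.smoothTransition =ᶠ[𝓝 s] fun _ => 1 := by
      filter_upwards [lt_mem_nhds hs] with r hr
      exact Real.smoothTransition.one_of_one_le hr.le
    rw [this.deriv_eq, deriv_const]

lemma exists_bound_deriv_smoothTransition :
    ∃ M : ℝ, 0 < M ∧ ∀ s, |deriv Real.smoothTransition s| ≤ M := by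
  have hc : Continuous (deriv Real.smoothTransition) :=
    (Real.smoothTransition.contDiff (n := 1)).continuous_deriv (by simp)
  obtain ⟨M, hM⟩ := isCompact_Icc.exists_bound_of_continuousOn (s := Set.Icc (0 : ℝ) 1)
    hc.continuousOn
  refine ⟨max M 1, by positivity, fun s => ?_⟩
  by_cases hs : s ∈ Set.Icc (0 : ℝ) 1
  · exact (hM s hs).trans (le_max_left _ _)
  · rw [Set.mem_Icc, not_and_or, not_le, not_le] at hs
    rw [deriv_smoothTransition_eq_zero hs, abs_zero]
    positivity

variable {N : ℕ} {Ω : Set (Space N)}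

/-- Truncating a test function at level `ε`. -/
noncomputable def truncation (ε : ℝ) (V : Space N → ℝ) (x : Space N) : ℝ :=
  Real.smoothTransition (V x / ε - 1)

lemma truncation_nonneg (ε : ℝ) (V : Space N → ℝ) (x : Space N) : 0 ≤ truncation ε V x :=
  Real.smoothTransition.nonneg _

lemma truncation_le_one (ε : ℝ) (V : Space N → ℝ) (x : Space N) : truncation ε V x ≤ 1 :=
  Real.smoothTransition.le_one _

lemma truncation_eq_one {ε : ℝ} (hε : 0 < ε) {V : Space N → ℝ} {x : Space N}
    (h : 2 * ε ≤ V x) : truncation ε V x = 1 := by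
  refine Real.smoothTransition.one_of_one_le ?_
  have : 2 ≤ V x / ε := (le_div_iff₀ hε).2 h
  linarith

lemma IsTestFunction.truncation {V : Space N → ℝ} (hV : IsTestFunction Ω V) (ε : ℝ) :
    IsTestFunction Ω (truncation ε V) := by
  have hsub : tsupport (Transport.truncation ε V) ⊆ tsupport V := by
    refine closure_mono fun x hx h0 => hx ?_
    exact Real.smoothTransition.zero_of_nonpos (by simp [h0])
  exact ⟨Real.smoothTransition.contDiff.comp ((hV.contDiff.div_const ε).sub contDiff_const),
    hV.hasCompactSupport.of_isClosed_subset (isClosed_tsupport _) hsub,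
    hsub.trans hV.tsupport_subset⟩

lemma IsTestFunction.fderiv_truncation {V : Space N → ℝ} (hV : IsTestFunction Ω V) (ε : ℝ)
    (x : Space N) : fderiv ℝ (Transport.truncation ε V) x
      = (deriv Real.smoothTransition (V x / ε - 1) / ε) • fderiv ℝ V x := by
  have h1 : HasFDerivAt V (fderiv ℝ V x) x :=
    (hV.contDiff.differentiable (by simp) x).hasFDerivAt
  have h2 : HasFDerivAt (fun x => V x / ε - 1) (ε⁻¹ • fderiv ℝ V x) x := by
    simpa [div_eq_inv_mul] using (h1.const_mul ε⁻¹).sub_const 1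
  have h3 : HasDerivAt Real.smoothTransition
      (deriv Real.smoothTransition (V x / ε - 1)) (V x / ε - 1) :=
    ((Real.smoothTransition.contDiff (n := 1)).differentiable (by simp) _).hasDerivAt
  have := h3.comp_hasFDerivAt x h2
  rw [smul_smul, ← div_eq_mul_inv] at this
  exact this.fderiv

lemma enorm_le_ofReal {r s : ℝ} (h : |r| ≤ s) : ‖r‖ₑ ≤ ENNReal.ofReal s := by
  rw [← ofReal_norm]
  exact ENNReal.ofReal_le_ofReal h

lemma enorm_clm_add_le {E F : Type*} [NormedAddCommGroup E] [NormedSpace ℝ E]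
    [NormedAddCommGroup F] [NormedSpace ℝ F] (f g : E →L[ℝ] F) : ‖f + g‖ₑ ≤ ‖f‖ₑ + ‖g‖ₑ := by
  rw [← ofReal_norm, ← ofReal_norm, ← ofReal_norm,
    ← ENNReal.ofReal_add (norm_nonneg _) (norm_nonneg _)]
  exact ENNReal.ofReal_le_ofReal (norm_add_le f g)

/-- The derivative of a truncation lives where the truncated function is comparable to the
truncation level. -/
lemma IsTestFunction.enorm_mul_fderiv_truncation_le {V : Space N → ℝ} (hV : IsTestFunction Ω V)
    {M : ℝ} (hM : ∀ s, |deriv Real.smoothTransition s| ≤ M) {ε : ℝ} (hε : 0 < ε)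
    {U : Space N → ℝ} {B : ℝ} (hUB : ∀ x, |U x| ≤ B) {e : Space N → ℝ≥0∞} {δ : ℝ≥0∞}
    (hδ : δ ≤ ENNReal.ofReal (ε / 4)) (hVU : ∀ x, ‖V x - U x‖ₑ ≤ e x + δ) (x : Space N) :
    ‖U x‖ₑ * ‖fderiv ℝ (Transport.truncation ε V) x‖ₑ
      ≤ (ENNReal.ofReal (3 * M) * {x | ε / 2 ≤ U x ∧ U x ≤ 3 * ε}.indicator 1 x
        + ENNReal.ofReal (B * (M / ε)) * {x | ENNReal.ofReal (ε / 4) ≤ e x}.indicator 1 x)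
        * ‖fderiv ℝ V x‖ₑ := by
  rw [hV.fderiv_truncation]
  have hsm : ‖(deriv Real.smoothTransition (V x / ε - 1) / ε) • fderiv ℝ V x‖ₑ
      = ‖deriv Real.smoothTransition (V x / ε - 1) / ε‖ₑ * ‖fderiv ℝ V x‖ₑ := enorm_smul _ _
  rw [hsm, ← mul_assoc]
  gcongr
  have hM0 : 0 ≤ M := (abs_nonneg _).trans (hM 0)
  -- The transition is locally constant in these two cases. In the remaining one ε ≤ V x ≤ 2ε.
  by_cases h0 : V x / ε - 1 < 0 ∨ 1 < V x / ε - 1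
  · simp [deriv_smoothTransition_eq_zero h0]
  push Not at h0
  have h1 : ε ≤ V x := by
    have : 1 ≤ V x / ε := by linarith [h0.1]
    rwa [one_le_div hε] at this
  have h2 : V x ≤ 2 * ε := by
    have : V x / ε ≤ 2 := by linarith [h0.2]
    rwa [div_le_iff₀ hε] at this
  have hd : |deriv Real.smoothTransition (V x / ε - 1) / ε| ≤ M / ε := by
    rw [abs_div, abs_of_pos hε]
    gcongr
    exact hM _
  rw [← enorm_mul]
  -- Where e is at least ε/4, only the crude bound B M/ε is available, but Markov's inequality will
  -- make this set small. Elsewhere |V - U| ≤ ε/2, so U lies between ε/2 and 3ε, and the factor U ≤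
  -- 3ε cancels the 1/ε of the truncation, leaving 3M.
  by_cases he : ENNReal.ofReal (ε / 4) ≤ e x
  · refine le_trans ?_ le_add_self
    rw [Set.indicator_of_mem (by exact he), Pi.one_apply, mul_one]
    refine enorm_le_ofReal ?_
    rw [abs_mul]
    exact mul_le_mul (hUB x) hd (abs_nonneg _) ((abs_nonneg _).trans (hUB x))
  · have h3 : |V x - U x| ≤ ε / 2 := by
      have h4 : ‖V x - U x‖ₑ ≤ ENNReal.ofReal (ε / 2) := by
        refine (hVU x).trans ((add_le_add (not_le.1 he).le hδ).trans (le_of_eq ?_))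
        rw [← ENNReal.ofReal_add (by positivity) (by positivity)]
        ring_nf
      rw [← ofReal_norm] at h4
      exact (ENNReal.ofReal_le_ofReal_iff (by positivity)).1 h4
    rw [abs_le] at h3
    have hU1 : ε / 2 ≤ U x := by linarith
    have hU2 : U x ≤ 3 * ε := by linarith
    refine le_trans ?_ le_self_add
    rw [Set.indicator_of_mem (by exact ⟨hU1, hU2⟩), Pi.one_apply, mul_one]
    refine enorm_le_ofReal ?_
    rw [abs_mul, abs_of_nonneg (by linarith : 0 ≤ U x)]
    calc U x * |deriv Real.smoothTransition (V x / ε - 1) / ε| ≤ 3 * ε * (M / ε) :=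
          mul_le_mul hU2 hd (abs_nonneg _) (by positivity)
      _ = 3 * M := by field_simp

/-- Where the truncation is not 1, V is below 2ε and U exceeds V by at most e + δ. This is what
makes the gradient of ψ cheap in the region where ψ completes the cutoff. -/
lemma enorm_mul_one_sub_truncation_le {V : Space N → ℝ} {ε : ℝ} (hε : 0 < ε)
    {U : Space N → ℝ} (hU0 : ∀ x, 0 ≤ U x) {e : Space N → ℝ≥0∞} {δ : ℝ≥0∞}
    (hVU : ∀ x, ‖V x - U x‖ₑ ≤ e x + δ) (x : Space N) :
    ‖U x‖ₑ * ‖1 - truncation ε V x‖ₑ ≤ ENNReal.ofReal (2 * ε) + (e x + δ) := by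
  by_cases h : 2 * ε ≤ V x
  · simp [truncation_eq_one hε h]
  calc ‖U x‖ₑ * ‖1 - truncation ε V x‖ₑ ≤ ‖U x‖ₑ * 1 := by
        gcongr
        rw [← ENNReal.ofReal_one]
        refine enorm_le_ofReal ?_
        rw [abs_le]
        constructor <;> linarith [truncation_nonneg ε V x, truncation_le_one ε V x]
    _ ≤ ENNReal.ofReal (2 * ε + |V x - U x|) := by
        rw [mul_one]
        refine enorm_le_ofReal ?_
        rw [abs_of_nonneg (hU0 x)]
        linarith [neg_abs_le (V x - U x)]
    _ ≤ _ := by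
        rw [ENNReal.ofReal_add (by positivity) (abs_nonneg _)]
        gcongr
        rw [← Real.norm_eq_abs, ofReal_norm]
        exact hVU x

/-- A function approximated by test functions admits cutoffs along which its flux is small. -/
lemma exists_cutoff (hΩ : volume Ω ≠ ⊤) {U : Space N → ℝ} (hUm : Measurable U)
    (hU0 : ∀ x, 0 ≤ U x) {B : ℝ} (hUB : ∀ x, |U x| ≤ B) {h : Space N → ℝ≥0∞} (hh : Measurable h)
    (hhi : ∫⁻ x, h x ∂spaceMeasure Ω ≠ ⊤) {K : ℝ≥0}
    (happ : ∀ δ : ℝ≥0∞, 0 < δ → ∃ V : Space N → ℝ, IsTestFunction Ω V ∧ ∃ e : Space N → ℝ≥0∞,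
      Measurable e ∧ ∫⁻ x, e x ∂spaceMeasure Ω ≤ δ ∧ (∀ x, ‖V x - U x‖ₑ ≤ e x + δ) ∧
      (∀ x, ‖fderiv ℝ V x‖ₑ ≤ K * (h x + e x)))
    {ψ : Space N → ℝ} (hψ : IsTestFunction Ω ψ) (hψ0 : ∀ x, 0 ≤ ψ x) (hψ1 : ∀ x, ψ x ≤ 1)
    {δ : ℝ≥0∞} (hδ : 0 < δ) :
    ∃ ζ : Space N → ℝ, IsTestFunction Ω ζ ∧ (∀ x, ψ x ≤ ζ x) ∧ (∀ x, ζ x ≤ 1) ∧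
      ∫⁻ x, ‖U x‖ₑ * ‖fderiv ℝ ζ x‖ₑ ∂spaceMeasure Ω ≤ δ := by
  obtain ⟨M, hM0, hM⟩ := exists_bound_deriv_smoothTransition
  obtain ⟨D, hD⟩ := (hψ.hasCompactSupport.fderiv ℝ).exists_bound_of_continuous
    (hψ.contDiff.continuous_fderiv (by simp))
  set μ := spaceMeasure Ω with hμ
  have hμt : μ Set.univ ≠ ⊤ := by simpa [hμ, spaceMeasure] using hΩ
  have : IsFiniteMeasure μ := ⟨hμt.lt_top⟩
  let S : ℝ → Set (Space N) := fun ε => {x | ε / 2 ≤ U x ∧ U x ≤ 3 * ε}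
  have hSm : ∀ ε, MeasurableSet (S ε) := fun ε =>
    (measurableSet_le measurable_const hUm).inter (measurableSet_le hUm measurable_const)
  -- The level ε is chosen from U, h and ψ alone, before any approximation V. The sets S ε shrink
  -- away pointwise: a point with U = 0 is in none of them, and one with U > 0 leaves once 3ε < U.
  obtain ⟨ε, hε, hεδ⟩ : ∃ ε : ℝ, 0 < ε ∧
      ENNReal.ofReal (3 * M) * (K * ∫⁻ x in S ε, h x ∂μ)
        + ENNReal.ofReal D * (ENNReal.ofReal (2 * ε) * μ Set.univ) < δ := by
    have l1 : Tendsto (fun ε => ∫⁻ x in S ε, h x ∂μ) (𝓝[>] 0) (𝓝 0) := by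
      simp_rw [← lintegral_indicator (hSm _)]
      rw [← lintegral_zero (μ := μ)]
      refine tendsto_lintegral_filter_of_dominated_convergence h
        (Eventually.of_forall fun ε => hh.indicator (hSm ε))
        (Eventually.of_forall fun ε => ae_of_all _ fun x => Set.indicator_le_self _ _ _) hhi
        (ae_of_all _ fun x => ?_)
      refine tendsto_const_nhds.congr' ?_
      rcases (hU0 x).eq_or_lt with h0 | h0
      · filter_upwards [self_mem_nhdsWithin] with ε hε
        have hε : 0 < ε := hε
        refine (Set.indicator_of_notMem (fun hx => ?_) _).symm
        have := hx.1
        linarith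
      · filter_upwards [nhdsWithin_le_nhds (gt_mem_nhds (by positivity : 0 < U x / 3))] with ε hε
        refine (Set.indicator_of_notMem (fun hx => ?_) _).symm
        have := hx.2
        linarith
    have l2 : Tendsto (fun ε : ℝ => ENNReal.ofReal (2 * ε)) (𝓝[>] 0) (𝓝 0) := by
      have hc : Continuous fun ε : ℝ => ENNReal.ofReal (2 * ε) :=
        ENNReal.continuous_ofReal.comp (continuous_const.mul continuous_id)
      have := hc.tendsto 0
      simp only [mul_zero, ENNReal.ofReal_zero] at this
      exact this.mono_left nhdsWithin_le_nhds
    have l3 := (ENNReal.Tendsto.const_mul (ENNReal.Tendsto.const_mul l1 (a := K)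
      (Or.inr (by simp))) (a := ENNReal.ofReal (3 * M)) (Or.inr ENNReal.ofReal_ne_top)).add
      (ENNReal.Tendsto.const_mul (ENNReal.Tendsto.mul_const l2 (b := μ Set.univ)
      (Or.inr hμt)) (a := ENNReal.ofReal D) (Or.inr (by simp)))
    simp only [mul_zero, zero_mul, add_zero] at l3
    obtain ⟨ε, h1, h2⟩ := ((l3.eventually (gt_mem_nhds hδ)).and self_mem_nhdsWithin).exists
    exact ⟨ε, h2, h1⟩
  set d : ℕ → ℝ≥0∞ := fun n => ENNReal.ofReal (1 / ((n : ℝ) + 1)) with hd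
  have hd0 : ∀ n, 0 < d n := fun n => ENNReal.ofReal_pos.2 (by positivity)
  have hdl : Tendsto d atTop (𝓝 0) := by
    have := (ENNReal.continuous_ofReal.tendsto 0).comp
      (tendsto_one_div_add_atTop_nhds_zero_nat (𝕜 := ℝ))
    rw [ENNReal.ofReal_zero] at this
    exact this
  -- With ε fixed, V n approximates U ever better. The constant B M/ε may be huge, but it multiplies
  -- the integral of h over Z n and the error e n, both of which vanish in the limit.
  choose V hV e hem hei hVU hVd using fun n => happ (d n) (hd0 n)
  let Z : ℕ → Set (Space N) := fun n => {x | ENNReal.ofReal (ε / 4) ≤ e n x}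
  have hZm : ∀ n, MeasurableSet (Z n) := fun n => measurableSet_le measurable_const (hem n)
  have hε4 : ENNReal.ofReal (ε / 4) ≠ 0 := (ENNReal.ofReal_pos.2 (by positivity)).ne'
  have hZ0 : Tendsto (fun n => μ (Z n)) atTop (𝓝 0) := by
    have hb : ∀ n, μ (Z n) ≤ d n / ENNReal.ofReal (ε / 4) := fun n =>
      (meas_ge_le_lintegral_div (hem n).aemeasurable hε4 ENNReal.ofReal_ne_top).trans
        (ENNReal.div_le_div_right (hei n) _)
    refine tendsto_of_tendsto_of_tendsto_of_le_of_le tendsto_const_nhds ?_ (fun _ => zero_le) hb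
    have := ENNReal.Tendsto.div_const hdl (b := ENNReal.ofReal (ε / 4)) (Or.inr hε4)
    simpa using this
  have hhZ : Tendsto (fun n => ∫⁻ x in Z n, h x ∂μ) atTop (𝓝 0) :=
    tendsto_setLIntegral_zero hhi hZ0
  have hlim : Tendsto (fun n => ENNReal.ofReal (3 * M) * (K * ((∫⁻ x in S ε, h x ∂μ) + d n))
      + ENNReal.ofReal (B * (M / ε)) * (K * ((∫⁻ x in Z n, h x ∂μ) + d n))
      + ENNReal.ofReal D * (ENNReal.ofReal (2 * ε) * μ Set.univ + (d n + d n * μ Set.univ)))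
      atTop (𝓝 (ENNReal.ofReal (3 * M) * (K * ((∫⁻ x in S ε, h x ∂μ) + 0))
      + ENNReal.ofReal (B * (M / ε)) * (K * (0 + 0))
      + ENNReal.ofReal D * (ENNReal.ofReal (2 * ε) * μ Set.univ + (0 + 0 * μ Set.univ)))) := by
    refine Tendsto.add (Tendsto.add ?_ ?_) ?_
    · exact ENNReal.Tendsto.const_mul (ENNReal.Tendsto.const_mul
        (tendsto_const_nhds.add hdl) (Or.inr (by simp))) (Or.inr ENNReal.ofReal_ne_top)
    · exact ENNReal.Tendsto.const_mul (ENNReal.Tendsto.const_mul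
        (hhZ.add hdl) (Or.inr (by simp))) (Or.inr (by simp))
    · exact ENNReal.Tendsto.const_mul (tendsto_const_nhds.add
        (hdl.add (ENNReal.Tendsto.mul_const hdl (Or.inr hμt)))) (Or.inr (by simp))
  simp only [add_zero, mul_zero, zero_mul] at hlim
  obtain ⟨n, hn, hnε⟩ := ((hlim.eventually (gt_mem_nhds hεδ)).and
    ((ENNReal.tendsto_nhds_zero.1 hdl) _ (pos_iff_ne_zero.2 hε4))).exists
  have hT := (hV n).truncation ε
  have hTd : ∀ x, HasFDerivAt (truncation ε (V n)) (fderiv ℝ (truncation ε (V n)) x) x :=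
    fun x => (hT.contDiff.differentiable (by simp) x).hasFDerivAt
  have hψd : ∀ x, HasFDerivAt ψ (fderiv ℝ ψ x) x := fun x =>
    (hψ.contDiff.differentiable (by simp) x).hasFDerivAt
  -- With τ the truncation, the cutoff is τ + ψ(1 - τ) = 1 - (1 - τ)(1 - ψ). It lies between ψ and
  -- 1, and ∇ψ enters only with the factor 1 - τ.
  have hζd : ∀ x, HasFDerivAt
      (fun x => truncation ε (V n) x + ψ x * (1 - truncation ε (V n) x))
      ((1 - ψ x) • fderiv ℝ (truncation ε (V n)) x
        + (1 - truncation ε (V n) x) • fderiv ℝ ψ x) x := by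
    intro x
    convert! (hTd x).add ((hψd x).mul ((hTd x).const_sub 1)) using 1
    module
  have hpt : ∀ x, ‖U x‖ₑ * ‖fderiv ℝ
      (fun x => truncation ε (V n) x + ψ x * (1 - truncation ε (V n) x)) x‖ₑ
      ≤ (ENNReal.ofReal (3 * M) * (K * ((S ε).indicator h x + e n x))
        + ENNReal.ofReal (B * (M / ε)) * (K * ((Z n).indicator h x + e n x)))
        + ENNReal.ofReal D * (ENNReal.ofReal (2 * ε) + (e n x + d n)) := by
    intro x
    rw [(hζd x).fderiv]
    have b1 : ‖(1 - ψ x) • fderiv ℝ (truncation ε (V n)) x‖ₑ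
        ≤ ‖fderiv ℝ (truncation ε (V n)) x‖ₑ := by
      have hs : ‖(1 - ψ x) • fderiv ℝ (truncation ε (V n)) x‖ₑ
        = ‖1 - ψ x‖ₑ * ‖fderiv ℝ (truncation ε (V n)) x‖ₑ := enorm_smul _ _
      rw [hs]
      refine mul_le_of_le_one_left' ?_
      rw [← ENNReal.ofReal_one]
      refine enorm_le_ofReal ?_
      rw [abs_le]
      constructor <;> linarith [hψ0 x, hψ1 x]
    have b2 : ‖(1 - truncation ε (V n) x) • fderiv ℝ ψ x‖ₑ
        ≤ ‖1 - truncation ε (V n) x‖ₑ * ENNReal.ofReal D := by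
      have hs : ‖(1 - truncation ε (V n) x) • fderiv ℝ ψ x‖ₑ
        = ‖1 - truncation ε (V n) x‖ₑ * ‖fderiv ℝ ψ x‖ₑ := enorm_smul _ _
      rw [hs]
      gcongr
      rw [← ofReal_norm]
      exact ENNReal.ofReal_le_ofReal (hD x)
    have b3 := (hV n).enorm_mul_fderiv_truncation_le hM hε hUB hnε (hVU n) x
    have b4 := enorm_mul_one_sub_truncation_le hε hU0 (hVU n) x
    have b5 : ∀ A : Set (Space N), A.indicator (1 : Space N → ℝ≥0∞) x * (K * (h x + e n x))
        ≤ K * (A.indicator h x + e n x) := by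
      intro A
      by_cases hx : x ∈ A
      · simp [hx]
      · simp [hx]
    calc ‖U x‖ₑ * ‖(1 - ψ x) • fderiv ℝ (truncation ε (V n)) x
          + (1 - truncation ε (V n) x) • fderiv ℝ ψ x‖ₑ
        ≤ ‖U x‖ₑ * (‖fderiv ℝ (truncation ε (V n)) x‖ₑ
          + ‖1 - truncation ε (V n) x‖ₑ * ENNReal.ofReal D) := by
          refine mul_le_mul_right (α := ℝ≥0∞) ?_ _
          exact (enorm_clm_add_le _ _).trans (add_le_add b1 b2)
      _ = ‖U x‖ₑ * ‖fderiv ℝ (truncation ε (V n)) x‖ₑ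
          + ENNReal.ofReal D * (‖U x‖ₑ * ‖1 - truncation ε (V n) x‖ₑ) := by ring
      _ ≤ _ := by
        refine add_le_add (b3.trans ?_) (mul_le_mul_right (α := ℝ≥0∞) b4 _)
        refine (mul_le_mul_right (α := ℝ≥0∞) (hVd n x) _).trans ?_
        rw [add_mul, mul_assoc, mul_assoc]
        exact add_le_add (mul_le_mul_right (α := ℝ≥0∞) (b5 _) _)
          (mul_le_mul_right (α := ℝ≥0∞) (b5 _) _)
  refine ⟨fun x => truncation ε (V n) x + ψ x * (1 - truncation ε (V n) x), ?_, ?_, ?_, ?_⟩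
  · have hsub : tsupport (fun x => truncation ε (V n) x + ψ x * (1 - truncation ε (V n) x))
        ⊆ tsupport (truncation ε (V n)) ∪ tsupport ψ := by
      refine closure_minimal (fun x hx => ?_) ((isClosed_tsupport _).union (isClosed_tsupport _))
      by_contra hcon
      rw [Set.mem_union, not_or] at hcon
      refine hx ?_
      simp [image_eq_zero_of_notMem_tsupport hcon.1, image_eq_zero_of_notMem_tsupport hcon.2]
    exact ⟨hT.contDiff.add (hψ.contDiff.mul (contDiff_const.sub hT.contDiff)),
      (hT.hasCompactSupport.isCompact.union hψ.hasCompactSupport.isCompact).of_isClosed_subset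
        (isClosed_tsupport _) hsub,
      hsub.trans (Set.union_subset hT.tsupport_subset hψ.tsupport_subset)⟩
  · intro x
    nlinarith [truncation_nonneg ε (V n) x, hψ1 x]
  · intro x
    nlinarith [truncation_le_one ε (V n) x, hψ1 x]
  · refine (lintegral_mono hpt).trans (le_trans ?_ hn.le)
    have hSi := hh.indicator (hSm ε)
    have hZi := hh.indicator (hZm n)
    have hen := hem n
    rw [lintegral_add_left (by fun_prop), lintegral_add_left (by fun_prop),
      lintegral_const_mul _ (by fun_prop), lintegral_const_mul _ (by fun_prop),
      lintegral_const_mul _ (by fun_prop), lintegral_const_mul _ (by fun_prop),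
      lintegral_const_mul _ (by fun_prop), lintegral_add_left (by fun_prop),
      lintegral_add_left (by fun_prop), lintegral_add_left (by fun_prop),
      lintegral_add_left (by fun_prop), lintegral_const, lintegral_const,
      lintegral_indicator (hSm ε), lintegral_indicator (hZm n)]
    gcongr
    all_goals exact hei n

end Cutoff

/-! ### The renormalized equation at positive mollification scale -/

section MollifiedEquation

variable {N : ℕ} {Ω : Set (Space N)} {m : Space N → ℝ} {ε C : ℝ}

lemma IsMollifier.integrable (hm : IsMollifier m ε C) : Integrable m :=
  hm.contDiff.continuous.integrable_of_hasCompactSupport hm.hasCompactSupport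

lemma IsMollifier.lintegral_enorm (hm : IsMollifier m ε C) : ∫⁻ h, ‖m h‖ₑ = 1 := by
  have h1 : ∀ h, ‖m h‖ₑ = ENNReal.ofReal (m h) := fun h => by
    rw [← ofReal_norm, Real.norm_of_nonneg (hm.nonneg h)]
  simp_rw [h1]
  rw [← ofReal_integral_eq_lintegral_ofReal hm.integrable (ae_of_all _ hm.nonneg),
    hm.integral_eq_one, ENNReal.ofReal_one]

lemma IsMollifier.eq_zero (hm : IsMollifier m ε C) {h : Space N} (hh : ε < ‖h‖) : m h = 0 := by
  refine image_eq_zero_of_notMem_tsupport fun h' => ?_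
  have := hm.tsupport_subset h'
  rw [mem_closedBall_zero_iff] at this
  linarith

lemma IsMollifier.mollify_sub_eq (hm : IsMollifier m ε C) {a : Space N → ℝ} (ha : Integrable a)
    (x : Space N) : mollify m a x - a x = ∫ h, m h * (a (x - h) - a x) := by
  have hb : ∃ B, ∀ h, ‖m h‖ ≤ B :=
    hm.hasCompactSupport.exists_bound_of_continuous hm.contDiff.continuous
  obtain ⟨B, hB⟩ := hb
  have i1 : Integrable fun h => m h * a (x - h) :=
    (ha.comp_sub_left x).bdd_mul hm.contDiff.continuous.aestronglyMeasurable (ae_of_all _ hB)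
  have i2 : Integrable fun h => m h * a x := hm.integrable.mul_const _
  simp_rw [mul_sub]
  rw [integral_sub i1 i2, integral_mul_const, hm.integral_eq_one, one_mul]
  congr 1
  unfold mollify
  rw [← integral_sub_left_eq_self (fun y => a y * m (x - y)) volume x]
  simp [mul_comm]

/-- The mollification averages shifts of size at most ε against a kernel of mass one, so its L¹
error is at most the L¹ modulus of continuity of a at scale ε. -/
lemma IsMollifier.lintegral_mollify_sub_le (hm : IsMollifier m ε C) {a : Space N → ℝ}
    (ha : Integrable a) (ham : Measurable a) {δ : ℝ≥0∞}
    (hδ : ∀ h : Space N, ‖h‖ ≤ ε → ∫⁻ x, ‖a (x - h) - a x‖ₑ ≤ δ) :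
    ∫⁻ x, ‖mollify m a x - a x‖ₑ ≤ δ := by
  have hmm : Measurable m := hm.contDiff.continuous.measurable
  calc ∫⁻ x, ‖mollify m a x - a x‖ₑ
      ≤ ∫⁻ x, ∫⁻ h, ‖m h‖ₑ * ‖a (x - h) - a x‖ₑ := by
        refine lintegral_mono fun x => ?_
        rw [hm.mollify_sub_eq ha]
        refine (enorm_integral_le_lintegral_enorm _).trans (lintegral_mono fun h => ?_)
        rw [enorm_mul]
    _ = ∫⁻ h, ∫⁻ x, ‖m h‖ₑ * ‖a (x - h) - a x‖ₑ :=
        lintegral_lintegral_swap (Measurable.aemeasurable (by fun_prop))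
    _ ≤ ∫⁻ h, ‖m h‖ₑ * δ := by
        refine lintegral_mono fun h => ?_
        rw [lintegral_const_mul' _ _ enorm_ne_top]
        by_cases hh : ε < ‖h‖
        · simp [hm.eq_zero hh]
        · gcongr
          exact hδ h (not_lt.1 hh)
    _ = δ := by rw [lintegral_mul_const _ hmm.enorm, hm.lintegral_enorm, one_mul]

lemma IsMollifier.stronglyMeasurable_mollify_prod (hm : IsMollifier m ε C)
    {ρ : ℝ → Space N → ℝ} (hρ : Measurable (Function.uncurry ρ)) :
    StronglyMeasurable fun z : ℝ × Space N => mollify m (ρ z.1) z.2 := by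
  refine StronglyMeasurable.integral_prod_right (f := fun (z : ℝ × Space N) y =>
    ρ z.1 y * m (z.2 - y)) (Measurable.stronglyMeasurable ?_)
  have hmm : Measurable m := hm.contDiff.continuous.measurable
  have h1 : Measurable fun z : (ℝ × Space N) × Space N => ρ z.1.1 z.2 :=
    hρ.comp ((measurable_fst.comp measurable_fst).prodMk measurable_snd)
  exact h1.mul (by fun_prop)

lemma IsMollifier.stronglyMeasurable_flux_prod (hm : IsMollifier m ε C)
    {ρ : ℝ → Space N → ℝ} (hρ : Measurable (Function.uncurry ρ))
    {u : ℝ → Space N → Space N} (hu : Measurable (Function.uncurry u)) :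
    StronglyMeasurable fun z : ℝ × Space N => mollifyFlux m (ρ z.1) (u z.1) z.2 := by
  refine StronglyMeasurable.integral_prod_right (f := fun (z : ℝ × Space N) y =>
    ρ z.1 y * fderiv ℝ m (z.2 - y) (u z.1 y)) (Measurable.stronglyMeasurable ?_)
  have h1 : Measurable fun z : (ℝ × Space N) × Space N => ρ z.1.1 z.2 :=
    hρ.comp ((measurable_fst.comp measurable_fst).prodMk measurable_snd)
  have h2 : Measurable fun z : (ℝ × Space N) × Space N => u z.1.1 z.2 :=
    hu.comp ((measurable_fst.comp measurable_fst).prodMk measurable_snd)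
  exact h1.mul (hm.continuous_fderiv_apply.measurable.comp
    (((measurable_snd.comp measurable_fst).sub measurable_snd).prodMk h2))

/-- Measurable space-time data for the transport equation, extended by zero outside `Ω`. -/
structure TransportData (T : ℝ) (Ω : Set (Space N)) (u : ℝ → Space N → Space N)
    (ρ : ℝ → Space N → ℝ) (g : ℝ → ℝ) (R : ℝ) : Prop where
  measurable_u : Measurable (Function.uncurry u)
  measurable_ρ : Measurable (Function.uncurry ρ)
  u_eq_zero : ∀ t, ∀ x ∉ Ω, u t x = 0
  integrable_g : Integrable g (timeMeasure T)
  norm_u_le : ∀ t x, ‖u t x‖ ≤ g t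
  integrable_u : ∀ t, Integrable (u t)
  integrable_ρ : ∀ t, Integrable (ρ t)
  integral_ρ_le : ∀ t, ∫ x, ‖ρ t x‖ ≤ R
  divFree : ∀ᵐ t ∂timeMeasure T, IsWeaklyDivFree Ω (u t)
  weak_eq : ∀ θ : ℝ → ℝ, ContDiff ℝ ∞ θ → HasCompactSupport θ → tsupport θ ⊆ Set.Iio T →
    ∀ χ : Space N → ℝ, IsTestFunction Ω χ →
      ∫ t in Set.Ioo 0 T, deriv θ t * ∫ x, ρ t x * χ x
        = ∫ t in Set.Ioo 0 T, θ t * ∫ x, ρ t x * fderiv ℝ χ x (u t x)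

namespace TransportData

variable {T : ℝ} {u : ℝ → Space N → Space N} {ρ : ℝ → Space N → ℝ} {g : ℝ → ℝ} {R : ℝ}

lemma measurable_u_slice (hd : TransportData T Ω u ρ g R) (t : ℝ) : Measurable (u t) :=
  hd.measurable_u.comp measurable_prodMk_left

lemma measurable_ρ_slice (hd : TransportData T Ω u ρ g R) (t : ℝ) : Measurable (ρ t) :=
  hd.measurable_ρ.comp measurable_prodMk_left

lemma g_nonneg (hd : TransportData T Ω u ρ g R) (t : ℝ) : 0 ≤ g t :=
  (norm_nonneg _).trans (hd.norm_u_le t 0)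

lemma norm_flux_le (hd : TransportData T Ω u ρ g R) {M : ℝ} (hM : ∀ h, ‖fderiv ℝ m h‖ ≤ M)
    (t : ℝ) (x : Space N) : ‖mollifyFlux m (ρ t) (u t) x‖ ≤ M * g t * R :=
  (norm_mollifyFlux_le (hd.integrable_ρ t) (hd.norm_u_le t) hM x).trans
    (mul_le_mul_of_nonneg_left (hd.integral_ρ_le t)
      (mul_nonneg ((norm_nonneg _).trans (hM 0)) (hd.g_nonneg t)))

/-- For fixed x, y ↦ m (x - y) is admissible in the weak equation. It shows that t ↦ `mollify m (ρ
t) x` has the mollified flux as weak derivative and zero initial value: the minus sign from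
differentiating m (x - y) in y matches that in the weak derivative. The flux is integrable in time
because g is. -/
lemma integral_saturation_mollify_eq (hd : TransportData T Ω u ρ g R) (hT : 0 < T)
    (hm : IsMollifier m ε C) {x : Space N} (hx : Metric.closedBall x ε ⊆ Ω) :
    ∫ t in Set.Ioo 0 T, saturation (mollify m (ρ t) x)
      = ∫ t in Set.Ioo 0 T, (T - t) *
        (deriv saturation (mollify m (ρ t) x) * mollifyFlux m (ρ t) (u t) x) := by
  obtain ⟨M, hM0, hM⟩ := hm.exists_norm_fderiv_le
  obtain ⟨B, hB⟩ := hm.hasCompactSupport.exists_bound_of_continuous hm.contDiff.continuous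
  have hmeas : Measurable fun t : ℝ => (t, x) := measurable_prodMk_right
  refine integral_comp_eq_of_weak_deriv hT ?_ ?_ ?_ lipschitzWith_saturation
    differentiable_saturation saturation_zero
  · refine Integrable.mono' (integrable_const (B * R))
      ((hm.stronglyMeasurable_mollify_prod hd.measurable_ρ).comp_measurable
        hmeas).aestronglyMeasurable (ae_of_all _ fun t => ?_)
    refine le_trans ?_ (mul_le_mul_of_nonneg_left (hd.integral_ρ_le t)
      ((norm_nonneg _).trans (hB 0)))
    rw [← integral_const_mul]
    refine norm_integral_le_of_norm_le ((hd.integrable_ρ t).norm.const_mul _)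
      (ae_of_all _ fun y => ?_)
    rw [norm_mul, mul_comm]
    exact mul_le_mul_of_nonneg_right (hB _) (norm_nonneg _)
  · refine Integrable.mono' ((hd.integrable_g.const_mul M).mul_const R)
      ((hm.stronglyMeasurable_flux_prod hd.measurable_ρ hd.measurable_u).comp_measurable
        hmeas).aestronglyMeasurable (ae_of_all _ fun t => hd.norm_flux_le hM t x)
  · intro θ hθ hθc hθT
    have := hd.weak_eq θ hθ hθc hθT _ (hm.isTestFunction_translate hx)
    simp_rw [(hm.hasFDerivAt_translate x _).fderiv] at this
    unfold mollify mollifyFlux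
    rw [this, ← integral_neg]
    refine integral_congr_ae (ae_of_all _ fun t => ?_)
    simp only [neg_apply, mul_neg, integral_neg]

/-- The mollified renormalized estimate. -/
lemma lintegral_saturation_mollify_le (hd : TransportData T Ω u ρ g R) (hT : 0 < T)
    (hm : IsMollifier m ε C) {ψ : Space N → ℝ} (hψ : IsTestFunction Ω ψ) (hψ0 : ∀ x, 0 ≤ ψ x)
    (hψ1 : ∀ x, ψ x ≤ 1) (hψε : ∀ x ∈ tsupport ψ, Metric.closedBall x ε ⊆ Ω) :
    ∫⁻ t, (∫⁻ x, ENNReal.ofReal (ψ x * saturation (mollify m (ρ t) x))) ∂timeMeasure T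
      ≤ ENNReal.ofReal T * ∫⁻ t, (incrementPairing (fun h => ‖fderiv ℝ m h‖ₑ) (ρ t) (u t)
        + ∫⁻ x, ‖u t x‖ₑ * ‖fderiv ℝ ψ x‖ₑ) ∂timeMeasure T := by
  obtain ⟨M, hM0, hM⟩ := hm.exists_norm_fderiv_le
  have hψi : Integrable ψ :=
    hψ.contDiff.continuous.integrable_of_hasCompactSupport hψ.hasCompactSupport
  have hA := hm.stronglyMeasurable_mollify_prod hd.measurable_ρ
  have hF := hm.stronglyMeasurable_flux_prod hd.measurable_ρ hd.measurable_u
  have hψm : StronglyMeasurable fun z : ℝ × Space N => ψ z.2 :=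
    (hψ.contDiff.continuous.comp continuous_snd).stronglyMeasurable
  have hsA : StronglyMeasurable fun z : ℝ × Space N => saturation (mollify m (ρ z.1) z.2) :=
    contDiff_saturation.continuous.comp_stronglyMeasurable hA
  have hdA : StronglyMeasurable fun z : ℝ × Space N =>
      deriv saturation (mollify m (ρ z.1) z.2) :=
    (contDiff_saturation.continuous_deriv (by simp)).comp_stronglyMeasurable hA
  have hψt : Integrable (fun z : ℝ × Space N => ψ z.2) ((timeMeasure T).prod volume) := by
    simpa using (integrable_const (1 : ℝ)).mul_prod (μ := timeMeasure T) hψi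
  have hψg : Integrable (fun z : ℝ × Space N => (M * g z.1 * R) * ψ z.2)
      ((timeMeasure T).prod volume) :=
    ((hd.integrable_g.const_mul M).mul_const R).mul_prod hψi
  have i1 : Integrable (fun z : ℝ × Space N => ψ z.2 * saturation (mollify m (ρ z.1) z.2))
      ((timeMeasure T).prod volume) := by
    refine hψt.mul_bdd (c := 1) hsA.aestronglyMeasurable (ae_of_all _ fun z => ?_)
    rw [Real.norm_of_nonneg (saturation_nonneg _)]
    exact saturation_le_one _
  have i2 : Integrable (fun z : ℝ × Space N => (T - z.1) * (ψ z.2 *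
      (deriv saturation (mollify m (ρ z.1) z.2) * mollifyFlux m (ρ z.1) (u z.1) z.2)))
      ((timeMeasure T).prod volume) := by
    refine Integrable.mono' (hψg.const_mul T) ((measurable_const.sub
      measurable_fst).aestronglyMeasurable.mul
      (hψm.mul (hdA.mul hF)).aestronglyMeasurable) ?_
    have hmem : ∀ᵐ z ∂(timeMeasure T).prod (volume : Measure (Space N)), z.1 ∈ Set.Ioo 0 T :=
      Measure.quasiMeasurePreserving_fst.ae (ae_restrict_mem measurableSet_Ioo)
    filter_upwards [hmem] with z hz
    rw [norm_mul, norm_mul, norm_mul, Real.norm_of_nonneg (hψ0 _),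
      Real.norm_of_nonneg (by linarith [hz.2] : 0 ≤ T - z.1)]
    have h1 : ‖deriv saturation (mollify m (ρ z.1) z.2)‖ * ‖mollifyFlux m (ρ z.1) (u z.1) z.2‖
        ≤ M * g z.1 * R := by
      refine le_trans ?_ (hd.norm_flux_le hM z.1 z.2)
      exact mul_le_of_le_one_left (norm_nonneg _) (abs_deriv_saturation_le _)
    calc (T - z.1) * (ψ z.2 * _) ≤ T * (ψ z.2 * (M * g z.1 * R)) :=
          mul_le_mul (by linarith [hz.1]) (mul_le_mul_of_nonneg_left h1 (hψ0 _))
            (mul_nonneg (hψ0 _) (by positivity)) hT.le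
      _ = _ := by ring
  have e1 : ∫⁻ t, (∫⁻ x, ENNReal.ofReal (ψ x * saturation (mollify m (ρ t) x))) ∂timeMeasure T
      = ENNReal.ofReal (∫ z, ψ z.2 * saturation (mollify m (ρ z.1) z.2)
        ∂(timeMeasure T).prod volume) := by
    rw [ofReal_integral_eq_lintegral_ofReal i1
      (ae_of_all _ fun z => mul_nonneg (hψ0 _) (saturation_nonneg _)),
      lintegral_prod _ i1.aestronglyMeasurable.aemeasurable.ennreal_ofReal]
  have e2 : ∫ z, ψ z.2 * saturation (mollify m (ρ z.1) z.2) ∂(timeMeasure T).prod volume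
      = ∫ t, (T - t) * (∫ x, ψ x * (deriv saturation (mollify m (ρ t) x)
        * mollifyFlux m (ρ t) (u t) x)) ∂timeMeasure T := by
    rw [integral_prod_symm _ i1]
    calc ∫ x, ∫ t, ψ x * saturation (mollify m (ρ t) x) ∂timeMeasure T
        = ∫ x, ∫ t, (T - t) * (ψ x * (deriv saturation (mollify m (ρ t) x)
            * mollifyFlux m (ρ t) (u t) x)) ∂timeMeasure T := by
          refine integral_congr_ae (ae_of_all _ fun x => ?_)
          beta_reduce
          -- The identity in time holds where the ε-ball around x lies in Ω; off the support of ψ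
          -- both sides are zero.
          by_cases hx : x ∈ tsupport ψ
          · rw [integral_const_mul, hd.integral_saturation_mollify_eq hT hm (hψε x hx),
              ← integral_const_mul]
            refine integral_congr_ae (ae_of_all _ fun t => ?_)
            ring
          · simp [image_eq_zero_of_notMem_tsupport hx]
      _ = _ := by
          rw [← integral_prod_symm _ i2, integral_prod _ i2]
          refine integral_congr_ae (ae_of_all _ fun t => ?_)
          exact integral_const_mul (T - t) fun x => ψ x * (deriv saturation (mollify m (ρ t) x)
            * mollifyFlux m (ρ t) (u t) x)
  rw [e1, e2]
  refine (ENNReal.ofReal_le_ofReal (le_abs_self _)).trans ?_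
  rw [← Real.norm_eq_abs, ofReal_norm]
  refine (enorm_integral_le_lintegral_enorm _).trans ?_
  rw [← lintegral_const_mul' _ _ ENNReal.ofReal_ne_top]
  refine lintegral_mono_ae ?_
  filter_upwards [hd.divFree, ae_restrict_mem measurableSet_Ioo] with t ht htT
  rw [enorm_mul]
  refine mul_le_mul' (enorm_le_ofReal ?_) ?_
  · rw [abs_le]
    constructor <;> linarith [htT.1, htT.2]
  · exact hm.enorm_integral_renormalized_flux_le (hd.integrable_ρ t) (hd.measurable_ρ_slice t)
      (hd.measurable_u_slice t) (hd.norm_u_le t) (hd.u_eq_zero t) (hd.integrable_u t) ht hψ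
      (fun x => abs_le.2 ⟨by linarith [hψ0 x], hψ1 x⟩) hψε

end TransportData

end MollifiedEquation

/-! ### Passage to the limit and conclusion from small-flux cutoffs -/

namespace TransportData

variable {N : ℕ} {Ω : Set (Space N)} {T : ℝ} {u : ℝ → Space N → Space N} {ρ : ℝ → Space N → ℝ}
  {g : ℝ → ℝ} {R : ℝ} {p q : ℝ≥0∞}

lemma measurable_incrementPairing (hd : TransportData T Ω u ρ g R) {k : Space N → ℝ≥0∞}
    (hk : Measurable k) : Measurable fun t => incrementPairing k (ρ t) (u t) := by
  have hρ := hd.measurable_ρ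
  have hu := hd.measurable_u
  have h1 : Measurable fun z : (ℝ × Space N) × Space N =>
      ‖ρ z.1.1 (z.2 - z.1.2) - ρ z.1.1 z.2‖ₑ * ‖u z.1.1 (z.2 - z.1.2) - u z.1.1 z.2‖ₑ := by
    have f1 : Measurable fun z : (ℝ × Space N) × Space N => (z.1.1, z.2 - z.1.2) := by fun_prop
    have f2 : Measurable fun z : (ℝ × Space N) × Space N => (z.1.1, z.2) := by fun_prop
    exact ((hρ.comp f1).sub (hρ.comp f2)).enorm.mul ((hu.comp f1).sub (hu.comp f2)).enorm
  have h2 : Measurable fun z : ℝ × Space N => k z.2 *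
      ∫⁻ x, ‖ρ z.1 (x - z.2) - ρ z.1 x‖ₑ * ‖u z.1 (x - z.2) - u z.1 x‖ₑ :=
    (hk.comp measurable_snd).mul h1.lintegral_prod_right'
  exact h2.lintegral_prod_right'

lemma lintegral_ρ_le (hd : TransportData T Ω u ρ g R) (t : ℝ) :
    ∫⁻ x, ‖ρ t x‖ₑ ≤ ENNReal.ofReal R := by
  have := ENNReal.ofReal_le_ofReal (hd.integral_ρ_le t)
  rw [ofReal_integral_eq_lintegral_ofReal (hd.integrable_ρ t).norm
    (ae_of_all _ fun _ => norm_nonneg _)] at this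
  simpa only [ofReal_norm] using this

/-- The renormalized estimate: the saturation of the solution is controlled by the flux through the
level sets of a cutoff. -/
lemma lintegral_saturation_le [p.HolderConjugate q] (hd : TransportData T Ω u ρ g R) (hT : 0 < T)
    (hΩ : IsOpen Ω) {G : ℝ → Fin N → Space N → Space N}
    (hG : ∀ᵐ t ∂timeMeasure T, MemSobolevZero Ω q (u t) (G t))
    (hGi : ∫⁻ t, sobolevNorm Ω q (u t) (G t) ∂timeMeasure T ≠ ⊤) {Cρ : ℝ≥0}
    (hρp : ∀ t, eLpNorm (ρ t) p volume ≤ Cρ)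
    {ψ : Space N → ℝ} (hψ : IsTestFunction Ω ψ) (hψ0 : ∀ x, 0 ≤ ψ x) (hψ1 : ∀ x, ψ x ≤ 1) :
    ∫⁻ t, (∫⁻ x, ENNReal.ofReal (ψ x * saturation (ρ t x))) ∂timeMeasure T
      ≤ ENNReal.ofReal T * ∫⁻ t, (∫⁻ x, ‖u t x‖ₑ * ‖fderiv ℝ ψ x‖ₑ) ∂timeMeasure T := by
  obtain ⟨ε₀, hε₀, hε₀Ω⟩ := hψ.hasCompactSupport.isCompact.exists_cthickening_subset_open hΩ
    hψ.tsupport_subset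
  set ε : ℕ → ℝ := fun n => ε₀ * (1 / ((n : ℝ) + 1)) with hε
  have hεpos : ∀ n, 0 < ε n := fun n => by positivity
  have hεle : ∀ n, ε n ≤ ε₀ := fun n => by
    refine mul_le_of_le_one_right hε₀.le ?_
    rw [div_le_one (by positivity)]
    linarith [(Nat.cast_nonneg n : (0 : ℝ) ≤ n)]
  have hεlim : Tendsto ε atTop (𝓝 0) := by
    simpa only [mul_zero] using
      (tendsto_one_div_add_atTop_nhds_zero_nat (𝕜 := ℝ)).const_mul ε₀
  obtain ⟨C, hC⟩ := exists_isMollifier N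
  choose m hm using fun n => hC (ε n) (hεpos n)
  have hball : ∀ n, ∀ x ∈ tsupport ψ, Metric.closedBall x (ε n) ⊆ Ω := fun n x hx =>
    ((Metric.closedBall_subset_closedBall (hεle n)).trans
      (Metric.closedBall_subset_cthickening hx ε₀)).trans hε₀Ω
  have hkm : ∀ n, Measurable fun h => ‖fderiv ℝ (m n) h‖ₑ :=
    fun n => (hm n).continuous_fderiv.enorm.measurable
  have hρt : ∀ t, eLpNorm (ρ t) p volume ≠ ⊤ := fun t =>
    ((hρp t).trans_lt ENNReal.coe_lt_top).ne
  -- the commutator vanishes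
  have l1 : Tendsto (fun n => ∫⁻ t, incrementPairing (fun h => ‖fderiv ℝ (m n) h‖ₑ) (ρ t) (u t)
      ∂timeMeasure T) atTop (𝓝 (∫⁻ _, 0 ∂timeMeasure T)) := by
    -- The majorant contains only the scale-invariant constant C, the uniform L^p bound of ρ and the
    -- Sobolev norm of u(t), which is integrable in time.
    refine tendsto_lintegral_of_dominated_convergence
      (fun t => ENNReal.ofReal C * (2 * Cρ * sobolevNorm Ω q (u t) (G t)))
      (fun n => hd.measurable_incrementPairing (hkm n)) (fun n => ?_) ?_ ?_
    · filter_upwards [hG] with t ht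
      refine (ht.incrementPairing_le (hd.measurable_u_slice t) (hd.u_eq_zero t) (hkm n)
        (hm n).lintegral_enorm_fderiv_lt_top.ne ENNReal.ofReal_ne_top
        (hm n).lintegral_enorm_mul_fderiv_le (hd.measurable_ρ_slice t) (hρt t)).trans ?_
      gcongr
      exact hρp t
    · simp_rw [← mul_assoc]
      rw [lintegral_const_mul' _ _ (by finiteness)]
      finiteness
    · filter_upwards [hG] with t ht
      exact ht.tendsto_incrementPairing (hd.measurable_u_slice t) (hd.u_eq_zero t) hεlim hm
        (hd.measurable_ρ_slice t) (hρt t) (hd.integrable_ρ t)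
  -- the mollifications converge
  have l2 : Tendsto (fun n => ∫⁻ t, (∫⁻ x, ‖mollify (m n) (ρ t) x - ρ t x‖ₑ) ∂timeMeasure T)
      atTop (𝓝 (∫⁻ _, 0 ∂timeMeasure T)) := by
    refine tendsto_lintegral_of_dominated_convergence (fun _ => 2 * ENNReal.ofReal R)
      (fun n => ?_) (fun n => ae_of_all _ fun t => ?_) ?_ (ae_of_all _ fun t => ?_)
    · exact (((hm n).stronglyMeasurable_mollify_prod hd.measurable_ρ).measurable.sub
        hd.measurable_ρ).enorm.lintegral_prod_right'
    · refine (hm n).lintegral_mollify_sub_le (hd.integrable_ρ t) (hd.measurable_ρ_slice t)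
        fun h _ => ?_
      refine (lintegral_translate_sub_le (hd.integrable_ρ t).aestronglyMeasurable h).trans ?_
      exact mul_le_mul_right (hd.lintegral_ρ_le t) 2
    · rw [lintegral_const]
      finiteness
    · rw [ENNReal.tendsto_nhds_zero]
      intro δ hδ
      obtain ⟨r, hr, hr'⟩ := Metric.eventually_nhds_iff.1 ((ENNReal.tendsto_nhds_zero.1
        (tendsto_lintegral_translate_sub (hd.integrable_ρ t))) δ hδ)
      filter_upwards [hεlim.eventually (gt_mem_nhds hr)] with n hn
      refine (hm n).lintegral_mollify_sub_le (hd.integrable_ρ t) (hd.measurable_ρ_slice t)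
        fun h hh => hr' ?_
      rw [dist_zero_right]
      linarith
  rw [lintegral_zero] at l1 l2
  set Fl := ∫⁻ t, (∫⁻ x, ‖u t x‖ₑ * ‖fderiv ℝ ψ x‖ₑ) ∂timeMeasure T
  have hbound : ∀ n, ∫⁻ t, (∫⁻ x, ENNReal.ofReal (ψ x * saturation (ρ t x))) ∂timeMeasure T
      ≤ ENNReal.ofReal T * ((∫⁻ t, incrementPairing (fun h => ‖fderiv ℝ (m n) h‖ₑ) (ρ t) (u t)
          ∂timeMeasure T) + Fl)
        + ∫⁻ t, (∫⁻ x, ‖mollify (m n) (ρ t) x - ρ t x‖ₑ) ∂timeMeasure T := by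
    intro n
    have hA := (hm n).stronglyMeasurable_mollify_prod hd.measurable_ρ
    have hs : Measurable fun z : ℝ × Space N =>
        ENNReal.ofReal (ψ z.2 * saturation (mollify (m n) (ρ z.1) z.2)) :=
      (((hψ.contDiff.continuous.measurable.comp measurable_snd).mul
        (contDiff_saturation.continuous.measurable.comp hA.measurable))).ennreal_ofReal
    calc ∫⁻ t, (∫⁻ x, ENNReal.ofReal (ψ x * saturation (ρ t x))) ∂timeMeasure T
        ≤ ∫⁻ t, ((∫⁻ x, ENNReal.ofReal (ψ x * saturation (mollify (m n) (ρ t) x)))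
          + ∫⁻ x, ‖mollify (m n) (ρ t) x - ρ t x‖ₑ) ∂timeMeasure T := by
          refine lintegral_mono fun t => ?_
          have hst : Measurable fun x =>
              ENNReal.ofReal (ψ x * saturation (mollify (m n) (ρ t) x)) :=
            hs.comp measurable_prodMk_left
          rw [← lintegral_add_left hst]
          refine lintegral_mono fun x => ?_
          rw [← ofReal_norm, ← ENNReal.ofReal_add (mul_nonneg (hψ0 _) (saturation_nonneg _))
            (norm_nonneg _)]
          refine ENNReal.ofReal_le_ofReal ?_
          have h1 := lipschitzWith_saturation.dist_le_mul (mollify (m n) (ρ t) x) (ρ t x)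
          rw [NNReal.coe_one, one_mul, Real.dist_eq, dist_eq_norm, abs_le] at h1
          have h2 : saturation (ρ t x) - saturation (mollify (m n) (ρ t) x)
              ≤ ‖mollify (m n) (ρ t) x - ρ t x‖ := by linarith [h1.1]
          nlinarith [hψ0 x, hψ1 x, norm_nonneg (mollify (m n) (ρ t) x - ρ t x)]
      _ = (∫⁻ t, (∫⁻ x, ENNReal.ofReal (ψ x * saturation (mollify (m n) (ρ t) x)))
            ∂timeMeasure T)
          + ∫⁻ t, (∫⁻ x, ‖mollify (m n) (ρ t) x - ρ t x‖ₑ) ∂timeMeasure T :=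
          lintegral_add_left hs.lintegral_prod_right' _
      _ ≤ _ := by
          gcongr
          refine (hd.lintegral_saturation_mollify_le hT (hm n) hψ hψ0 hψ1 (hball n)).trans ?_
          rw [lintegral_add_left (hd.measurable_incrementPairing (hkm n))]
  have hlim := (ENNReal.Tendsto.const_mul (l1.add_const Fl) (a := ENNReal.ofReal T)
    (Or.inr ENNReal.ofReal_ne_top)).add l2
  simpa using ge_of_tendsto' hlim hbound

/-- A renormalized solution with vanishing initial value vanishes as soon as cutoffs with small flux
exist. -/
lemma ae_eq_zero_of_cutoff (hd : TransportData T Ω u ρ g R) (hΩ : IsOpen Ω)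
    (hest : ∀ ψ : Space N → ℝ, IsTestFunction Ω ψ → (∀ x, 0 ≤ ψ x) → (∀ x, ψ x ≤ 1) →
      ∫⁻ t, (∫⁻ x, ENNReal.ofReal (ψ x * saturation (ρ t x))) ∂timeMeasure T
        ≤ ENNReal.ofReal T * ∫⁻ t, (∫⁻ x, ‖u t x‖ₑ * ‖fderiv ℝ ψ x‖ₑ) ∂timeMeasure T)
    (hcut : ∀ ψ : Space N → ℝ, IsTestFunction Ω ψ → (∀ x, 0 ≤ ψ x) → (∀ x, ψ x ≤ 1) →
      ∀ δ : ℝ≥0∞, 0 < δ → ∃ ζ : Space N → ℝ, IsTestFunction Ω ζ ∧ (∀ x, ψ x ≤ ζ x) ∧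
        (∀ x, ζ x ≤ 1) ∧ ∫⁻ t, (∫⁻ x, ‖u t x‖ₑ * ‖fderiv ℝ ζ x‖ₑ) ∂timeMeasure T ≤ δ) :
    ∀ᵐ t ∂timeMeasure T, ∀ᵐ x ∂spaceMeasure Ω, ρ t x = 0 := by
  have hzero : ∀ ψ : Space N → ℝ, IsTestFunction Ω ψ → (∀ x, 0 ≤ ψ x) → (∀ x, ψ x ≤ 1) →
      ∀ᵐ t ∂timeMeasure T, ∀ᵐ x, ψ x * saturation (ρ t x) = 0 := by
    intro ψ hψ hψ0 hψ1
    have hlim : Tendsto (fun δ => ENNReal.ofReal T * δ) (𝓝[>] 0) (𝓝 0) := by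
      have := ENNReal.Tendsto.const_mul (tendsto_id (x := 𝓝 (0 : ℝ≥0∞)))
        (a := ENNReal.ofReal T) (Or.inr ENNReal.ofReal_ne_top)
      rw [mul_zero] at this
      exact this.mono_left nhdsWithin_le_nhds
    have h0 : ∫⁻ t, (∫⁻ x, ENNReal.ofReal (ψ x * saturation (ρ t x))) ∂timeMeasure T = 0 := by
      refine le_antisymm (ge_of_tendsto hlim ?_) zero_le
      filter_upwards [self_mem_nhdsWithin] with δ hδ
      -- Since ζ dominates ψ, the estimate for ζ bounds the integral with ψ, which does not depend
      -- on δ; letting δ tend to 0 gives zero.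
      obtain ⟨ζ, hζ, hψζ, hζ1, hζδ⟩ := hcut ψ hψ hψ0 hψ1 δ hδ
      calc ∫⁻ t, (∫⁻ x, ENNReal.ofReal (ψ x * saturation (ρ t x))) ∂timeMeasure T
          ≤ ∫⁻ t, (∫⁻ x, ENNReal.ofReal (ζ x * saturation (ρ t x))) ∂timeMeasure T := by
            gcongr with t x
            · exact saturation_nonneg _
            · exact hψζ x
        _ ≤ _ := (hest ζ hζ (fun x => (hψ0 x).trans (hψζ x)) hζ1).trans (by gcongr)
    have hmeas : Measurable fun z : ℝ × Space N =>
        ENNReal.ofReal (ψ z.2 * saturation (ρ z.1 z.2)) :=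
      (((hψ.contDiff.continuous.measurable.comp measurable_snd).mul
        (contDiff_saturation.continuous.measurable.comp hd.measurable_ρ))).ennreal_ofReal
    rw [lintegral_eq_zero_iff hmeas.lintegral_prod_right'] at h0
    filter_upwards [h0] with t ht
    have ht' := (lintegral_eq_zero_iff (hmeas.comp measurable_prodMk_left)).1 ht
    filter_upwards [ht'] with x hx
    exact le_antisymm (ENNReal.ofReal_eq_zero.1 hx) (mul_nonneg (hψ0 x) (saturation_nonneg _))
  have hloc : ∀ x ∈ Ω, ∃ ψ : Space N → ℝ, IsTestFunction Ω ψ ∧ (∀ x, 0 ≤ ψ x) ∧ (∀ x, ψ x ≤ 1) ∧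
      ψ x = 1 := by
    intro x hx
    obtain ⟨f, h1, h2, h3, h4, h5⟩ := exists_contDiff_tsupport_subset (n := ⊤) (hΩ.mem_nhds hx)
    exact ⟨f, ⟨h3, h2, h1⟩, fun y => (h4 ⟨y, rfl⟩).1, fun y => (h4 ⟨y, rfl⟩).2, h5⟩
  choose! ψ hψ hψ0 hψ1 hψx using hloc
  -- By the Lindelöf property countably many of the sets {ψ ≠ 0} cover Ω, so the exceptional null
  -- sets, in time as well as in space, can be united.
  obtain ⟨s, hsΩ, hsc, hs⟩ := TopologicalSpace.countable_cover_nhdsWithin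
    (s := Ω) (f := fun x => {y | ψ x y ≠ 0}) fun x hx =>
      mem_nhdsWithin_of_mem_nhds ((hψ x hx).contDiff.continuous.isOpen_preimage _
        isOpen_ne |>.mem_nhds (by simp [hψx x hx]))
  have hall : ∀ᵐ t ∂timeMeasure T, ∀ y ∈ s, ∀ᵐ x, ψ y x * saturation (ρ t x) = 0 :=
    (ae_ball_iff hsc).2 fun y hy =>
      hzero (ψ y) (hψ y (hsΩ hy)) (hψ0 y (hsΩ hy)) (hψ1 y (hsΩ hy))
  filter_upwards [hall] with t ht
  have ht' := (ae_ball_iff hsc).2 ht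
  filter_upwards [ae_restrict_of_ae ht', ae_restrict_mem hΩ.measurableSet] with x hx hxΩ
  obtain ⟨y, hy, hyx⟩ := Set.mem_iUnion₂.1 (hs hxΩ)
  exact saturation_eq_zero_iff.1 ((mul_eq_zero.1 (hx y hy)).resolve_left hyx)

end TransportData

/-! ### Invariance under null sets, and cutoffs for the given velocity -/

section Reduction

variable {N : ℕ} {Ω : Set (Space N)} {T : ℝ} {p q : ℝ≥0∞}

lemma locallyIntegrableOn_congr_ae {F : Type*} [NormedAddCommGroup F] {v v' : Space N → F}
    (h : LocallyIntegrableOn v Ω) (hv : v =ᵐ[spaceMeasure Ω] v') :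
    LocallyIntegrableOn v' Ω := fun x hx => by
  obtain ⟨s, hs, hint⟩ := h x hx
  exact ⟨s ∩ Ω, inter_mem hs self_mem_nhdsWithin, IntegrableOn.congr_fun_ae
    (hint.mono_set Set.inter_subset_left)
    (ae_restrict_of_ae_restrict_of_subset Set.inter_subset_right hv)⟩

lemma MemSobolevZero.congr {v v' : Space N → Space N}
    {G G' : Fin N → Space N → Space N} (h : MemSobolevZero Ω q v G)
    (hv : v =ᵐ[spaceMeasure Ω] v') (hG : ∀ i, G i =ᵐ[spaceMeasure Ω] G' i) :
    MemSobolevZero Ω q v' G' where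
  memLp := h.memLp.ae_eq hv
  memLp_deriv i := (h.memLp_deriv i).ae_eq (hG i)
  isWeakGradient :=
    { locallyIntegrableOn := locallyIntegrableOn_congr_ae h.isWeakGradient.locallyIntegrableOn hv
      locallyIntegrableOn_deriv := fun i =>
        locallyIntegrableOn_congr_ae (h.isWeakGradient.locallyIntegrableOn_deriv i) (hG i)
      integral_eq := fun i φ hφ => by
        have h1 : ∫ x in Ω, partialDeriv i φ x • v' x = ∫ x in Ω, partialDeriv i φ x • v x :=
          integral_congr_ae (by filter_upwards [hv] with x hx; rw [hx])
        have h2 : ∫ x in Ω, φ x • G' i x = ∫ x in Ω, φ x • G i x :=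
          integral_congr_ae (by filter_upwards [hG i] with x hx; rw [hx])
        rw [h1, h2]
        exact h.isWeakGradient.integral_eq i φ hφ }
  exists_approx := by
    obtain ⟨φ, hφ, hlim⟩ := h.exists_approx
    refine ⟨φ, hφ, hlim.congr fun n => ?_⟩
    unfold sobolevNorm
    congr 1
    · exact eLpNorm_congr_ae (by filter_upwards [hv] with x hx; rw [hx])
    · exact Finset.sum_congr rfl fun i _ =>
        eLpNorm_congr_ae (by filter_upwards [hG i] with x hx; rw [hx])

lemma sobolevNorm_congr {v v' : Space N → Space N} {G G' : Fin N → Space N → Space N}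
    (hv : v =ᵐ[spaceMeasure Ω] v') (hG : ∀ i, G i =ᵐ[spaceMeasure Ω] G' i) :
    sobolevNorm Ω q v G = sobolevNorm Ω q v' G' := by
  unfold sobolevNorm
  rw [eLpNorm_congr_ae hv]
  congr 1
  exact Finset.sum_congr rfl fun i _ => eLpNorm_congr_ae (hG i)

lemma IsWeaklyDivFree.congr {v v' : Space N → Space N} (h : IsWeaklyDivFree Ω v)
    (hv : v =ᵐ[spaceMeasure Ω] v') : IsWeaklyDivFree Ω v' := fun φ hφ => by
  rw [← h φ hφ]
  exact integral_congr_ae (by filter_upwards [hv] with x hx; rw [hx])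

/-- The `L¹` norm of the jet is controlled by the Sobolev norm on sets of finite measure. -/
lemma exists_lintegral_jet_le (hΩ : volume Ω ≠ ⊤) (hq : 1 ≤ q) :
    ∃ A : ℝ≥0∞, A ≠ ⊤ ∧ ∀ (v : Space N → Space N) (G : Fin N → Space N → Space N),
      AEStronglyMeasurable v (spaceMeasure Ω) →
      (∀ i, AEStronglyMeasurable (G i) (spaceMeasure Ω)) →
      ∫⁻ x, ‖((v x, fun i => G i x) : Space N × (Fin N → Space N))‖ₑ ∂spaceMeasure Ω
        ≤ sobolevNorm Ω q v G * A := by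
  set μ := spaceMeasure Ω with hμ
  have hμt : μ Set.univ ≠ ⊤ := by simpa [hμ, spaceMeasure] using hΩ
  -- The constant comes from Hölder's inequality against 1 on a set of finite measure. For q = ⊤ the
  -- conventions `toReal ⊤ = 0` and 1 / 0 = 0 make the exponent 1, as it should be.
  refine ⟨μ Set.univ ^ (1 / (1 : ℝ≥0∞).toReal - 1 / q.toReal), ?_, fun v G hv hG => ?_⟩
  · refine ENNReal.rpow_ne_top_of_nonneg ?_ hμt
    rw [ENNReal.toReal_one, div_one, sub_nonneg]
    by_cases hqt : q = ⊤
    · simp [hqt]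
    · rw [div_le_one]
      · have := ENNReal.toReal_mono hqt hq
        simpa using this
      · exact ENNReal.toReal_pos (by positivity) hqt
  · have h1 : ∀ {F : Type} [NormedAddCommGroup F] (f : Space N → F), AEStronglyMeasurable f μ →
        ∫⁻ x, ‖f x‖ₑ ∂μ ≤ eLpNorm f q μ *
          μ Set.univ ^ (1 / (1 : ℝ≥0∞).toReal - 1 / q.toReal) := by
      intro F _ f hf
      rw [← eLpNorm_one_eq_lintegral_enorm]
      exact eLpNorm_le_eLpNorm_mul_rpow_measure_univ hq hf
    calc ∫⁻ x, ‖((v x, fun i => G i x) : Space N × (Fin N → Space N))‖ₑ ∂μ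
        ≤ ∫⁻ x, (‖v x‖ₑ + ∑ i, ‖G i x‖ₑ) ∂μ := by
          refine lintegral_mono fun x => ?_
          have : ‖((v x, fun i => G i x) : Space N × (Fin N → Space N))‖
              ≤ ‖v x‖ + ∑ i, ‖G i x‖ := by
            refine norm_prod_le_iff.2 ⟨le_add_of_nonneg_right (by positivity), ?_⟩
            refine (pi_norm_le_iff_of_nonneg (by positivity)).2 fun i => ?_
            exact (Finset.single_le_sum (f := fun i => ‖G i x‖) (fun _ _ => norm_nonneg _)
              (Finset.mem_univ i)).trans (le_add_of_nonneg_left (norm_nonneg _))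
          rw [← ofReal_norm]
          refine (ENNReal.ofReal_le_ofReal this).trans (le_of_eq ?_)
          rw [ENNReal.ofReal_add (norm_nonneg _) (by positivity),
            ENNReal.ofReal_sum_of_nonneg fun _ _ => norm_nonneg _]
          simp_rw [ofReal_norm]
      _ = ∫⁻ x, ‖v x‖ₑ ∂μ + ∑ i, ∫⁻ x, ‖G i x‖ₑ ∂μ := by
          rw [lintegral_add_left' hv.enorm, lintegral_finsetSum' _ fun i _ => (hG i).enorm]
      _ ≤ _ := by
          unfold sobolevNorm
          rw [add_mul, Finset.sum_mul]
          exact add_le_add (h1 _ hv) (Finset.sum_le_sum fun i _ => h1 _ (hG i))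

/-- Cutoffs with small flux exist for Sobolev fields with vanishing trace. -/
lemma TransportData.exists_cutoff_flux_le {u : ℝ → Space N → Space N} {ρ : ℝ → Space N → ℝ}
    {g : ℝ → ℝ} {R : ℝ} (hd : TransportData T Ω u ρ g R) (hΩ : IsOpen Ω) (hΩf : volume Ω ≠ ⊤)
    (hq : 1 ≤ q) {G : ℝ → Fin N → Space N → Space N}
    (hGm : ∀ i, Measurable fun z : ℝ × Space N => G z.1 i z.2)
    (hG : ∀ᵐ t ∂timeMeasure T, MemSobolevZero Ω q (u t) (G t))
    (hGi : ∫⁻ t, sobolevNorm Ω q (u t) (G t) ∂timeMeasure T ≠ ⊤)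
    {ψ : Space N → ℝ} (hψ : IsTestFunction Ω ψ) (hψ0 : ∀ x, 0 ≤ ψ x) (hψ1 : ∀ x, ψ x ≤ 1)
    {δ : ℝ≥0∞} (hδ : 0 < δ) :
    ∃ ζ : Space N → ℝ, IsTestFunction Ω ζ ∧ (∀ x, ψ x ≤ ζ x) ∧ (∀ x, ζ x ≤ 1) ∧
      ∫⁻ t, (∫⁻ x, ‖u t x‖ₑ * ‖fderiv ℝ ζ x‖ₑ) ∂timeMeasure T ≤ δ := by
  obtain ⟨A, hA, hjet⟩ := exists_lintegral_jet_le (Ω := Ω) hΩf hq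
  let P : ℝ → Space N → Space N × (Fin N → Space N) := fun t x => (u t x, fun i => G t i x)
  have hP : Measurable (Function.uncurry P) :=
    hd.measurable_u.prodMk (measurable_pi_lambda _ hGm)
  have hut : ∀ x, Integrable (fun t => u t x) (timeMeasure T) := fun x =>
    hd.integrable_g.mono' (hd.measurable_u.comp measurable_prodMk_right).aestronglyMeasurable
      (ae_of_all _ fun t => hd.norm_u_le t x)
  have hPi : ∫⁻ t, ∫⁻ x, ‖P t x‖ₑ ∂spaceMeasure Ω ∂timeMeasure T ≠ ⊤ := by
    refine ne_top_of_le_ne_top (ENNReal.mul_ne_top hGi hA) ?_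
    rw [← lintegral_mul_const' _ _ hA]
    refine lintegral_mono_ae ?_
    filter_upwards [hG] with t ht
    exact hjet _ _ ht.memLp.1 fun i => (ht.memLp_deriv i).1
  have happ : ∀ᵐ t ∂timeMeasure T, ∀ δ > 0, ∃ ψ, IsTestFunction Ω ψ ∧
      ∫⁻ x, ‖P t x - jet ψ x‖ₑ ∂spaceMeasure Ω < δ := by
    filter_upwards [hG] with t ht δ hδ
    obtain ⟨φ, hφ, hlim⟩ := ht.exists_approx
    have hlim' := ENNReal.Tendsto.mul_const hlim (b := A) (Or.inr hA)
    rw [zero_mul] at hlim'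
    obtain ⟨n, hn⟩ := (hlim'.eventually (gt_mem_nhds hδ)).exists
    refine ⟨φ n, hφ n, lt_of_le_of_lt ?_ hn⟩
    exact hjet _ _ (ht.memLp.1.sub (hφ n).contDiff.continuous.aestronglyMeasurable)
      fun i => (ht.memLp_deriv i).1.sub ((hφ n).continuous_partialDeriv i).aestronglyMeasurable
  have hUm : Measurable fun x => ∫ t, ‖u t x‖ ∂timeMeasure T := by
    have : StronglyMeasurable fun z : Space N × ℝ => ‖u z.2 z.1‖ :=
      ((hd.measurable_u.comp measurable_swap).norm).stronglyMeasurable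
    exact this.integral_prod_right'.measurable
  -- U is the time-averaged speed, bounded by B = ∫ g thanks to the supremum bound on the velocity;
  -- h is the time average of the jet norm, and K = N comes from bounding the gradient of V by the
  -- sum of N partial derivatives.
  obtain ⟨ζ, h1, h2, h3, h4⟩ := exists_cutoff hΩf (U := fun x => ∫ t, ‖u t x‖ ∂timeMeasure T) hUm
    (fun x => integral_nonneg fun t => norm_nonneg _) (B := ∫ t, g t ∂timeMeasure T)
    (fun x => by
      rw [abs_of_nonneg (integral_nonneg fun t => norm_nonneg _)]
      exact integral_mono (hut x).norm hd.integrable_g fun t => hd.norm_u_le t x)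
    (h := fun x => ∫⁻ t, ‖P t x‖ₑ ∂timeMeasure T)
    (Measurable.lintegral_prod_left' (f := fun z : ℝ × Space N => ‖P z.1 z.2‖ₑ) hP.enorm)
    (by
      have hPs : AEMeasurable (Function.uncurry fun x t => ‖P t x‖ₑ)
          ((spaceMeasure Ω).prod (timeMeasure T)) := (hP.enorm.comp measurable_swap).aemeasurable
      rwa [lintegral_lintegral_swap hPs]) (K := N)
    (fun δ hδ => by
      obtain ⟨V, hV, e, hem, hei, hVU, hVd⟩ :=
        exists_testFunction_near_average hP hPi (fun x => hut x) happ hδ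
      exact ⟨V, hV, e, hem, hei, hVU, fun x => by simpa using hVd x⟩)
    hψ hψ0 hψ1 hδ
  -- Since ζ does not depend on time, Tonelli turns its space-time flux into the integral of U |∇ζ|.
  refine ⟨ζ, h1, h2, h3, le_trans (le_of_eq ?_) h4⟩
  have hm : Measurable fun z : ℝ × Space N => ‖u z.1 z.2‖ₑ * ‖fderiv ℝ ζ z.2‖ₑ :=
    hd.measurable_u.enorm.mul
      ((h1.contDiff.continuous_fderiv (by simp)).enorm.measurable.comp measurable_snd)
  rw [lintegral_lintegral_swap hm.aemeasurable]
  have hsupp : ∀ x, x ∉ Ω →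
      ∫⁻ t, ‖u t x‖ₑ * ‖fderiv ℝ ζ x‖ₑ ∂timeMeasure T = 0 := fun x hx => by
    simp [hd.u_eq_zero _ x hx]
  have hset : ∫⁻ x, (∫⁻ t, ‖u t x‖ₑ * ‖fderiv ℝ ζ x‖ₑ ∂timeMeasure T)
      = ∫⁻ x in Ω, (∫⁻ t, ‖u t x‖ₑ * ‖fderiv ℝ ζ x‖ₑ ∂timeMeasure T) := by
    rw [← lintegral_indicator hΩ.measurableSet]
    refine lintegral_congr fun x => ?_
    by_cases hx : x ∈ Ω
    · rw [Set.indicator_of_mem hx]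
    · rw [Set.indicator_of_notMem hx, hsupp x hx]
  rw [hset]
  refine lintegral_congr fun x => ?_
  have hux : Measurable fun t => ‖u t x‖ₑ := (hd.measurable_u.comp measurable_prodMk_right).enorm
  rw [lintegral_mul_const _ hux, ← ofReal_norm (∫ t, ‖u t x‖ ∂timeMeasure T),
    Real.norm_of_nonneg (integral_nonneg fun t => norm_nonneg _),
    ofReal_integral_eq_lintegral_ofReal (hut x).norm (ae_of_all _ fun t => norm_nonneg _)]
  simp_rw [ofReal_norm]

end Reduction

/-! ### Measurable representatives and the uniqueness theorem -/

section Representatives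

variable {N : ℕ} {Ω : Set (Space N)} {T : ℝ} {p q : ℝ≥0∞}

/-- A field that is jointly measurable up to null sets has a jointly measurable version. -/
lemma exists_measurable_ae_eq {F : Type*} [NormedAddCommGroup F] [MeasurableSpace F] [BorelSpace F]
    {f : ℝ → Space N → F}
    (hf : AEStronglyMeasurable (fun z : ℝ × Space N => f z.1 z.2)
      ((timeMeasure T).prod (spaceMeasure Ω))) :
    ∃ f' : ℝ → Space N → F, Measurable (Function.uncurry f') ∧
      ∀ᵐ t ∂timeMeasure T, f t =ᵐ[spaceMeasure Ω] f' t :=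
  ⟨fun t x => hf.mk _ (t, x), hf.stronglyMeasurable_mk.measurable,
    Measure.ae_ae_of_ae_prod hf.ae_eq_mk⟩

/-- A velocity in `L¹(0,T; C(Ω̄))` has a measurable version with an everywhere valid bound. -/
lemma exists_velocity_representative (hΩ : IsOpen Ω) (hΩf : volume Ω ≠ ⊤)
    {u : ℝ → Space N → Space N}
    (hu : AEStronglyMeasurable (fun z : ℝ × Space N => u z.1 z.2)
      ((timeMeasure T).prod (spaceMeasure Ω)))
    (huc : MemL1ContinuousClosure T Ω u) :
    ∃ (u' : ℝ → Space N → Space N) (g : ℝ → ℝ), Measurable (Function.uncurry u') ∧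
      (∀ t, ∀ x ∉ Ω, u' t x = 0) ∧ Integrable g (timeMeasure T) ∧ (∀ t x, ‖u' t x‖ ≤ g t) ∧
      (∀ t, Integrable (u' t)) ∧ ∀ᵐ t ∂timeMeasure T, u t =ᵐ[spaceMeasure Ω] u' t := by
  classical
  obtain ⟨v, hvm, hv⟩ := exists_measurable_ae_eq hu
  obtain ⟨w, hwi, hw⟩ := huc
  have hwm := hwi.norm.aestronglyMeasurable
  let g : ℝ → ℝ := fun t => |hwm.mk _ t|
  have hgm : Measurable g := hwm.stronglyMeasurable_mk.norm.measurable
  have hgw : ∀ᵐ t ∂timeMeasure T, ‖w t‖ = g t := by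
    filter_upwards [hwm.ae_eq_mk] with t ht
    simp only [g, ← ht, abs_norm]
  have hg0 : ∀ t, 0 ≤ g t := fun t => abs_nonneg _
  -- Cutting the version v to zero where it exceeds g makes the bound valid at every point. For
  -- almost every t this changes v only on a null subset of Ω, because there u(t) agrees with w t,
  -- of norm at most g t.
  let S : Set (ℝ × Space N) := {z | z.2 ∈ Ω} ∩ {z | ‖v z.1 z.2‖ ≤ g z.1}
  have hS : MeasurableSet S := (measurable_snd hΩ.measurableSet).inter
    (measurableSet_le hvm.norm (hgm.comp measurable_fst))
  let u' : ℝ → Space N → Space N := fun t x => S.indicator (Function.uncurry v) (t, x)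
  have hum : Measurable (Function.uncurry u') := hvm.indicator hS
  have hu0 : ∀ t, ∀ x ∉ Ω, u' t x = 0 := fun t x hx =>
    Set.indicator_of_notMem (fun h => hx h.1) _
  have hule : ∀ t x, ‖u' t x‖ ≤ g t := fun t x => by
    by_cases h : (t, x) ∈ S
    · simp only [u', Set.indicator_of_mem h]
      exact h.2
    · simp only [u', Set.indicator_of_notMem h, norm_zero, hg0]
  refine ⟨u', g, hum, hu0, hwi.norm.congr hgw, hule, fun t => ?_, ?_⟩
  · have h1 : Integrable (Ω.indicator fun _ => g t) :=
      (integrable_indicator_iff hΩ.measurableSet).2 (integrableOn_const hΩf)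
    refine h1.mono' (hum.comp measurable_prodMk_left).aestronglyMeasurable (ae_of_all _ fun x => ?_)
    by_cases hx : x ∈ Ω
    · rw [Set.indicator_of_mem hx]
      exact hule t x
    · rw [Set.indicator_of_notMem hx, hu0 t x hx, norm_zero]
  · filter_upwards [hv, hw, hgw] with t h1 h2 h3
    filter_upwards [h1, h2, ae_restrict_mem hΩ.measurableSet] with x h4 h5 hx
    have hmem : (t, x) ∈ S := by
      refine ⟨hx, ?_⟩
      change ‖v t x‖ ≤ g t
      rw [← h4, h5 hx, ← h3]
      exact (w t).norm_coe_le_norm _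
    simp only [u', Set.indicator_of_mem hmem]
    exact h4

/-- A density in `L^∞(0,T; L^p(Ω))` has a measurable version with an everywhere valid bound. -/
lemma exists_density_representative (hΩ : IsOpen Ω) {ρ : ℝ → Space N → ℝ}
    (hρ : MemLinftyLp T Ω p ρ) :
    ∃ (ρ' : ℝ → Space N → ℝ) (C : ℝ≥0), Measurable (Function.uncurry ρ') ∧
      (∀ t, ∀ x ∉ Ω, ρ' t x = 0) ∧ (∀ t, eLpNorm (ρ' t) p volume ≤ C) ∧
      ∀ᵐ t ∂timeMeasure T, ρ t =ᵐ[spaceMeasure Ω] ρ' t := by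
  obtain ⟨hm, C, hC⟩ := hρ
  obtain ⟨σ, hσm, hσ⟩ := exists_measurable_ae_eq hm
  have hbad : ∀ᵐ t ∂timeMeasure T, eLpNorm (σ t) p (spaceMeasure Ω) ≤ C := by
    filter_upwards [hC, hσ] with t h1 h2
    rwa [← eLpNorm_congr_ae h2]
  -- The times that violate the bound are enlarged to a measurable null set, on which the density is
  -- replaced by zero without losing joint measurability.
  let B := toMeasurable (timeMeasure T) {t | ¬ eLpNorm (σ t) p (spaceMeasure Ω) ≤ C}
  have hB0 : timeMeasure T B = 0 := (measure_toMeasurable _).trans hbad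
  have hB : ∀ t ∉ B, eLpNorm (σ t) p (spaceMeasure Ω) ≤ C := fun t ht => by
    by_contra h
    exact ht (subset_toMeasurable _ _ h)
  let S : Set (ℝ × Space N) := Bᶜ ×ˢ Ω
  have hS : MeasurableSet S :=
    (measurableSet_toMeasurable _ _).compl.prod hΩ.measurableSet
  refine ⟨fun t x => S.indicator (Function.uncurry σ) (t, x), C, hσm.indicator hS,
    fun t x hx => Set.indicator_of_notMem (fun h => hx h.2) _, fun t => ?_, ?_⟩
  · by_cases ht : t ∈ B
    · have : (fun x => S.indicator (Function.uncurry σ) (t, x)) = 0 :=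
        funext fun x => Set.indicator_of_notMem (fun h => h.1 ht) _
      beta_reduce
      rw [this, eLpNorm_zero]
      exact zero_le
    · have : (fun x => S.indicator (Function.uncurry σ) (t, x)) = Ω.indicator (σ t) := by
        funext x
        by_cases hx : x ∈ Ω
        · rw [Set.indicator_of_mem hx, Set.indicator_of_mem (show (t, x) ∈ S from ⟨ht, hx⟩)]
          rfl
        · rw [Set.indicator_of_notMem hx, Set.indicator_of_notMem fun h => hx h.2]
      beta_reduce
      rw [this, eLpNorm_indicator_eq_eLpNorm_restrict hΩ.measurableSet]
      exact hB t ht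
  · have hBae : ∀ᵐ t ∂timeMeasure T, t ∉ B := measure_eq_zero_iff_ae_notMem.1 hB0
    filter_upwards [hσ, hBae] with t h1 h2
    filter_upwards [h1, ae_restrict_mem hΩ.measurableSet] with x h3 hx
    rw [h3, Set.indicator_of_mem (show (t, x) ∈ S from ⟨h2, hx⟩)]
    rfl

/-- On sets of finite measure, `L^p` bounds give `L¹` bounds. -/
lemma exists_integral_norm_le (hΩf : volume Ω ≠ ⊤) (hp : 1 ≤ p)
    {ρ : ℝ → Space N → ℝ} (hρm : Measurable (Function.uncurry ρ))
    (hρ0 : ∀ t, ∀ x ∉ Ω, ρ t x = 0) {C : ℝ≥0} (hC : ∀ t, eLpNorm (ρ t) p volume ≤ C) :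
    (∀ t, Integrable (ρ t)) ∧ ∃ R : ℝ, ∀ t, ∫ x, ‖ρ t x‖ ≤ R := by
  have : IsFiniteMeasure (spaceMeasure Ω) := ⟨by
    simpa [spaceMeasure] using hΩf.lt_top⟩
  have hsl : ∀ t, AEStronglyMeasurable (ρ t) (spaceMeasure Ω) := fun t =>
    (hρm.comp measurable_prodMk_left).aestronglyMeasurable
  have hp1 : ∀ t, eLpNorm (ρ t) p (spaceMeasure Ω) ≤ C := fun t =>
    (eLpNorm_mono_measure _ Measure.restrict_le_self).trans (hC t)
  have hint : ∀ t, Integrable (ρ t) (spaceMeasure Ω) := fun t =>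
    MemLp.integrable hp ⟨hsl t, (hp1 t).trans_lt ENNReal.coe_lt_top⟩
  refine ⟨fun t => (integrableOn_iff_integrable_of_support_subset fun x hx => ?_).1 (hint t), ?_⟩
  · by_contra h
    exact hx (hρ0 t x h)
  · have he : 0 ≤ 1 / (1 : ℝ≥0∞).toReal - 1 / p.toReal := by
      rw [ENNReal.toReal_one, div_one, sub_nonneg]
      by_cases hpt : p = ⊤
      · simp [hpt]
      · have h1 := ENNReal.toReal_mono hpt hp
        rw [ENNReal.toReal_one] at h1
        exact (div_le_one (by linarith)).2 h1
    set A := (C : ℝ≥0∞) *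
      spaceMeasure Ω Set.univ ^ (1 / (1 : ℝ≥0∞).toReal - 1 / p.toReal) with hA
    have hAt : A ≠ ⊤ := ENNReal.mul_ne_top ENNReal.coe_ne_top
      (ENNReal.rpow_ne_top_of_nonneg he (measure_ne_top _ _))
    refine ⟨A.toReal, fun t => ?_⟩
    rw [← setIntegral_eq_integral_of_forall_compl_eq_zero (s := Ω)
      (fun x hx => by rw [hρ0 t x hx, norm_zero]), integral_norm_eq_lintegral_enorm (hsl t)]
    refine ENNReal.toReal_mono hAt ?_
    rw [← eLpNorm_one_eq_lintegral_enorm]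
    refine (eLpNorm_le_eLpNorm_mul_rpow_measure_univ hp (hsl t)).trans ?_
    exact mul_le_mul_left (hp1 t) _

lemma isSpaceTimeTestFunction_mul {θ : ℝ → ℝ} (hθ : ContDiff ℝ ∞ θ) (hθc : HasCompactSupport θ)
    (hθT : tsupport θ ⊆ Set.Iio T) {χ : Space N → ℝ} (hχ : IsTestFunction Ω χ) :
    IsSpaceTimeTestFunction T Ω fun z => θ z.1 * χ z.2 := by
  have hsub : tsupport (fun z : ℝ × Space N => θ z.1 * χ z.2) ⊆ tsupport θ ×ˢ tsupport χ := by
    refine closure_minimal (fun z hz => ?_)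
      ((isClosed_tsupport θ).prod (isClosed_tsupport χ))
    rw [Function.mem_support] at hz
    exact ⟨subset_tsupport _ (left_ne_zero_of_mul hz), subset_tsupport _ (right_ne_zero_of_mul hz)⟩
  exact
    { contDiff := (hθ.comp contDiff_fst).mul (hχ.contDiff.comp contDiff_snd)
      hasCompactSupport := (hθc.isCompact.prod hχ.hasCompactSupport.isCompact).of_isClosed_subset
        (isClosed_tsupport _) hsub
      tsupport_subset := hsub.trans (Set.prod_mono hθT hχ.tsupport_subset) }

/-- The weak formulation, tested with products, for versions of the density and the velocity. -/
lemma IsWeakSolution.weak_eq_mul {u u' : ℝ → Space N → Space N} {ρ ρ' : ℝ → Space N → ℝ}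
    (h : IsWeakSolution T Ω p u (fun _ => 0) ρ)
    (hu : ∀ᵐ t ∂timeMeasure T, u t =ᵐ[spaceMeasure Ω] u' t)
    (hρ : ∀ᵐ t ∂timeMeasure T, ρ t =ᵐ[spaceMeasure Ω] ρ' t) (hρ0 : ∀ t, ∀ x ∉ Ω, ρ' t x = 0)
    {θ : ℝ → ℝ} (hθ : ContDiff ℝ ∞ θ) (hθc : HasCompactSupport θ) (hθT : tsupport θ ⊆ Set.Iio T)
    {χ : Space N → ℝ} (hχ : IsTestFunction Ω χ) :
    ∫ t in Set.Ioo 0 T, deriv θ t * ∫ x, ρ' t x * χ x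
      = ∫ t in Set.Ioo 0 T, θ t * ∫ x, ρ' t x * fderiv ℝ χ x (u' t x) := by
  have hw := h.weak_eq _ (isSpaceTimeTestFunction_mul hθ hθc hθT hχ)
  -- The initial term disappears because the initial density is zero, although θ 0 may be nonzero;
  -- this is where the initial condition enters.
  simp only [zero_mul, integral_zero, sub_zero] at hw
  have h1 : ∫ t in Set.Ioo 0 T, deriv θ t * ∫ x, ρ' t x * χ x
      = ∫ t in Set.Ioo 0 T, ∫ x in Ω, ρ t x * deriv (fun s => θ s * χ x) t := by
    refine integral_congr_ae ?_
    filter_upwards [hρ] with t ht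
    rw [← setIntegral_eq_integral_of_forall_compl_eq_zero (s := Ω)
      (fun x hx => by rw [hρ0 t x hx, zero_mul]), ← integral_const_mul]
    refine integral_congr_ae ?_
    filter_upwards [ht] with x hx
    rw [hx, deriv_mul_const ((hθ.differentiable (by simp)) t)]
    ring
  have h2 : ∫ t in Set.Ioo 0 T, θ t * ∫ x, ρ' t x * fderiv ℝ χ x (u' t x)
      = ∫ t in Set.Ioo 0 T, ∫ x in Ω, ρ t x * fderiv ℝ (fun y => θ t * χ y) x (u t x) := by
    refine integral_congr_ae ?_
    filter_upwards [hρ, hu] with t ht hut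
    rw [← setIntegral_eq_integral_of_forall_compl_eq_zero (s := Ω)
      (fun x hx => by rw [hρ0 t x hx, zero_mul]), ← integral_const_mul]
    refine integral_congr_ae ?_
    filter_upwards [ht, hut] with x hx hux
    rw [hx, hux, fderiv_const_mul ((hχ.contDiff.differentiable (by simp)) x)]
    simp only [smul_apply, smul_eq_mul]
    ring
  rw [h1, h2]
  linarith

/-- Weak solutions with vanishing initial density vanish. -/
theorem ae_eq_zero_of_isWeakSolution (hT : 0 < T)
    (hΩ : IsBoundedDomain Ω)
    (hp : 1 < p) (hpq : p.HolderConjugate q)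
    {u : ℝ → Space N → Space N}
    (hu_sobolev : MemL1SobolevZero T Ω q u)
    (hu_cont : MemL1ContinuousClosure T Ω u)
    (hu_div : ∀ᵐ t ∂timeMeasure T, IsWeaklyDivFree Ω (u t))
    {ρ : ℝ → Space N → ℝ}
    (hρ : IsWeakSolution T Ω p u (fun _ => 0) ρ) :
    ∀ᵐ t ∂timeMeasure T, ∀ᵐ x ∂spaceMeasure Ω, ρ t x = 0 := by
  have := hpq
  have hq : 1 ≤ q := ENNReal.HolderConjugate.one_le q p
  have hΩo := hΩ.isOpen
  have hΩf : volume Ω ≠ ⊤ := hΩ.isBounded.measure_lt_top.ne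
  obtain ⟨hum, G, hGm, hG, hGi⟩ := hu_sobolev
  obtain ⟨u', g, hum', hu0, hg, hug, hui, huu⟩ :=
    exists_velocity_representative hΩo hΩf hum hu_cont
  obtain ⟨ρ', C, hρm, hρ0, hρC, hρρ⟩ := exists_density_representative hΩo hρ.memLinftyLp
  obtain ⟨hρi, R, hR⟩ := exists_integral_norm_le hΩf hp.le hρm hρ0 hρC
  choose G' hGm' hGG using fun i =>
    exists_measurable_ae_eq (f := fun t x => G t i x) (hGm i)
  have hGG' := ae_all_iff.2 hGG
  have hd : TransportData T Ω u' ρ' g R :=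
    { measurable_u := hum'
      measurable_ρ := hρm
      u_eq_zero := hu0
      integrable_g := hg
      norm_u_le := hug
      integrable_u := hui
      integrable_ρ := hρi
      integral_ρ_le := hR
      divFree := by
        filter_upwards [hu_div, huu] with t h1 h2
        exact h1.congr h2
      weak_eq := fun θ h1 h2 h3 χ h4 => hρ.weak_eq_mul huu hρρ hρ0 h1 h2 h3 h4 }
  have hG' : ∀ᵐ t ∂timeMeasure T, MemSobolevZero Ω q (u' t) (fun i => G' i t) := by
    filter_upwards [hG, huu, hGG'] with t h1 h2 h3
    exact h1.congr h2 h3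
  have hGi' : ∫⁻ t, sobolevNorm Ω q (u' t) (fun i => G' i t) ∂timeMeasure T ≠ ⊤ := by
    refine ne_of_eq_of_ne (lintegral_congr_ae ?_) hGi.ne
    filter_upwards [huu, hGG'] with t h2 h3
    exact (sobolevNorm_congr h2 h3).symm
  have hzero := hd.ae_eq_zero_of_cutoff hΩo
    (fun ψ h h0 h1 => hd.lintegral_saturation_le (p := p) (q := q) hT hΩo hG' hGi' hρC h h0 h1)
    (fun ψ h h0 h1 δ hδ => hd.exists_cutoff_flux_le hΩo hΩf hq
      (G := fun t i => G' i t) hGm' hG' hGi' h h0 h1 hδ)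
  filter_upwards [hzero, hρρ] with t h1 h2
  filter_upwards [h1, h2] with x h3 h4
  rw [h4, h3]

end Representatives

end Transport

theorem mainTheorem2 {N : ℕ} (T : ℝ) (hT : 0 < T)
    (Ω : Set (Transport.Space N)) (hΩ : Transport.IsBoundedDomain Ω)
    (p q : ℝ≥0∞) (hp : 1 < p) (hpq : p.HolderConjugate q)
    (u : ℝ → Transport.Space N → Transport.Space N)
    (hu_sobolev : Transport.MemL1SobolevZero T Ω q u)
    (hu_cont : Transport.MemL1ContinuousClosure T Ω u)
    (hu_div : ∀ᵐ t ∂Transport.timeMeasure T, Transport.IsWeaklyDivFree Ω (u t))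
    (ρ : ℝ → Transport.Space N → ℝ)
    (hρ : Transport.IsWeakSolution T Ω p u (fun _ => 0) ρ) :
    ∀ᵐ t ∂Transport.timeMeasure T, ∀ᵐ x ∂Transport.spaceMeasure Ω, ρ t x = 0 :=
  Transport.ae_eq_zero_of_isWeakSolution hT hΩ hp hpq hu_sobolev hu_cont hu_div hρ
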